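/- **Setting.** Let $M$ be a smooth Lorentzian manifold of dimension $n\ge 4$ (signature $(-,+,\dots,+)$) with metric $g_{\alpha\beta}$ and Levi-Civita connection $\nabla$, let $A_\alpha$ be a smooth 1-form and $F_{\alpha\beta}=\nabla_\alpha A_\beta-\nabla_\beta A_\alpha$. Let $k^\alpha$ be a smooth Killing field with $\mathcal L_kA=0$. Fix real numbers $m\ge 0$, $q$, $\mathcal E$. A *worldline of $M$* (mass $m$, charge $q$) is a smooth curve $\gamma$ on an open interval with $\dot\gamma^\alpha\nabla_\alpha\dot\gamma^\beta=qF^\beta{}_\lambda\dot\gamma^\lambda$ and $\dot\gamma^\alpha\dot\gamma_\alpha=-m^2$; its total energy is $-k_\alpha(\dot\gamma^\alpha+qA^\alpha)$. Put $\mathcal E_k=\mathcal E+q\,k_\alpha A^\alpha$. Let $S$ be an immersed timelike hypersurface (without boundary) of $M$, with induced metric $h$ and its Levi-Civita connection $\mathcal D$; let $\kappa$ be the orthogonal projection of $k$ to $TS$ and $\kappa^2=\kappa_\alpha\kappa^\alpha$. A curve or tangent vector of the immersed hypersurface is one of the manifold $S$, transported to $M$ by the immersion. For a local smooth unit normal field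 $n^\alpha$ of $S$ let $\chi(v,w)=g(\nabla_v n,w)$ for $v,w$ tangent to $S$. A *worldline of $S$* (charge $q$) is a smooth curve in $S$, on an open interval, satisfying $\dot\gamma^\alpha\mathcal D_\alpha\dot\gamma^\beta=q\,h^{\beta\gamma}F_{\gamma\lambda}\dot\gamma^\lambda$. Call $v\in T_pS$ *admissible* if $v^\alpha v_\alpha=-m^2$ and $v^\alpha\kappa_\alpha=-\mathcal E_k(p)$. $S$ is a *massive particle surface* for $m,q,\mathcal E$ if it is nowhere orthogonal to $k$ and for every $p\in S$ and every admissible $v\in T_pS$ there is a curve $\gamma$ in $S$, defined on an open interval around $0$, with $\gamma(0)=p$ and $\dot\gamma(0)=v$, which is a worldline of $M$ with mass $m$, charge $q$ and total energy $\mathcal E$. **Theorem.** Suppose that $k$ is nowhere orthogonal to $S$ (that is, $\kappa\ne0$ everywhere on $S$) and that $\mathcal E_k\neq0$ and $\kappa^2>-\mathcal E_k^2/m^2$ everywhere on $S$ (no condition on $\kappa^2$ if $m=0$; the value $\kappa^2=0$ is allowed). Then the following are equivalent: (i) $S$ is a massive particle surface for $m,q,\mathcal E$; (ii) for every local unit normal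 field, every $p$ in its domain and every admissible $v\in T_pS$, $\ \chi_{\alpha\beta}v^\alpha v^\beta=-q\,n^\beta F_{\beta\lambda}v^\lambda$; (iii) for every local unit normal field, at every point of its domain, $$\chi_{\alpha\beta}=\frac{\chi_\tau}{n-2}H_{\alpha\beta}+\frac{q}{\mathcal E_k}\mathcal F_{\alpha\beta},\qquad H_{\alpha\beta}=h_{\alpha\beta}+\frac{m^2}{\mathcal E_k^2}\kappa_\alpha\kappa_\beta,\qquad \mathcal F_{\alpha\beta}=\tfrac12\,(n^\rho F_{\rho\alpha}\kappa_\beta+n^\rho F_{\rho\beta}\kappa_\alpha)$$ on $TS$, where $\chi_\tau=\frac{n-2}{H}\bigl(\chi-q\mathcal F/\mathcal E_k\bigr)$ and $H,\chi,\mathcal F$ denote the traces of $H_{\alpha\beta},\chi_{\alpha\beta},\mathcal F_{\alpha\beta}$ with respect to $h$; (iv) every worldline of $S$ of charge $q$ whose velocity is admissible at some point is a worldline of $M$ with mass $m$ and charge $q$. -/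

import Mathlib

open Set Manifold Bundle
open scoped ContDiff Manifold

noncomputable section

namespace ChargedSurface

/-- The model space `ℝᵈ`. Every tangent space of a `d`-manifold is a copy of it: `T_x` is
identified with `ℝᵈ` through the preferred chart at `x`. -/
abbrev Vec (d : ℕ) : Type := EuclideanSpace ℝ (Fin d)

/-- The `i`-th standard basis vector of `ℝᵈ`. -/
abbrev basisVec {d : ℕ} (i : Fin d) : Vec d := EuclideanSpace.single i 1

section LinearAlgebra

variable {d : ℕ}

/-- The matrix `B_{ij} = B(e_i, e_j)` of a bilinear form. -/
def gram (B : Vec d →L[ℝ] Vec d →L[ℝ] ℝ) : Matrix (Fin d) (Fin d) ℝ :=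
  Matrix.of fun i j => B (basisVec i) (basisVec j)

/-- Raising an index: for a nondegenerate symmetric `B` and a covector `a`, the vector
`B^{ij} a_j`, characterised by `B (sharp B a) w = a w` for all `w`. -/
def sharp (B : Vec d →L[ℝ] Vec d →L[ℝ] ℝ) (a : Vec d → ℝ) : Vec d :=
  WithLp.toLp 2 fun i => ∑ j, (gram B)⁻¹ i j * a (basisVec j)

/-- The trace `T^α_α = B^{ij} T_{ij}` of a covariant 2-tensor with respect to the
nondegenerate form `B`. -/
def traceWith (B : Vec d →L[ℝ] Vec d →L[ℝ] ℝ) (T : Vec d → Vec d → ℝ) : ℝ :=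
  ∑ i, ∑ j, (gram B)⁻¹ i j * T (basisVec i) (basisVec j)

/-- A symmetric bilinear form of signature `(-,+,…,+)`: there is a vector on which it is
negative and on whose orthogonal complement it is positive definite. -/
structure IsLorentzForm (B : Vec d →L[ℝ] Vec d →L[ℝ] ℝ) : Prop where
  symm : ∀ v w, B v w = B w v
  signature : ∃ t, B t t < 0 ∧ ∀ v, B t v = 0 → v ≠ 0 → 0 < B v v

end LinearAlgebra

section Manifolds

variable {d : ℕ} {X : Type*} [TopologicalSpace X] [ChartedSpace (Vec d) X]

/-- Vector fields on `X` (no regularity imposed). -/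
abbrev VField (d : ℕ) (X : Type*) [TopologicalSpace X] [ChartedSpace (Vec d) X] : Type _ :=
  ∀ x : X, TangentSpace (𝓡 d) x

/-- Covector fields on `X` (no regularity imposed). -/
abbrev OneTensor (d : ℕ) (X : Type*) [TopologicalSpace X] [ChartedSpace (Vec d) X] : Type _ :=
  ∀ x : X, TangentSpace (𝓡 d) x →L[ℝ] ℝ

/-- Fields of bilinear forms on `X` (no regularity imposed). -/
abbrev TwoTensor (d : ℕ) (X : Type*) [TopologicalSpace X] [ChartedSpace (Vec d) X] : Type _ :=
  ∀ x : X, TangentSpace (𝓡 d) x →L[ℝ] TangentSpace (𝓡 d) x →L[ℝ] ℝ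

variable [IsManifold (𝓡 d) ∞ X]

/-- A smooth vector field. -/
def IsSmoothVField (k : VField d X) : Prop :=
  ContMDiff (𝓡 d) (𝓡 d).tangent ∞ fun x => (⟨x, k x⟩ : TangentBundle (𝓡 d) X)

/-- A smooth 1-form, as a section of `Hom(TX, ℝ)`. -/
def IsSmoothOneTensor (A : OneTensor d X) : Prop :=
  ContMDiff (𝓡 d) ((𝓡 d).prod 𝓘(ℝ, Vec d →L[ℝ] ℝ)) ∞
    fun x => TotalSpace.mk' (Vec d →L[ℝ] ℝ)
      (E := fun x : X => TangentSpace (𝓡 d) x →L[ℝ] ℝ) x (A x)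

/-- A smooth 2-tensor, as a section of `Hom(TX, Hom(TX, ℝ))`. -/
def IsSmoothTwoTensor (g : TwoTensor d X) : Prop :=
  ContMDiff (𝓡 d) ((𝓡 d).prod 𝓘(ℝ, Vec d →L[ℝ] Vec d →L[ℝ] ℝ)) ∞
    fun x => TotalSpace.mk' (Vec d →L[ℝ] Vec d →L[ℝ] ℝ)
      (E := fun x : X => TangentSpace (𝓡 d) x →L[ℝ] TangentSpace (𝓡 d) x →L[ℝ] ℝ) x (g x)

/-- A smooth Lorentzian metric. -/
structure IsLorentzMetric (g : TwoTensor d X) : Prop where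
  smooth : IsSmoothTwoTensor g
  lorentz : ∀ x, IsLorentzForm (g x)

/-- The components of a 2-tensor in the preferred chart at `x₀`, as a function of the
coordinates `y`. -/
def localTwo (g : TwoTensor d X) (x₀ : X) (y : Vec d) : Vec d →L[ℝ] Vec d →L[ℝ] ℝ :=
  let x := (extChartAt (𝓡 d) x₀).symm y
  ContinuousLinearMap.bilinearComp (g x)
    (tangentCoordChange (𝓡 d) x₀ x x) (tangentCoordChange (𝓡 d) x₀ x x)

/-- The components of a 1-form in the preferred chart at `x₀`, as a function of the
coordinates `y`. -/
def localOne (A : OneTensor d X) (x₀ : X) (y : Vec d) : Vec d →L[ℝ] ℝ :=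
  let x := (extChartAt (𝓡 d) x₀).symm y
  ContinuousLinearMap.comp (A x) (tangentCoordChange (𝓡 d) x₀ x x)

/-- The Christoffel symbols of the Levi-Civita connection of `g`, at the point `x` and in the
preferred chart at `x`:
`Γ(u,v)^i = ½ g^{ij} (∂_u g_{vj} + ∂_v g_{uj} - ∂_j g_{uv})`. -/
def christoffel (g : TwoTensor d X) (x : X) (u v : Vec d) : Vec d :=
  let Dg := fderiv ℝ (localTwo g x) (extChartAt (𝓡 d) x x)
  sharp (g x) fun w => (1 / 2 : ℝ) * (Dg u v w + Dg v u w - Dg w u v)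

/-- The covariant derivative `∇_u A` of a 1-form, evaluated on `w`:
`(∇_u A)(w) = (∂_u A)(w) - A(Γ(u,w))`. -/
def covDerivOne (g : TwoTensor d X) (A : OneTensor d X) (x : X) (u w : Vec d) : ℝ :=
  fderiv ℝ (localOne A x) (extChartAt (𝓡 d) x x) u w - A x (christoffel g x u w)

/-- The electromagnetic field `F_{αβ} = ∇_α A_β - ∇_β A_α`. -/
def fieldStrength (g : TwoTensor d X) (A : OneTensor d X) (x : X) (u w : Vec d) : ℝ :=
  covDerivOne g A x u w - covDerivOne g A x w u

variable {d' : ℕ} {Y : Type*} [TopologicalSpace Y] [ChartedSpace (Vec d') Y]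

/-- The Levi-Civita covariant derivative `∇_u V` at `p` of a vector field `V` along a map
`f : Y → X` in the direction `u ∈ T_p Y`. In the preferred chart at `f p`:
`∇_u V = ∂_u V + Γ(df(u), V)`. -/
def covDerivAlong (g : TwoTensor d X) (f : Y → X) (V : ∀ q : Y, TangentSpace (𝓡 d) (f q))
    (p : Y) (u : Vec d') : Vec d :=
  let dV : Vec d := mfderiv (𝓡 d') 𝓘(ℝ, Vec d)
    (fun q => (tangentCoordChange (𝓡 d) (f q) (f p) (f q) (V q) : Vec d)) p u
  dV + christoffel g (f p) (mfderiv (𝓡 d') (𝓡 d) f p u) (V p)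

/-- The velocity of a curve. -/
def velocity (c : ℝ → X) (s : ℝ) : TangentSpace (𝓡 d) (c s) :=
  mfderiv 𝓘(ℝ, ℝ) (𝓡 d) c s (1 : ℝ)

/-- The covariant acceleration `∇_ċ ċ` of a curve, in the preferred chart at `c s`:
`(∇_ċ ċ) = d ċ / ds + Γ(ċ, ċ)`. -/
def acceleration (g : TwoTensor d X) (c : ℝ → X) (s : ℝ) : Vec d :=
  deriv (fun t => (tangentCoordChange (𝓡 d) (c t) (c s) (c t) (velocity c t) : Vec d)) s +
    christoffel g (c s) (velocity c s) (velocity c s)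

/-- `c`, restricted to the parameter interval `J`, is a smooth curve solving the Lorentz force
equation `∇_ċ ċ^β = q F^β_λ ċ^λ` for the metric `g` and the 2-form `F`. -/
structure SolvesLorentzForce (g : TwoTensor d X) (F : X → Vec d → Vec d → ℝ) (q : ℝ)
    (c : ℝ → X) (J : Set ℝ) : Prop where
  smooth : ContMDiffOn 𝓘(ℝ, ℝ) (𝓡 d) ∞ c J
  force : ∀ s ∈ J, acceleration g c s = q • sharp (g (c s)) fun w => F (c s) w (velocity c s)

/-- `c`, restricted to `J`, is a worldline of a particle of charge `q` and mass `m`: it solves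
the Lorentz force equation and `ċ^α ċ_α = -m²`. -/
structure IsWorldline (g : TwoTensor d X) (F : X → Vec d → Vec d → ℝ) (m q : ℝ)
    (c : ℝ → X) (J : Set ℝ) : Prop extends SolvesLorentzForce g F q c J where
  mass : ∀ s ∈ J, g (c s) (velocity c s) (velocity c s) = -m ^ 2

/-- `k` is a Killing field of `g`: `∇_α k_β + ∇_β k_α = 0`. -/
def IsKilling (g : TwoTensor d X) (k : VField d X) : Prop :=
  ∀ (x : X) (u w : Vec d), g x (covDerivAlong g id k x u) w + g x (covDerivAlong g id k x w) u = 0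

/-- The 1-form `A` is invariant under `k`:
`L_k A_α = k^λ ∇_λ A_α + (∇_α k^λ) A_λ = 0`. -/
def IsInvariantPotential (g : TwoTensor d X) (k : VField d X) (A : OneTensor d X) : Prop :=
  ∀ (x : X) (u : Vec d), covDerivOne g A x (k x) u + A x (covDerivAlong g id k x u) = 0

/-- The total energy `-k_α (v^α + q A^α)` of a particle of charge `q` and velocity `v` at `x`. -/
def totalEnergy (g : TwoTensor d X) (k : VField d X) (A : OneTensor d X) (q : ℝ) (x : X)
    (v : Vec d) : ℝ :=
  -(g x (k x) v + q * A x (k x))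

/-- The kinetic energy `E_k = E - E_p`, where `E_p = -q k_α A^α`, at the point `x`. -/
def kineticEnergy (k : VField d X) (A : OneTensor d X) (q En : ℝ) (x : X) : ℝ :=
  En - -(q * A x (k x))

end Manifolds

section Hypersurfaces

variable {n d : ℕ}
  {M : Type*} [TopologicalSpace M] [ChartedSpace (Vec n) M] [IsManifold (𝓡 n) ∞ M]
  {S : Type*} [TopologicalSpace S] [ChartedSpace (Vec d) S] [IsManifold (𝓡 d) ∞ S]

/-- The differential `dφ_p` of a map, as a linear map of the model spaces. -/
def dmap (φ : S → M) (p : S) : Vec d →L[ℝ] Vec n := mfderiv (𝓡 d) (𝓡 n) φ p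

/-- The induced metric `h = φ^* g`. -/
def inducedMetric (g : TwoTensor n M) (φ : S → M) : TwoTensor d S := fun p =>
  ContinuousLinearMap.bilinearComp (g (φ p)) (dmap φ p) (dmap φ p)

/-- The pull-back `φ^* F` (the tangential projection of `F`) of a 2-form. -/
def inducedField (F : M → Vec n → Vec n → ℝ) (φ : S → M) : S → Vec d → Vec d → ℝ :=
  fun p u w => F (φ p) (dmap φ p u) (dmap φ p w)

/-- `φ : S → M` is an immersed timelike hypersurface: an immersion of a manifold of one
dimension less, whose induced metric is Lorentzian. -/
structure IsTimelikeHypersurface (g : TwoTensor n M) (φ : S → M) : Prop where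
  codim : d + 1 = n
  immersion : IsImmersion (𝓡 d) (𝓡 n) ∞ φ
  timelike : ∀ p, IsLorentzForm (inducedMetric (d := d) g φ p)

/-- `k` is nowhere orthogonal to the hypersurface. -/
def NowhereOrthogonal (g : TwoTensor n M) (k : VField n M) (φ : S → M) : Prop :=
  ∀ p : S, ∃ w : Vec d, g (φ p) (k (φ p)) (dmap φ p w) ≠ 0

/-- The orthogonal projection `κ` of `k` onto the hypersurface, as a vector of `T_p S`: it is
characterised by `h(κ, w) = g(k, dφ w)` for all `w ∈ T_p S`, that is, `k - dφ κ` is normal. -/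
def kappa (g : TwoTensor n M) (k : VField n M) (φ : S → M) (p : S) : Vec d :=
  sharp (inducedMetric g φ p) fun w => g (φ p) (k (φ p)) (dmap φ p w)

/-- `N` is a smooth unit normal field of the hypersurface on the set `U ⊆ S`. -/
structure IsUnitNormalOn (g : TwoTensor n M) (φ : S → M)
    (N : ∀ p : S, TangentSpace (𝓡 n) (φ p)) (U : Set S) : Prop where
  smooth : ContMDiffOn (𝓡 d) (𝓡 n).tangent ∞
    (fun p => (⟨φ p, N p⟩ : TangentBundle (𝓡 n) M)) U
  normal : ∀ p ∈ U, ∀ w : Vec d, g (φ p) (N p) (dmap φ p w) = 0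
  unit : ∀ p ∈ U, g (φ p) (N p) (N p) = 1

/-- The second fundamental form `χ(v,w) = g(∇_v n, w)` for `v, w` tangent to the hypersurface. -/
def secondForm (g : TwoTensor n M) (φ : S → M) (N : ∀ p : S, TangentSpace (𝓡 n) (φ p))
    (p : S) (v w : Vec d) : ℝ :=
  g (φ p) (covDerivAlong g φ N p v) (dmap φ p w)

/-- The tensor `H_{αβ} = h_{αβ} + (m²/E_k²) κ_α κ_β`. -/
def tensorH (g : TwoTensor n M) (k : VField n M) (A : OneTensor n M) (m q En : ℝ) (φ : S → M)
    (p : S) (v w : Vec d) : ℝ :=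
  inducedMetric g φ p v w + m ^ 2 / kineticEnergy k A q En (φ p) ^ 2 *
    (inducedMetric g φ p (kappa g k φ p) v * inducedMetric g φ p (kappa g k φ p) w)

/-- The tensor `𝓕_{αβ} = ½ (n^ρ F_{ρα} κ_β + n^ρ F_{ρβ} κ_α)`. -/
def tensorF (g : TwoTensor n M) (k : VField n M) (A : OneTensor n M) (φ : S → M)
    (N : ∀ p : S, TangentSpace (𝓡 n) (φ p)) (p : S) (v w : Vec d) : ℝ :=
  1 / 2 * (fieldStrength g A (φ p) (N p) (dmap φ p v) * inducedMetric g φ p (kappa g k φ p) w +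
    fieldStrength g A (φ p) (N p) (dmap φ p w) * inducedMetric g φ p (kappa g k φ p) v)

/-- The function `χ_τ = ((n-2)/H) (χ - q 𝓕/E_k)`, where `H`, `χ`, `𝓕` are the traces of
`H_{αβ}`, `χ_{αβ}`, `𝓕_{αβ}` with respect to the induced metric. -/
def chiTau (g : TwoTensor n M) (k : VField n M) (A : OneTensor n M) (m q En : ℝ) (φ : S → M)
    (N : ∀ p : S, TangentSpace (𝓡 n) (φ p)) (p : S) : ℝ :=
  ((n : ℝ) - 2) / traceWith (inducedMetric (d := d) g φ p) (tensorH g k A m q En φ p) *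
    (traceWith (inducedMetric (d := d) g φ p) (secondForm g φ N p) -
      q * traceWith (inducedMetric (d := d) g φ p) (tensorF g k A φ N p) /
        kineticEnergy k A q En (φ p))

/-- `v ∈ T_p S` is an admissible initial velocity: `v^α v_α = -m²` and `v^α κ_α = -E_k`. -/
def IsAdmissible (g : TwoTensor n M) (k : VField n M) (A : OneTensor n M) (m q En : ℝ) (φ : S → M)
    (p : S) (v : Vec d) : Prop :=
  inducedMetric g φ p v v = -m ^ 2 ∧
    inducedMetric g φ p v (kappa g k φ p) = -kineticEnergy k A q En (φ p)

/-- Massive particle surfaces for mass `m`, charge `q` and total energy `En`: immersed timelike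
hypersurfaces, nowhere orthogonal to `k`, such that every admissible tangent vector is the
initial velocity of a worldline of `M` with these `m`, `q`, `En` that runs in the
hypersurface (on an open parameter interval around `0`). -/
structure IsMassiveParticleSurface (g : TwoTensor n M) (k : VField n M) (A : OneTensor n M)
    (m q En : ℝ) (φ : S → M) : Prop where
  hypersurface : IsTimelikeHypersurface (d := d) g φ
  nowhereOrthogonal : NowhereOrthogonal (d := d) g k φ
  captures : ∀ (p : S) (v : TangentSpace (𝓡 d) p), IsAdmissible g k A m q En φ p v →
    ∃ (c : ℝ → S) (ε : ℝ), 0 < ε ∧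
      ContMDiffOn 𝓘(ℝ, ℝ) (𝓡 d) ∞ c (Ioo (-ε) ε) ∧
      (⟨c 0, velocity c 0⟩ : TangentBundle (𝓡 d) S) = ⟨p, v⟩ ∧
      IsWorldline g (fieldStrength g A) m q (φ ∘ c) (Ioo (-ε) ε) ∧
      ∀ s ∈ Ioo (-ε) ε, totalEnergy g k A q (φ (c s)) (velocity (φ ∘ c) s) = En

end Hypersurfaces

end ChargedSurface

end

open ChargedSurface

noncomputable section

namespace ChargedSurface

open scoped Topology

set_option linter.unusedSectionVars false

/-! Write `E` for the kinetic energy, `ν = g(k,n)`, and `v` for the velocity of a curve in `S`. The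
link between dynamics and geometry is the Gauss formula: the tangential part of the ambient
acceleration is the intrinsic acceleration (`tw_acceleration_dmap`), and its normal part is
`-χ(v,v)` (`tw_acceleration_normal`). A worldline of `S` is therefore a worldline of `M` exactly
when its mass is right and the normal part of the force matches, that is, `χ(v,v) = -q F(n,v)`.
Reading this at parameter `0` gives (i) ⇒ (ii).

For (ii) ⇒ (iii), put `T = χ - (q/E) 𝓕`. A vector that is null for `H` and has `h(κ,v) ≠ 0` can be
rescaled to an admissible one, so `T` vanishes on such vectors. The bound on `κ²` makes `H`
Lorentzian. As `dim S ≥ 3`, every null vector is a limit of null vectors off the hyperplane `h(κ,·)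
= 0`, so `T` vanishes on the whole cone, and a symmetric form vanishing on the null cone of a
Lorentzian form is a multiple of it. Taking traces identifies the factor. This is
`exists_partially_umbilic`, resting on `null_of_null_off_hyperplane` and `exists_eq_mul_of_null`.

For (iii) ⇒ (iv), the antisymmetry of `F` conserves the mass along a worldline of `S`. The energy is
less immediate, since the curve is not yet known to be a worldline of `M`. With `a = g(k,v)` and `f
= a + E`, the Killing equation and the invariance of `A` give `f' = -ν (χ(v,v) + q F(n,v))`.
Inserting (iii), with factor `λ` in front of `H`, the bracket becomes `(a + E) (λ m² (a - E)/E² + q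
F(n,v)/E)`. So `f` solves a homogeneous linear equation; if it vanishes once it vanishes on the
whole interval (`isAdmissible_of_partially_umbilic`). Admissibility thus persists, and the Gauss
formula gives the ambient equation (`isWorldline_of_isAdmissible`).

For (iv) ⇒ (i), the Lorentz force equation on `S` is solved locally with the given initial velocity
(`exists_worldline_hypersurface`); (iv) makes the solution a worldline of `M`, and conservation of
energy does the rest.

Derivatives are defined at each point in the preferred chart of that point, so independence of the
chart is needed throughout. One coordinate computation, `covd_pullback`, supplies it: applied to a
change of charts it gives invariance of the covariant derivative, applied to the immersion it gives
the tangential Gauss formula. -/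

/-- Bilinear forms on `ℝᵈ`. -/
abbrev Bilin (d : ℕ) : Type := Vec d →L[ℝ] Vec d →L[ℝ] ℝ

/-- A symmetric nondegenerate bilinear form. -/
structure IsMetricForm {d : ℕ} (B : Bilin d) : Prop where
  symm : ∀ v w, B v w = B w v
  nondeg : ∀ v, (∀ w, B v w = 0) → v = 0

/-! ### Nondegenerate and Lorentzian forms on `ℝᵈ` -/

section LinearAlgebra

variable {d : ℕ} {B : Bilin d}

lemma vec_eq_sum (v : Vec d) : v = ∑ i, v i • basisVec i := by
  have := (EuclideanSpace.basisFun (Fin d) ℝ).sum_repr v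
  simpa using this.symm

lemma IsLinearMap.apply_eq_sum {a : Vec d → ℝ} (ha : IsLinearMap ℝ a) (v : Vec d) :
    a v = ∑ i, v i * a (basisVec i) := by
  have : ha.mk' a v = ∑ i, v i * ha.mk' a (basisVec i) := by
    conv_lhs => rw [vec_eq_sum v]
    simp [map_sum]
  exact this

lemma IsMetricForm.gram_symm (hB : IsMetricForm B) (i j : Fin d) : gram B i j = gram B j i :=
  hB.symm _ _

/-- A kernel vector of the Gram matrix is a vector orthogonal to the whole space. -/
lemma IsMetricForm.isUnit_det (hB : IsMetricForm B) : IsUnit (gram B).det := by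
  rw [isUnit_iff_ne_zero]
  intro h0
  obtain ⟨x, hx, hx0⟩ := Matrix.exists_mulVec_eq_zero_iff.mpr h0
  apply hx
  have : (WithLp.toLp 2 x : Vec d) = 0 := by
    apply hB.nondeg
    intro w
    rw [hB.symm, vec_eq_sum w]
    simp only [map_sum, map_smul, sum_apply, smul_apply]
    apply Finset.sum_eq_zero
    intro i _
    have hi := congrFun hx0 i
    rw [vec_eq_sum (WithLp.toLp 2 x)]
    simp only [map_sum, map_smul, smul_eq_mul]
    simp only [Matrix.mulVec, dotProduct, gram, Matrix.of_apply, Pi.zero_apply] at hi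
    rw [show ∑ j, x j * (B (basisVec i)) (basisVec j) = 0 by
      rw [← hi]; exact Finset.sum_congr rfl fun j _ => mul_comm _ _]
    simp
  ext i
  have := congrArg (fun v : Vec d => v i) this
  simpa using this

/-- The defining property of the raised covector. -/
lemma IsMetricForm.sharp_apply (hB : IsMetricForm B) {a : Vec d → ℝ} (ha : IsLinearMap ℝ a)
    (w : Vec d) : B (sharp B a) w = a w := by
  have key : ∀ k, B (sharp B a) (basisVec k) = a (basisVec k) := by
    intro k
    rw [hB.symm, vec_eq_sum (sharp B a)]
    simp only [map_sum, map_smul, smul_eq_mul]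
    have h1 : ∀ i, sharp B a i = ((gram B)⁻¹.mulVec fun j => a (basisVec j)) i := fun i => rfl
    have h2 : (gram B).mulVec ((gram B)⁻¹.mulVec fun j => a (basisVec j)) =
        fun j => a (basisVec j) := by
      rw [Matrix.mulVec_mulVec, Matrix.mul_nonsing_inv _ hB.isUnit_det, Matrix.one_mulVec]
    rw [← congrFun h2 k]
    simp only [Matrix.mulVec, dotProduct]
    refine Finset.sum_congr rfl fun i _ => ?_
    rw [h1, mul_comm]
    rfl
  rw [IsLinearMap.apply_eq_sum ha w]
  conv_lhs => rw [vec_eq_sum w]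
  simp only [map_sum, map_smul, smul_eq_mul, key]

lemma IsMetricForm.ext (hB : IsMetricForm B) {u v : Vec d} (h : ∀ w, B u w = B v w) : u = v := by
  rw [← sub_eq_zero]
  apply hB.nondeg
  intro w
  simp [h w]

lemma IsMetricForm.eq_sharp (hB : IsMetricForm B) {a : Vec d → ℝ} (ha : IsLinearMap ℝ a)
    {u : Vec d} (h : ∀ w, B u w = a w) : u = sharp B a :=
  hB.ext fun w => by rw [h, hB.sharp_apply ha]

/-- The signature is given through one timelike vector `t`; this passes to any timelike `u`. If `v`
were not spacelike, the combination of `u` and `v` orthogonal to `t` would have nonpositive square,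
hence be zero, and this forces `v` itself to be orthogonal to `t`. -/
lemma IsLorentzForm.pos_of_orthogonal (hB : IsLorentzForm B) {u v : Vec d} (hu : B u u < 0)
    (huv : B u v = 0) (hv : v ≠ 0) : 0 < B v v := by
  obtain ⟨t, -, ht⟩ := hB.signature
  by_contra hneg
  push Not at hneg
  set w := B t v • u - B t u • v with hw
  have htw : B t w = 0 := by simp [hw]; ring
  have hvu : B v u = 0 := by rw [hB.symm, huv]
  have hww : B w w ≤ 0 := by
    have : B w w = (B t v) ^ 2 * B u u + (B t u) ^ 2 * B v v := by
      simp [hw, huv, hvu]; ring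
    rw [this]
    nlinarith [sq_nonneg (B t v), sq_nonneg (B t u)]
  have hw0 : w = 0 := by
    by_contra h
    exact absurd (ht w htw h) (not_lt.mpr hww)
  have : B u w = B t v * B u u := by simp [hw, huv]
  rw [hw0, map_zero] at this
  have htv : B t v = 0 := by
    rcases mul_eq_zero.mp this.symm with h | h
    · exact h
    · exact absurd h hu.ne
  exact absurd (ht v htv hv) (not_lt.mpr hneg)

lemma IsLorentzForm.isMetricForm (hB : IsLorentzForm B) : IsMetricForm B := by
  refine ⟨hB.symm, fun v hv => ?_⟩
  obtain ⟨t, -, ht⟩ := hB.signature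
  by_contra h
  have := ht v (by rw [hB.symm, hv]) h
  rw [hv] at this
  exact lt_irrefl _ this

lemma IsMetricForm.traceWith_self (hB : IsMetricForm B) :
    traceWith B (fun v w => B v w) = d := by
  have : traceWith B (fun v w => B v w) = ((gram B)⁻¹ * gram B).trace := by
    simp only [traceWith, Matrix.trace, Matrix.diag, Matrix.mul_apply]
    refine Finset.sum_congr rfl fun i _ => Finset.sum_congr rfl fun j _ => ?_
    rw [hB.gram_symm j i]; rfl
  rw [this, Matrix.nonsing_inv_mul _ hB.isUnit_det]
  simp

/-- Raising the index of the covector `B(k,·)` returns `k`, so the double contraction is `B(k,k)`.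
-/
lemma IsMetricForm.traceWith_mul_self (hB : IsMetricForm B) (k : Vec d) :
    traceWith B (fun v w => B k v * B k w) = B k k := by
  have hl : IsLinearMap ℝ (fun w => B k w) := (B k).toLinearMap.isLinear
  have h1 : sharp B (fun w => B k w) = k := (hB.eq_sharp hl fun _ => rfl).symm
  have h2 : B k k = B k (sharp B (fun w => B k w)) := by rw [h1]
  rw [h2, IsLinearMap.apply_eq_sum hl]
  simp only [traceWith, sharp, Finset.sum_mul]
  refine Finset.sum_congr rfl fun i _ => Finset.sum_congr rfl fun j _ => ?_
  ring

lemma traceWith_linear (B : Bilin d) (T₁ T₂ : Vec d → Vec d → ℝ) (a b : ℝ) :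
    traceWith B (fun v w => a * T₁ v w + b * T₂ v w) =
      a * traceWith B T₁ + b * traceWith B T₂ := by
  simp only [traceWith, Finset.mul_sum, ← Finset.sum_add_distrib]
  refine Finset.sum_congr rfl fun i _ => Finset.sum_congr rfl fun j _ => ?_
  ring

end LinearAlgebra

/-! ### Quadratic forms vanishing on a null cone -/

section NullCone

variable {E : Type*} [AddCommGroup E] [Module ℝ E] {H T : E →ₗ[ℝ] E →ₗ[ℝ] ℝ}

/-- A symmetric form that vanishes on the null cone of a Lorentzian form is a multiple of it. -/
lemma exists_eq_mul_of_null (hT : ∀ v w, T v w = T w v)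
    (hH : ∀ v w, H v w = H w v) {e : E} (he : H e e < 0)
    (hpos : ∀ v, H e v = 0 → v ≠ 0 → 0 < H v v) (hnull : ∀ v, H v v = 0 → T v v = 0) :
    ∃ c : ℝ, ∀ v w, T v w = c * H v w := by
  have hquad : ∀ v, T v v = T e e / H e e * H v v := by
    intro v
    set a := H e v / H e e with ha
    set u := v - a • e with hu
    have heu : H e u = 0 := by simp [hu, ha, he.ne]
    have hue : H u e = 0 := by rw [hH, heu]
    have hv : v = a • e + u := by simp [hu]
    have hru : 0 ≤ H u u := by
      rcases eq_or_ne u 0 with h | h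
      · simp [h]
      · exact (hpos u heu h).le
    -- This `r` makes both `r e + u` and `r e - u` null. The sum and difference of the two resulting
    -- equations for `T` determine `T(u,u)` and give `r T(e,u) = 0`; if `r = 0`, then `u = 0` by
    -- positivity on the complement of `e`.
    set r := Real.sqrt (H u u / -H e e) with hr
    have hr2 : r ^ 2 * H e e = - H u u := by
      rw [hr, Real.sq_sqrt (div_nonneg hru (by linarith))]
      field_simp [he.ne]
    have n1 : T (r • e + u) (r • e + u) = 0 := by
      apply hnull
      simp [heu, hue]
      linarith
    have n2 : T (r • e - u) (r • e - u) = 0 := by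
      apply hnull
      simp [heu, hue]
      linarith
    simp only [map_add, map_sub, map_smul, LinearMap.add_apply, LinearMap.sub_apply,
      LinearMap.smul_apply, smul_eq_mul] at n1 n2
    rw [hT u e] at n1 n2
    have hTu : T u u = - r ^ 2 * T e e := by linarith
    have hTe : T e u = 0 := by
      have h0 : r * T e u = 0 := by linarith
      rcases mul_eq_zero.mp h0 with h | h
      · have : H u u = 0 := by rw [h] at hr2; linarith
        have hu0 : u = 0 := by
          by_contra hne
          exact (hpos u heu hne).ne' this
        simp [hu0]
      · exact h
    have hTue : T u e = 0 := by rw [hT, hTe]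
    have hHu : H u u = - (r ^ 2 * H e e) := by linarith
    rw [hv]
    simp only [map_add, map_smul, LinearMap.add_apply, LinearMap.smul_apply, smul_eq_mul,
      hTe, hTue, heu, hue, hTu, hHu]
    field_simp [he.ne]
    ring
  -- Polarisation recovers the bilinear identity from the quadratic one.
  refine ⟨T e e / H e e, fun v w => ?_⟩
  have h1 := hquad (v + w)
  simp only [map_add, LinearMap.add_apply, hquad v, hquad w] at h1
  rw [hT w v, hH w v] at h1
  linarith

/-- If a quadratic form vanishes on the null vectors outside a hyperplane, it vanishes on all
null vectors. -/
lemma null_of_null_off_hyperplane (hH : ∀ v w, H v w = H w v)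
    {l : E →ₗ[ℝ] ℝ} (hl : ∃ z, l z ≠ 0) (hnd : ∀ v, v ≠ 0 → ∃ z, H v z ≠ 0)
    (hw : ∀ v, ∃ w, H v w = 0 ∧ H w w ≠ 0)
    (hnull : ∀ v, H v v = 0 → l v ≠ 0 → T v v = 0) {v : E} (hv : H v v = 0) : T v v = 0 := by
  by_cases hlv : l v ≠ 0
  · exact hnull v hv hlv
  push Not at hlv
  rcases eq_or_ne v 0 with rfl | hv0
  · simp
  obtain ⟨w, hvw, hww⟩ := hw v
  -- A vector space is not the union of two proper subspaces, here the kernels of `H v` and `l`.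
  obtain ⟨z, hz, hlz⟩ : ∃ z, H v z ≠ 0 ∧ l z ≠ 0 := by
    obtain ⟨z₁, h₁⟩ := hl
    obtain ⟨z₂, h₂⟩ := hnd v hv0
    by_cases a : H v z₁ = 0
    · by_cases b : l z₂ = 0
      · exact ⟨z₁ + z₂, by simpa [a] using h₂, by simpa [b] using h₁⟩
      · exact ⟨z₂, h₂, b⟩
    · exact ⟨z₁, a, h₁⟩
  -- the reflected vectors `u s` are null and tend to a multiple of `v`
  let u : ℝ → E := fun s => H (w + s • z) (w + s • z) • v - (2 * H v (w + s • z)) • (w + s • z)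
  have hu0 : ∀ s, H (u s) (u s) = 0 := by
    intro s
    have e1 : ∀ y : E, H (H y y • v - (2 * H v y) • y) (H y y • v - (2 * H v y) • y) = 0 := by
      intro y
      simp only [map_sub, map_smul, LinearMap.sub_apply, LinearMap.smul_apply, smul_eq_mul, hv,
        hH y v]
      ring
    exact e1 _
  have hlu : ∀ s, l (u s) = - (2 * s * H v z) * (l w + s * l z) := by
    intro s
    simp only [u, map_sub, map_add, map_smul, smul_eq_mul, hlv, hvw]
    ring
  have hcont : Continuous fun s => T (u s) (u s) := by
    simp only [u, map_sub, map_add, map_smul, LinearMap.sub_apply, LinearMap.smul_apply,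
      LinearMap.add_apply, smul_eq_mul]
    fun_prop
  -- By the formula for `l (u s)`, the curve leaves the hyperplane `l = 0` for small `s ≠ 0`, where
  -- the hypothesis applies; continuity then gives the value at `s = 0`.
  have hev : ∀ᶠ s in nhdsWithin (0 : ℝ) {0}ᶜ, T (u s) (u s) = 0 := by
    have h2 : ∀ᶠ s in nhdsWithin (0 : ℝ) {0}ᶜ, l w + s * l z ≠ 0 := by
      by_cases h : l w = 0
      · filter_upwards [self_mem_nhdsWithin] with s hs
        simpa [h, hlz] using hs
      · have : ContinuousAt (fun s : ℝ => l w + s * l z) 0 := by fun_prop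
        exact (this.eventually_ne (by simpa using h)).filter_mono nhdsWithin_le_nhds
    filter_upwards [self_mem_nhdsWithin, h2] with s hs h
    apply hnull _ (hu0 s)
    rw [hlu]
    have hs' : s ≠ 0 := hs
    simp [hs', hz, h]
  have hlim := (hcont.tendsto 0).mono_left (nhdsWithin_le_nhds (s := ({0}ᶜ : Set ℝ)))
  have h0 : T (u 0) (u 0) = 0 :=
    tendsto_nhds_unique (hlim.congr' hev) tendsto_const_nhds
  have hu : u 0 = H w w • v := by simp [u, hvw]
  rw [hu] at h0
  simpa [hww] using h0

end NullCone

/-! ### The pointwise algebra of the partially umbilic condition -/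

section PartiallyUmbilic

variable {d : ℕ} {h : Bilin d}

/-- `h + c κ ⊗ κ` is Lorentzian as soon as `1 + c h(κ,κ) > 0`. -/
lemma IsLorentzForm.exists_signature_add_sq (hh : IsLorentzForm h) (κ : Vec d) {c : ℝ}
    (hc : 0 < 1 + c * h κ κ) :
    ∃ e : Vec d, h e e + c * (h κ e * h κ e) < 0 ∧
      ∀ v, h e v + c * (h κ e * h κ v) = 0 → v ≠ 0 → 0 < h v v + c * (h κ v * h κ v) := by
  obtain ⟨t, ht, hpos⟩ := hh.signature
  set r := Real.sqrt (1 + c * h κ κ) with hr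
  have hr2 : r ^ 2 = 1 + c * h κ κ := Real.sq_sqrt hc.le
  have hr0 : 0 < r := Real.sqrt_pos.mpr hc
  -- `P = id + μ h(κ,·) κ` pulls `h` back to `h + c κ ⊗ κ` when `2μ + μ² h(κ,κ) = c`; this is the
  -- root of that equation that stays finite when `h(κ,κ) = 0`.
  set μ := c / (1 + r) with hμ
  have hμ1 : μ * (1 + r) = c := by rw [hμ]; field_simp
  have hμ2 : 1 + μ * h κ κ = r := by
    have : (1 + r) * (1 + μ * h κ κ - r) = 0 := by
      have : (1 + r) * (1 + μ * h κ κ - r) = 1 - r ^ 2 + (μ * (1 + r)) * h κ κ := by ring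
      rw [this, hμ1, hr2]; ring
    rcases mul_eq_zero.mp this with h' | h' <;> linarith
  let P : Vec d → Vec d := fun v => v + (μ * h κ v) • κ
  have hP : ∀ v w, h (P v) (P w) = h v w + c * (h κ v * h κ w) := by
    intro v w
    simp only [P, map_add, map_smul, add_apply, smul_apply,
      smul_eq_mul, hh.symm v κ]
    rw [← hμ1, ← hμ2]
    ring
  have hκP : ∀ v, h κ (P v) = r * h κ v := by
    intro v
    simp only [P, map_add, map_smul, smul_eq_mul]
    rw [← hμ2]; ring
  -- The preimage of `t` under `P`, found from the fact that `P` multiplies `h(κ,·)` by `r`.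
  set e := t - (μ * h κ t / r) • κ with he
  have hPe : P e = t := by
    have : h κ e = h κ t / r := by
      simp only [he, map_sub, map_smul, smul_eq_mul]
      field_simp
      linear_combination h κ t * hμ2 * (-1) 
    simp only [P, this]
    rw [he]
    rw [mul_div_assoc]
    abel
  refine ⟨e, ?_, fun v hv hv0 => ?_⟩
  · rw [← hP, hPe]; exact ht
  · rw [← hP] at hv ⊢
    rw [hPe] at hv
    apply hpos _ hv
    intro h0
    have h1 := hκP v
    rw [h0, map_zero] at h1
    have h2 : h κ v = 0 := by
      rcases mul_eq_zero.mp h1.symm with h' | h'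
      · exact absurd h' hr0.ne'
      · exact h'
    apply hv0
    simpa [P, h2] using h0

/-- The pointwise algebraic core: a symmetric form `χ` with `χ(v,v) = -q f(v)` for all `v` with
`h(v,v) = -m²`, `h(v,κ) = -E` is a combination of `h + (m²/E²) κ ⊗ κ` and of the symmetrised
product of `f` and `κ`. -/
lemma exists_partially_umbilic (hd : 3 ≤ d) (hh : IsLorentzForm h) {κ : Vec d}
    (hκ0 : κ ≠ 0) {m q E : ℝ} (hE : E ≠ 0) (hκ : 0 < 1 + m ^ 2 / E ^ 2 * h κ κ)
    (χ : Vec d →ₗ[ℝ] Vec d →ₗ[ℝ] ℝ) (hχ : ∀ v w, χ v w = χ w v) (f : Vec d →ₗ[ℝ] ℝ)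
    (hadm : ∀ v, h v v = -m ^ 2 → h v κ = -E → χ v v = -q * f v) :
    ∃ c : ℝ, ∀ v w, χ v w = c * (h v w + m ^ 2 / E ^ 2 * (h κ v * h κ w)) +
      q / E * (1 / 2 * (f v * h κ w + f w * h κ v)) := by
  have hnd := hh.isMetricForm
  let l : Vec d →ₗ[ℝ] ℝ := (h κ).toLinearMap
  let H : Vec d →ₗ[ℝ] Vec d →ₗ[ℝ] ℝ := LinearMap.mk₂ ℝ
    (fun v w => h v w + m ^ 2 / E ^ 2 * (h κ v * h κ w))
    (fun a b c => by simp; ring) (fun c a b => by simp; ring)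
    (fun a b c => by simp; ring) (fun c a b => by simp; ring)
  let T : Vec d →ₗ[ℝ] Vec d →ₗ[ℝ] ℝ := LinearMap.mk₂ ℝ
    (fun v w => χ v w - q / E * (1 / 2 * (f v * h κ w + f w * h κ v)))
    (fun a b c => by simp; ring) (fun c a b => by simp; ring)
    (fun a b c => by simp; ring) (fun c a b => by simp; ring)
  have hHa : ∀ v w, H v w = h v w + m ^ 2 / E ^ 2 * (h κ v * h κ w) := fun _ _ => rfl
  have hTa : ∀ v w, T v w = χ v w - q / E * (1 / 2 * (f v * h κ w + f w * h κ v)) :=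
    fun _ _ => rfl
  have hHs : ∀ v w, H v w = H w v := fun v w => by rw [hHa, hHa, hh.symm v w]; ring
  have hTs : ∀ v w, T v w = T w v := fun v w => by rw [hTa, hTa, hχ v w]; ring
  obtain ⟨e, he, hpos⟩ := hh.exists_signature_add_sq κ hκ
  -- Here `d ≥ 3` enters: the two functionals `H v` and `H e` have a common nonzero kernel vector,
  -- which is spacelike because it is orthogonal to `e`.
  have hfin : ∀ v, ∃ w, H v w = 0 ∧ H w w ≠ 0 := by
    intro v
    let L : Vec d →ₗ[ℝ] ℝ × ℝ := (H v).prod (H e)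
    have : LinearMap.ker L ≠ ⊥ := by
      apply LinearMap.ker_ne_bot_of_finrank_lt
      simp
      omega
    obtain ⟨w, hw, hw0⟩ := (Submodule.ne_bot_iff _).mp this
    have hw' : H v w = 0 ∧ H e w = 0 := by simpa [L, Prod.ext_iff] using hw
    exact ⟨w, hw'.1, (hpos w hw'.2 hw0).ne'⟩
  have hnull : ∀ v, H v v = 0 → l v ≠ 0 → T v v = 0 := by
    intro v hv hlv
    have hlv' : h κ v ≠ 0 := hlv
    have hvv : h v v = - (m ^ 2 / E ^ 2 * (h κ v * h κ v)) := by
      have := hHa v v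
      rw [hv] at this; linarith
    -- The scale that gives `s v` the energy required of an admissible vector; nullity for `H` then
    -- gives it the right mass. The condition at `s v` is quadratic on one side and linear on the
    -- other, so one factor `s` cancels.
    set s := -E / h κ v with hs
    have := hadm (s • v) (by
      simp only [map_smul, smul_apply, smul_eq_mul, hvv, hs]
      field_simp) (by
      simp only [map_smul, smul_apply, smul_eq_mul, hh.symm v κ, hs]
      field_simp)
    simp only [map_smul, LinearMap.smul_apply, smul_eq_mul] at this
    have hs0 : s ≠ 0 := by simp [hs, hE, hlv']
    have h1 : s * χ v v = -q * f v := by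
      apply mul_left_cancel₀ hs0
      linear_combination this
    rw [hTa]
    apply mul_left_cancel₀ hs0
    have h2 : s * h κ v = - E := by rw [hs]; field_simp
    have h3 : s * (χ v v - q / E * (1 / 2 * (f v * h κ v + f v * h κ v))) =
        s * χ v v - q / E * (f v * (s * h κ v)) := by ring
    rw [h3, h1, h2]
    field_simp
    ring
  obtain ⟨c, hc⟩ := exists_eq_mul_of_null hTs hHs he hpos (fun v hv =>
    null_of_null_off_hyperplane (l := l) hHs (by
      by_contra hcon
      push Not at hcon
      exact hκ0 (hnd.nondeg κ hcon)) (fun v hv => by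
      by_contra hcon
      push Not at hcon
      have h1 := hcon e
      rw [hHs] at h1
      exact (hpos v h1 hv).ne' (hcon v)) hfin hnull hv)
  refine ⟨c, fun v w => ?_⟩
  have := hc v w
  rw [hTa, hHa] at this
  linarith

end PartiallyUmbilic

/-! ### Normed structures on spaces of forms -/

section Instances

variable {d : ℕ}

instance : NormedAddCommGroup (Vec d →L[ℝ] ℝ) := ContinuousLinearMap.toNormedAddCommGroup
instance : NormedSpace ℝ (Vec d →L[ℝ] ℝ) := ContinuousLinearMap.toNormedSpace
instance : NormedAddCommGroup (Bilin d) := ContinuousLinearMap.toNormedAddCommGroup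
instance : NormedSpace ℝ (Bilin d) := ContinuousLinearMap.toNormedSpace
instance : AddCommGroup (Bilin d) := ContinuousLinearMap.addCommGroup
instance : AddCommMonoid (Bilin d) := ContinuousLinearMap.addCommMonoid
instance : Module ℝ (Bilin d) := ContinuousLinearMap.module
instance : TopologicalSpace (Bilin d) := ContinuousLinearMap.topologicalSpace
instance : NormedAddCommGroup (Vec d →L[ℝ] Bilin d) := ContinuousLinearMap.toNormedAddCommGroup
instance : NormedSpace ℝ (Vec d →L[ℝ] Bilin d) := ContinuousLinearMap.toNormedSpace

end Instances

/-! ### Levi-Civita calculus in coordinates -/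

section Calculus

variable {d d' : ℕ} {D : Type*} [NormedAddCommGroup D] [NormedSpace ℝ D] {r : WithTop ℕ∞}

lemma contDiffAt_of_apply {F : Type*} [NormedAddCommGroup F] [NormedSpace ℝ F]
    {f : D → Vec d →L[ℝ] F} {x : D} (h : ∀ v, ContDiffAt ℝ r (fun y => f y v) x) :
    ContDiffAt ℝ r f x := by
  have : f = fun y => ∑ i, ContinuousLinearMap.smulRightL ℝ (Vec d) F
      (EuclideanSpace.proj i) (f y (basisVec i)) := by
    ext y v
    conv_lhs => rw [vec_eq_sum v]
    simp [map_sum, sum_apply]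
  rw [this]
  exact ContDiffAt.sum fun i _ => contDiffAt_const.clm_apply (h _)

lemma contDiffAt_bilin_of_apply {f : D → Bilin d} {x : D}
    (h : ∀ v w, ContDiffAt ℝ r (fun y => f y v w) x) : ContDiffAt ℝ r f x :=
  contDiffAt_of_apply fun v => contDiffAt_of_apply fun w => h v w

/-- Cramer's rule: determinant and adjugate are polynomial in the entries. -/
lemma contDiffAt_inv_matrix {ι : Type*} [Fintype ι] [DecidableEq ι] {A : D → Matrix ι ι ℝ} {x : D}
    (hA : ∀ i j, ContDiffAt ℝ r (fun y => A y i j) x) (hx : (A x).det ≠ 0) (i j : ι) :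
    ContDiffAt ℝ r (fun y => (A y)⁻¹ i j) x := by
  have hdet : ∀ {B : D → Matrix ι ι ℝ}, (∀ i j, ContDiffAt ℝ r (fun y => B y i j) x) →
      ContDiffAt ℝ r (fun y => (B y).det) x := by
    intro B hB
    simp only [Matrix.det_apply]
    exact ContDiffAt.sum fun σ _ => (ContDiffAt.const_smul _ (contDiffAt_prod fun k _ => hB _ _))
  have : (fun y => (A y)⁻¹ i j) = fun y => ((A y).det)⁻¹ * (A y).adjugate i j := by
    funext y
    simp [Matrix.inv_def, Ring.inverse_eq_inv']
  rw [this]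
  refine ((hdet hA).inv hx).mul ?_
  simp only [Matrix.adjugate_apply]
  refine hdet fun k l => ?_
  by_cases hk : k = j
  · subst hk
    simp only [Matrix.updateRow_self]
    exact contDiffAt_const
  · simp only [Matrix.updateRow_ne hk]
    exact hA k l

lemma contDiffAt_sharp {G : D → Bilin d} {a : D → Vec d → ℝ} {x : D} (hG : ContDiffAt ℝ r G x)
    (hx : IsMetricForm (G x)) (ha : ∀ w, ContDiffAt ℝ r (fun y => a y w) x) :
    ContDiffAt ℝ r (fun y => sharp (G y) (a y)) x := by
  rw [contDiffAt_euclidean]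
  intro i
  simp only [sharp]
  refine ContDiffAt.sum fun j _ => ContDiffAt.mul ?_ (ha _)
  refine contDiffAt_inv_matrix (A := fun y => gram (G y)) (fun k l => ?_) ?_ i j
  · exact (hG.clm_apply contDiffAt_const).clm_apply contDiffAt_const
  · exact hx.isUnit_det.ne_zero

/-- The Koszul expression `½ (∂_u g(v,w) + ∂_v g(u,w) - ∂_w g(u,v))`. -/
def koszul (DG : Vec d →L[ℝ] Bilin d) (u v w : Vec d) : ℝ :=
  (1 / 2 : ℝ) * (DG u v w + DG v u w - DG w u v)

/-- The Christoffel symbols of a field of bilinear forms on `ℝᵈ`. -/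
def chris (G : Vec d → Bilin d) (y u v : Vec d) : Vec d :=
  sharp (G y) fun w => koszul (fderiv ℝ G y) u v w

lemma isLinearMap_koszul (DG : Vec d →L[ℝ] Bilin d) (u v : Vec d) :
    IsLinearMap ℝ fun w => koszul DG u v w :=
  ⟨fun a b => by simp [koszul]; ring, fun c a => by simp [koszul]; ring⟩

lemma chris_apply {G : Vec d → Bilin d} {y : Vec d} (h : IsMetricForm (G y)) (u v w : Vec d) :
    G y (chris G y u v) w = koszul (fderiv ℝ G y) u v w :=
  h.sharp_apply (isLinearMap_koszul _ _ _) w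

lemma contDiffAt_chris {G : Vec d → Bilin d} {c : D → Vec d} {u v : D → Vec d} {x : D}
    (hG : ContDiffAt ℝ ∞ G (c x)) (h : IsMetricForm (G (c x))) (hc : ContDiffAt ℝ ∞ c x)
    (hu : ContDiffAt ℝ ∞ u x) (hv : ContDiffAt ℝ ∞ v x) :
    ContDiffAt ℝ ∞ (fun z => chris G (c z) (u z) (v z)) x := by
  refine contDiffAt_sharp (hG.comp x hc) h fun w => ?_
  have hDG : ContDiffAt ℝ ∞ (fun z => fderiv ℝ G (c z)) x :=
    (hG.fderiv_right (m := ∞) (by simp)).comp x hc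
  refine contDiffAt_const.mul (((hDG.clm_apply hu).clm_apply hv).clm_apply contDiffAt_const |>.add
    (((hDG.clm_apply hv).clm_apply hu).clm_apply contDiffAt_const) |>.sub
    (((hDG.clm_apply contDiffAt_const).clm_apply hu).clm_apply hv))

lemma fderiv_symm_of_eventually_symm {G : Vec d → Bilin d} {y : Vec d}
    (hG : DifferentiableAt ℝ G y) (hs : ∀ᶠ z in 𝓝 y, ∀ v w, G z v w = G z w v) (u v w : Vec d) :
    fderiv ℝ G y u v w = fderiv ℝ G y u w v := by
  have h1 : ∀ v w, HasFDerivAt (fun z => G z v w) (((fderiv ℝ G y).flip v).flip w) y := by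
    intro v w
    have := (hG.hasFDerivAt.clm_apply (hasFDerivAt_const v y)).clm_apply (hasFDerivAt_const w y)
    convert! this using 1
    ext z; simp
  have h2 : (fun z => G z v w) =ᶠ[𝓝 y] fun z => G z w v := hs.mono fun z hz => hz v w
  have := ((h1 w v).congr_of_eventuallyEq h2).unique (h1 v w)
  simpa using (congrArg (fun L => L u) this).symm

lemma chris_symm {G : Vec d → Bilin d} {y : Vec d}
    (hG : DifferentiableAt ℝ G y) (hs : ∀ᶠ z in 𝓝 y, ∀ v w, G z v w = G z w v) (u v : Vec d) :
    chris G y u v = chris G y v u := by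
  unfold chris
  congr 1
  funext w
  simp only [koszul]
  rw [fderiv_symm_of_eventually_symm hG hs w u v]
  ring

/-- The metric is parallel: `∂_u g(v,w) = g(Γ(u,v),w) + g(v,Γ(u,w))`. -/
lemma fderiv_eq_chris {G : Vec d → Bilin d} {y : Vec d} (hG : DifferentiableAt ℝ G y)
    (hm : ∀ᶠ z in 𝓝 y, IsMetricForm (G z)) (u v w : Vec d) :
    fderiv ℝ G y u v w = G y (chris G y u v) w + G y v (chris G y u w) := by
  have hy := hm.self_of_nhds
  rw [hy.symm v, chris_apply hy, chris_apply hy]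
  have := fderiv_symm_of_eventually_symm hG (hm.mono fun z hz => hz.symm)
  simp only [koszul]
  rw [this u w v, this v u w, this w u v]
  ring

/-- The covariant derivative `V' + Γ(y', V)` of a vector field `V` along a curve `y`. -/
def covd (G : Vec d → Bilin d) (y V : ℝ → Vec d) (s : ℝ) : Vec d :=
  deriv V s + chris G (y s) (deriv y s) (V s)

/-- The product rule, with the derivative of the metric absorbed into the Christoffel terms of the
two covariant derivatives. -/
lemma hasDerivAt_metric {G : Vec d → Bilin d} {y V W : ℝ → Vec d} {s : ℝ}
    (hG : DifferentiableAt ℝ G (y s)) (hm : ∀ᶠ z in 𝓝 (y s), IsMetricForm (G z))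
    (hy : DifferentiableAt ℝ y s) (hV : DifferentiableAt ℝ V s) (hW : DifferentiableAt ℝ W s) :
    HasDerivAt (fun t => G (y t) (V t) (W t))
      (G (y s) (covd G y V s) (W s) + G (y s) (V s) (covd G y W s)) s := by
  have h1 : HasDerivAt (fun t => G (y t)) (fderiv ℝ G (y s) (deriv y s)) s :=
    hG.hasFDerivAt.comp_hasDerivAt s hy.hasDerivAt
  have h2 := (h1.clm_apply hV.hasDerivAt).clm_apply hW.hasDerivAt
  convert! h2 using 1
  simp only [covd, map_add, add_apply, fderiv_eq_chris hG hm]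
  ring

/-- Compatibility of the covariant derivative with pull-backs: the tangential part of the
covariant derivative of the pushed-forward field is the covariant derivative for the pulled-back
metric. -/
lemma covd_pullback {G : Vec d → Bilin d} {G' : Vec d' → Bilin d'} {ψ : Vec d' → Vec d}
    {y V : ℝ → Vec d'} {s : ℝ} (hψ : ContDiffAt ℝ 2 ψ (y s))
    (hG : DifferentiableAt ℝ G (ψ (y s))) (hG' : DifferentiableAt ℝ G' (y s))
    (hm : ∀ᶠ z in 𝓝 (ψ (y s)), IsMetricForm (G z)) (hm' : IsMetricForm (G' (y s)))
    (hpb : ∀ᶠ z in 𝓝 (y s), ∀ v w, G' z v w = G (ψ z) (fderiv ℝ ψ z v) (fderiv ℝ ψ z w))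
    (hy : DifferentiableAt ℝ y s) (hV : DifferentiableAt ℝ V s) (w : Vec d') :
    G (ψ (y s)) (covd G (ψ ∘ y) (fun t => fderiv ℝ ψ (y t) (V t)) s) (fderiv ℝ ψ (y s) w) =
      G' (y s) (covd G' y V s) w := by
  have hm0 := hm.self_of_nhds
  have hψ1 : HasFDerivAt ψ (fderiv ℝ ψ (y s)) (y s) :=
    (hψ.differentiableAt (by simp)).hasFDerivAt
  have hψ2 : HasFDerivAt (fderiv ℝ ψ) (fderiv ℝ (fderiv ℝ ψ) (y s)) (y s) :=
    ((hψ.fderiv_right (m := 1) (by norm_num)).differentiableAt (by simp)).hasFDerivAt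
  have hsym : ∀ u v, fderiv ℝ (fderiv ℝ ψ) (y s) u v = fderiv ℝ (fderiv ℝ ψ) (y s) v u :=
    fun u v => (hψ.isSymmSndFDerivAt (by simp)).eq u v
  -- The derivative of the pulled-back metric acquires Hessian terms of `ψ`. In the Koszul
  -- expression their symmetry cancels all of them except the pairing of `D²ψ(y',V)` with `dψ w`,
  -- which is exactly what differentiating `dψ(V)` along the curve produces.
  have hDG' : ∀ u v w, fderiv ℝ G' (y s) u v w =
      fderiv ℝ G (ψ (y s)) (fderiv ℝ ψ (y s) u) (fderiv ℝ ψ (y s) v) (fderiv ℝ ψ (y s) w) +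
      G (ψ (y s)) (fderiv ℝ (fderiv ℝ ψ) (y s) u v) (fderiv ℝ ψ (y s) w) +
      G (ψ (y s)) (fderiv ℝ ψ (y s) v) (fderiv ℝ (fderiv ℝ ψ) (y s) u w) := by
    intro u v w
    have h1 : HasFDerivAt (fun z => G' z v w) (((fderiv ℝ G' (y s)).flip v).flip w) (y s) := by
      have := (hG'.hasFDerivAt.clm_apply (hasFDerivAt_const v _)).clm_apply
        (hasFDerivAt_const w (y s))
      convert! this using 1
      ext z; simp
    have h2 := ((hG.hasFDerivAt.comp (y s) hψ1).clm_apply (hψ2.clm_apply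
      (hasFDerivAt_const v _))).clm_apply (hψ2.clm_apply (hasFDerivAt_const w (y s)))
    have h3 := h1.unique (h2.congr_of_eventuallyEq (hpb.mono fun z hz => hz v w))
    have h4 := congrArg (fun L => L u) h3
    simp at h4
    rw [h4]
    ring
  have hd1 : deriv (ψ ∘ y) s = fderiv ℝ ψ (y s) (deriv y s) :=
    (hψ1.comp_hasDerivAt s hy.hasDerivAt).deriv
  have hd2 : deriv (fun t => fderiv ℝ ψ (y t) (V t)) s =
      fderiv ℝ (fderiv ℝ ψ) (y s) (deriv y s) (V s) + fderiv ℝ ψ (y s) (deriv V s) :=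
    ((hψ2.comp_hasDerivAt s hy.hasDerivAt).clm_apply hV.hasDerivAt).deriv
  simp only [covd, hd1, hd2, map_add, add_apply, Function.comp_apply]
  rw [chris_apply hm0, chris_apply hm', hpb.self_of_nhds]
  simp only [koszul, hDG']
  rw [hm0.symm (fderiv ℝ ψ (y s) (V s)), hm0.symm (fderiv ℝ ψ (y s) (deriv y s)),
    hm0.symm (fderiv ℝ ψ (y s) (deriv y s)), hsym (V s) (deriv y s), hsym w (deriv y s),
    hsym w (V s)]
  ring

end Calculus

/-! ### Maps and curves read in charts -/

section Charts

variable {d d' : ℕ} {X : Type*} [TopologicalSpace X] [ChartedSpace (Vec d) X]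
  [IsManifold (𝓡 d) ∞ X]
  {Y : Type*} [TopologicalSpace Y] [ChartedSpace (Vec d') Y] [IsManifold (𝓡 d') ∞ Y]

/-- The coordinate change `T_z` from the chart at `x` to the chart at `y`. -/
abbrev tcc (x y z : X) : Vec d →L[ℝ] Vec d := tangentCoordChange (𝓡 d) x y z

/-- The value of a 2-tensor at a point, as a bilinear form on the model space. -/
def tw (g : TwoTensor d X) (x : X) : Bilin d := g x

/-- The value of a 1-form at a point, as a covector of the model space. -/
def cov (A : OneTensor d X) (x : X) : Vec d →L[ℝ] ℝ := A x

/-- The velocity of a curve, as a vector of the model space. -/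
def vel (c : ℝ → X) (s : ℝ) : Vec d := velocity c s

/-- The chart at `x`. -/
abbrev crd (x : X) : PartialEquiv X (Vec d) := extChartAt (𝓡 d) x

instance : IsManifold (𝓡 d) 1 X := IsManifold.of_le (n := ∞) (by simp)

lemma tcc_cancel {x y z : X} (hx : z ∈ (crd (d := d) x).source) (hy : z ∈ (crd (d := d) y).source)
    (v : Vec d) : tcc x y z (tcc y x z v) = v := by
  rw [tangentCoordChange_comp ⟨⟨hy, hx⟩, hy⟩, tangentCoordChange_self hy]

lemma mem_crd_source (x : X) : x ∈ (crd (d := d) x).source := mem_extChartAt_source x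

lemma crd_source_mem_nhds {x z : X} (h : z ∈ (crd (d := d) x).source) :
    (crd (d := d) x).source ∈ 𝓝 z := extChartAt_source_mem_nhds' h

lemma tcc_self (x : X) (v : Vec d) : tcc x x x v = v :=
  tangentCoordChange_self (mem_crd_source x)

lemma hasMFDerivAt_crd {x₁ x : X} (h : x ∈ (crd (d := d) x₁).source) :
    HasMFDerivAt (𝓡 d) 𝓘(ℝ, Vec d) (crd (d := d) x₁) x (tcc x x₁ x) := by
  have h' : x ∈ (chartAt (Vec d) x₁).source := by rwa [extChartAt_source] at h
  have := hasMFDerivAt_extChartAt (I := 𝓡 d) h'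
  rwa [mfderiv_chartAt_eq_tangentCoordChange h'] at this

lemma hasMFDerivAt_crd_symm {x₀ x : X} (h : x ∈ (crd (d := d) x₀).source) :
    HasMFDerivAt 𝓘(ℝ, Vec d) (𝓡 d) (crd (d := d) x₀).symm (crd x₀ x) (tcc x₀ x x) := by
  have hx : (crd (d := d) x₀).symm (crd x₀ x) = x := (crd x₀).left_inv h
  refine ⟨continuousAt_extChartAt_symm' h, ?_⟩
  have := hasFDerivWithinAt_tangentCoordChange (I := 𝓡 d) ⟨h, mem_crd_source x⟩
  simp only [writtenInExtChartAt, hx]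
  exact this

lemma hasFDerivAt_in_charts {f : Y → X} {y₀ q : Y} {x₁ : X} (hq : q ∈ (crd (d := d') y₀).source)
    (hfq : f q ∈ (crd (d := d) x₁).source) (hf : MDifferentiableAt (𝓡 d') (𝓡 d) f q) :
    HasFDerivAt (crd (d := d) x₁ ∘ f ∘ (crd (d := d') y₀).symm)
      ((tcc (f q) x₁ (f q)).comp ((dmap f q).comp (tcc y₀ q q))) (crd y₀ q) := by
  have hx : (crd (d := d') y₀).symm (crd y₀ q) = q := (crd y₀).left_inv hq
  have h1 := hasMFDerivAt_crd_symm hq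
  have h2 := hf.hasMFDerivAt
  have h3 := hasMFDerivAt_crd hfq
  have h23 := h3.comp q h2
  rw [← hx] at h23
  have := HasMFDerivAt.comp (crd y₀ q) h23 h1
  rw [hx] at this
  exact hasMFDerivAt_iff_hasFDerivAt.1 this

lemma hasDerivAt_curve {c : ℝ → X} {t : ℝ} {x₁ : X} (hc : MDifferentiableAt 𝓘(ℝ, ℝ) (𝓡 d) c t)
    (h : c t ∈ (crd (d := d) x₁).source) :
    HasDerivAt (crd (d := d) x₁ ∘ c) (tcc (c t) x₁ (c t) (vel c t)) t := by
  have := (hasMFDerivAt_crd h).comp t hc.hasMFDerivAt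
  have h2 : HasFDerivAt (crd (d := d) x₁ ∘ c)
      ((tcc (c t) x₁ (c t)).comp (mfderiv 𝓘(ℝ, ℝ) (𝓡 d) c t : ℝ →L[ℝ] Vec d)) t :=
    hasMFDerivAt_iff_hasFDerivAt.1 this
  exact h2.hasDerivAt

lemma vel_comp {f : Y → X} {c : ℝ → Y} {t : ℝ}
    (hf : MDifferentiableAt (𝓡 d') (𝓡 d) f (c t)) (hc : MDifferentiableAt 𝓘(ℝ, ℝ) (𝓡 d') c t) :
    vel (d := d) (f ∘ c) t = dmap (d := d') (n := d) f (c t) (vel c t) := by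
  simp only [vel, velocity, dmap]
  rw [mfderiv_comp t hf hc]
  rfl

lemma contDiffAt_in_charts {f : Y → X} {y₀ q : Y} {x₁ : X} (hq : q ∈ (crd (d := d') y₀).source)
    (hfq : f q ∈ (crd (d := d) x₁).source) (hf : ContMDiffAt (𝓡 d') (𝓡 d) ∞ f q) :
    ContDiffAt ℝ ∞ (crd (d := d) x₁ ∘ f ∘ (crd (d := d') y₀).symm) (crd y₀ q) := by
  rw [← contMDiffAt_iff_contDiffAt]
  have hx : (crd (d := d') y₀).symm (crd y₀ q) = q := (crd y₀).left_inv hq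
  have h1 : ContMDiffAt 𝓘(ℝ, Vec d') (𝓡 d') ∞ (crd (d := d') y₀).symm (crd y₀ q) :=
    (contMDiffOn_extChartAt_symm (n := ∞) y₀).contMDiffAt
      (extChartAt_target_mem_nhds' ((crd y₀).map_source hq))
  have h2 : ContMDiffAt (𝓡 d) 𝓘(ℝ, Vec d) ∞ (crd (d := d) x₁) (f q) :=
    contMDiffAt_extChartAt' (by rwa [extChartAt_source] at hfq)
  have h3 := h2.comp q hf
  rw [← hx] at h3
  exact h3.comp _ h1

lemma contDiffAt_curve {c : ℝ → X} {t : ℝ} {x₁ : X} (hc : ContMDiffAt 𝓘(ℝ, ℝ) (𝓡 d) ∞ c t)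
    (h : c t ∈ (crd (d := d) x₁).source) : ContDiffAt ℝ ∞ (crd (d := d) x₁ ∘ c) t := by
  rw [← contMDiffAt_iff_contDiffAt]
  have h2 : ContMDiffAt (𝓡 d) 𝓘(ℝ, Vec d) ∞ (crd (d := d) x₁) (c t) :=
    contMDiffAt_extChartAt' (by rwa [extChartAt_source] at h)
  exact h2.comp t hc

lemma eventually_mdifferentiableAt {f : Y → X} {q : Y} (hf : ContMDiffAt (𝓡 d') (𝓡 d) ∞ f q) :
    ∀ᶠ z in 𝓝 q, MDifferentiableAt (𝓡 d') (𝓡 d) f z := by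
  filter_upwards [(contMDiffAt_iff_contMDiffAt_nhds (n := 1) (by simp)).mp (hf.of_le (by simp))]
    with z hz
  exact hz.mdifferentiableAt (by simp)

lemma eventually_mdifferentiableAt_curve {c : ℝ → X} {t : ℝ}
    (hc : ContMDiffAt 𝓘(ℝ, ℝ) (𝓡 d) ∞ c t) :
    ∀ᶠ z in 𝓝 t, MDifferentiableAt 𝓘(ℝ, ℝ) (𝓡 d) c z := by
  filter_upwards [(contMDiffAt_iff_contMDiffAt_nhds (n := 1) (by simp)).mp (hc.of_le (by simp))]
    with z hz
  exact hz.mdifferentiableAt (by simp)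

/-- Near the coordinates of `q`, the chart representative of `f` is differentiable with the
expected derivative. -/
lemma eventually_fderiv_in_charts {f : Y → X} {y₀ q : Y} {x₁ : X}
    (hq : q ∈ (crd (d := d') y₀).source)
    (hfq : f q ∈ (crd (d := d) x₁).source) (hf : ContMDiffAt (𝓡 d') (𝓡 d) ∞ f q) :
    ∀ᶠ p in 𝓝 q, p ∈ (crd (d := d') y₀).source ∧ f p ∈ (crd (d := d) x₁).source ∧
      MDifferentiableAt (𝓡 d') (𝓡 d) f p ∧
      fderiv ℝ (crd (d := d) x₁ ∘ f ∘ (crd (d := d') y₀).symm) (crd y₀ p) =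
        (tcc (f p) x₁ (f p)).comp ((dmap f p).comp (tcc y₀ p p)) := by
  filter_upwards [crd_source_mem_nhds hq, hf.continuousAt.preimage_mem_nhds
    (crd_source_mem_nhds hfq), eventually_mdifferentiableAt hf] with p h1 h2 h3
  exact ⟨h1, h2, h3, (hasFDerivAt_in_charts h1 h2 h3).fderiv⟩

lemma eventually_in_chart {y₀ q : Y} (hq : q ∈ (crd (d := d') y₀).source) {P : Y → Prop}
    (h : ∀ᶠ p in 𝓝 q, P p) :
    ∀ᶠ z in 𝓝 (crd (d := d') y₀ q), z ∈ (crd (d := d') y₀).target ∧ P ((crd y₀).symm z) := by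
  have hx : (crd (d := d') y₀).symm (crd y₀ q) = q := (crd y₀).left_inv hq
  have h1 : ContinuousAt (crd (d := d') y₀).symm (crd y₀ q) := continuousAt_extChartAt_symm' hq
  rw [← hx] at h
  filter_upwards [extChartAt_target_mem_nhds' (I := 𝓡 d') ((crd y₀).map_source hq),
    h1.eventually h] with z h1 h2 using ⟨h1, h2⟩

end Charts

/-! ### Tensor components in charts -/

section Tensors

variable {d d' : ℕ} {X : Type*} [TopologicalSpace X] [ChartedSpace (Vec d) X]
  [IsManifold (𝓡 d) ∞ X]
  {Y : Type*} [TopologicalSpace Y] [ChartedSpace (Vec d') Y] [IsManifold (𝓡 d') ∞ Y]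

lemma localTwo_apply (g : TwoTensor d X) {x₀ x : X} (h : x ∈ (crd (d := d) x₀).source)
    (u v : Vec d) : localTwo g x₀ (crd x₀ x) u v = tw g x (tcc x₀ x x u) (tcc x₀ x x v) := by
  have hx : (extChartAt (𝓡 d) x₀).symm (extChartAt (𝓡 d) x₀ x) = x := (crd x₀).left_inv h
  show tw g ((crd x₀).symm (crd x₀ x)) (tangentCoordChange (𝓡 d) x₀ _ _ u)
    (tangentCoordChange (𝓡 d) x₀ _ _ v) = _
  rw [hx]

lemma localTwo_apply_tcc (g : TwoTensor d X) {x₀ x : X} (h : x ∈ (crd (d := d) x₀).source)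
    (u v : Vec d) : localTwo g x₀ (crd x₀ x) (tcc x x₀ x u) (tcc x x₀ x v) = tw g x u v := by
  rw [localTwo_apply g h, tcc_cancel h (mem_crd_source x),
    tcc_cancel h (mem_crd_source x)]

lemma localTwo_self (g : TwoTensor d X) (x : X) : localTwo g x (crd x x) = tw g x := by
  ext u v
  rw [localTwo_apply g (mem_crd_source x), tcc_self, tcc_self]

lemma localOne_apply (A : OneTensor d X) {x₀ x : X} (h : x ∈ (crd (d := d) x₀).source)
    (u : Vec d) : localOne A x₀ (crd x₀ x) u = cov A x (tcc x₀ x x u) := by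
  have hx : (extChartAt (𝓡 d) x₀).symm (extChartAt (𝓡 d) x₀ x) = x := (crd x₀).left_inv h
  show cov A ((crd x₀).symm (crd x₀ x)) (tangentCoordChange (𝓡 d) x₀ _ _ u) = _
  rw [hx]

lemma localOne_apply_tcc (A : OneTensor d X) {x₀ x : X} (h : x ∈ (crd (d := d) x₀).source)
    (u : Vec d) : localOne A x₀ (crd x₀ x) (tcc x x₀ x u) = cov A x u := by
  rw [localOne_apply A h, tcc_cancel h (mem_crd_source x)]

/-- A field of metric forms whose components are smooth in every chart. -/
structure IsChartMetric (g : TwoTensor d X) : Prop where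
  smooth : ∀ (x₀ : X) {x : X}, x ∈ (crd (d := d) x₀).source →
    ContDiffAt ℝ ∞ (localTwo g x₀) (crd x₀ x)
  metric : ∀ x, IsMetricForm (tw g x)

lemma IsChartMetric.metric_local {g : TwoTensor d X} (hg : IsChartMetric g) {x₀ x : X}
    (h : x ∈ (crd (d := d) x₀).source) : IsMetricForm (localTwo g x₀ (crd x₀ x)) := by
  have hx := mem_crd_source (d := d) x
  refine ⟨fun v w => ?_, fun v hv => ?_⟩
  · rw [localTwo_apply g h, localTwo_apply g h]
    exact (hg.metric x).symm _ _
  · have : tcc x₀ x x v = 0 := by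
      apply (hg.metric x).nondeg
      intro w
      have := hv (tcc x x₀ x w)
      rwa [localTwo_apply g h, tcc_cancel h hx] at this
    rw [← tcc_cancel hx h v, this, map_zero]

lemma IsChartMetric.eventually_metric_local {g : TwoTensor d X} (hg : IsChartMetric g) {x₀ x : X}
    (h : x ∈ (crd (d := d) x₀).source) : ∀ᶠ z in 𝓝 (crd x₀ x), IsMetricForm (localTwo g x₀ z) := by
  filter_upwards [extChartAt_target_mem_nhds' (I := 𝓡 d) ((crd x₀).map_source h)] with z hz
  have := hg.metric_local ((crd x₀).map_target hz)
  rwa [(crd x₀).right_inv hz] at this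

/-- In charts, the pulled-back tensor is the pull-back by the chart representative. -/
lemma eventually_localTwo_pullback (g : TwoTensor d X) (h : TwoTensor d' Y) {f : Y → X} {y₀ q : Y}
    {x₁ : X} (hq : q ∈ (crd (d := d') y₀).source) (hfq : f q ∈ (crd (d := d) x₁).source)
    (hf : ContMDiffAt (𝓡 d') (𝓡 d) ∞ f q)
    (hpb : ∀ᶠ p in 𝓝 q, ∀ u v : Vec d', tw h p u v = tw g (f p) (dmap f p u) (dmap f p v)) :
    ∀ᶠ z in 𝓝 (crd (d := d') y₀ q), ∀ v w, localTwo h y₀ z v w =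
      localTwo g x₁ ((crd (d := d) x₁ ∘ f ∘ (crd (d := d') y₀).symm) z)
        (fderiv ℝ (crd (d := d) x₁ ∘ f ∘ (crd (d := d') y₀).symm) z v)
        (fderiv ℝ (crd (d := d) x₁ ∘ f ∘ (crd (d := d') y₀).symm) z w) := by
  filter_upwards [eventually_in_chart hq ((eventually_fderiv_in_charts hq hfq hf).and hpb)]
    with z ⟨hz, ⟨⟨h1, h2, h3, h4⟩, h5⟩⟩ v w
  set p := (crd (d := d') y₀).symm z with hp
  have hz' : z = crd y₀ p := ((crd y₀).right_inv hz).symm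
  have hz'' : (crd (d := d') y₀).symm (crd y₀ p) = p := (crd y₀).left_inv h1
  rw [hz', h4, localTwo_apply h h1, h5]
  simp only [Function.comp_apply, hz'', ContinuousLinearMap.comp_apply]
  rw [localTwo_apply_tcc g h2]

end Tensors

/-! ### Smoothness of sections and of their components -/

section Smoothness

variable {d d' : ℕ} {X : Type*} [TopologicalSpace X] [ChartedSpace (Vec d) X]
  [IsManifold (𝓡 d) ∞ X]
  {Y : Type*} [TopologicalSpace Y] [ChartedSpace (Vec d') Y] [IsManifold (𝓡 d') ∞ Y]

/-- A vector field along a map is smooth iff the map and the components of the field are. -/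
lemma contMDiffAt_along_iff {f : Y → X} {V : Y → Vec d} {q : Y} {x₁ : X}
    (h : f q ∈ (crd (d := d) x₁).source) :
    ContMDiffAt (𝓡 d') (𝓡 d).tangent ∞ (fun p => (⟨f p, V p⟩ : TangentBundle (𝓡 d) X)) q ↔
      ContMDiffAt (𝓡 d') (𝓡 d) ∞ f q ∧
      ContMDiffAt (𝓡 d') 𝓘(ℝ, Vec d) ∞ (fun p => tcc (f p) x₁ (f p) (V p)) q := by
  have h' : f q ∈ (trivializationAt (Vec d) (TangentSpace (𝓡 d)) x₁).baseSet := by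
    rw [TangentBundle.trivializationAt_baseSet]
    rwa [extChartAt_source] at h
  rw [Bundle.Trivialization.contMDiffAt_iff (IB := 𝓡 d)
    (e := trivializationAt (Vec d) (TangentSpace (𝓡 d)) x₁)
    (by rw [Bundle.Trivialization.mem_source]; exact h')]
  rfl

/-- These fields have constant components in the chart at `x₀`; the values of a smooth tensor on
them are its components there, which are therefore smooth. -/
lemma contMDiffAt_constant_section {x₀ x : X} (h : x ∈ (crd (d := d) x₀).source) (v : Vec d) :
    ContMDiffAt (𝓡 d) (𝓡 d).tangent ∞
      (fun p => (⟨p, tcc x₀ p p v⟩ : TangentBundle (𝓡 d) X)) x := by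
  refine (contMDiffAt_along_iff (f := fun p : X => p) (V := fun p => tcc x₀ p p v) h).mpr
    ⟨contMDiffAt_id, ?_⟩
  refine contMDiffAt_const (c := v) |>.congr_of_eventuallyEq ?_
  filter_upwards [crd_source_mem_nhds h] with p hp
  exact tcc_cancel (mem_crd_source p) hp v

lemma contDiffAt_comp_symm {F : Type*} [NormedAddCommGroup F] [NormedSpace ℝ F] {u : X → F}
    {x₀ x : X} (h : x ∈ (crd (d := d) x₀).source) (hu : ContMDiffAt (𝓡 d) 𝓘(ℝ, F) ∞ u x) :
    ContDiffAt ℝ ∞ (u ∘ (crd (d := d) x₀).symm) (crd x₀ x) := by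
  rw [← contMDiffAt_iff_contDiffAt]
  have hx : (crd (d := d) x₀).symm (crd x₀ x) = x := (crd x₀).left_inv h
  have h1 : ContMDiffAt 𝓘(ℝ, Vec d) (𝓡 d) ∞ (crd (d := d) x₀).symm (crd x₀ x) :=
    (contMDiffOn_extChartAt_symm (n := ∞) x₀).contMDiffAt
      (extChartAt_target_mem_nhds' ((crd x₀).map_source h))
  rw [← hx] at hu
  exact hu.comp _ h1

lemma IsLorentzMetric.isChartMetric {g : TwoTensor d X} (hg : IsLorentzMetric g) :
    IsChartMetric g := by
  refine ⟨fun x₀ x h => contDiffAt_bilin_of_apply fun v w => ?_,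
    fun x => (hg.lorentz x).isMetricForm⟩
  have h1 : ContMDiffAt (𝓡 d) 𝓘(ℝ, ℝ) ∞
      (fun p : X => tw g p (tcc x₀ p p v) (tcc x₀ p p w)) x := by
    have := (hg.smooth.contMDiffAt (x := x)).clm_bundle_apply₂ (E₃ := Bundle.Trivial X ℝ)
      (contMDiffAt_constant_section h v)
      (contMDiffAt_constant_section h w)
    rw [contMDiffAt_totalSpace] at this
    exact this.2
  refine contDiffAt_comp_symm h h1

lemma IsSmoothOneTensor.contDiffAt_localOne {A : OneTensor d X} (hA : IsSmoothOneTensor A)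
    {x₀ x : X} (h : x ∈ (crd (d := d) x₀).source) :
    ContDiffAt ℝ ∞ (localOne A x₀) (crd x₀ x) := by
  refine contDiffAt_of_apply fun v => ?_
  have h1 : ContMDiffAt (𝓡 d) 𝓘(ℝ, ℝ) ∞ (fun p : X => cov A p (tcc x₀ p p v)) x := by
    have := (hA.contMDiffAt (x := x)).clm_bundle_apply (E₂ := Bundle.Trivial X ℝ)
      (contMDiffAt_constant_section h v)
    rw [contMDiffAt_totalSpace] at this
    exact this.2
  exact contDiffAt_comp_symm h h1

/-- The pull-back of a chart-smooth metric is chart-smooth. -/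
lemma IsChartMetric.pullback {g : TwoTensor d X} (hg : IsChartMetric g) {h : TwoTensor d' Y}
    {f : Y → X} (hf : ContMDiff (𝓡 d') (𝓡 d) ∞ f)
    (hpb : ∀ p, ∀ u v : Vec d', tw h p u v = tw g (f p) (dmap f p u) (dmap f p v))
    (hm : ∀ p, IsMetricForm (tw h p)) : IsChartMetric h := by
  refine ⟨fun y₀ q hq => ?_, hm⟩
  have hfq := mem_crd_source (d := d) (f q)
  have h1 := eventually_localTwo_pullback g h hq hfq hf.contMDiffAt
    (Filter.Eventually.of_forall hpb)
  have hψ := contDiffAt_in_charts hq hfq (hf.contMDiffAt (x := q))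
  have hx : (crd (d := d') y₀).symm (crd y₀ q) = q := (crd y₀).left_inv hq
  refine contDiffAt_bilin_of_apply fun v w => ContDiffAt.congr_of_eventuallyEq ?_
    (h1.mono fun z hz => hz v w)
  have hG : ContDiffAt ℝ ∞ (localTwo g (f q)) ((crd (d := d) (f q) ∘ f ∘ (crd (d := d') y₀).symm)
      (crd y₀ q)) := by
    simp only [Function.comp_apply, hx]
    exact hg.smooth _ hfq
  have hdψ := hψ.fderiv_right (m := ∞) (by simp)
  exact ((hG.comp _ hψ).clm_apply (hdψ.clm_apply contDiffAt_const)).clm_apply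
    (hdψ.clm_apply contDiffAt_const)

end Smoothness

/-! ### Covariant derivatives along curves and maps -/

section CovariantDerivative

variable {d d' : ℕ} {X : Type*} [TopologicalSpace X] [ChartedSpace (Vec d) X]
  [IsManifold (𝓡 d) ∞ X]
  {Y : Type*} [TopologicalSpace Y] [ChartedSpace (Vec d') Y] [IsManifold (𝓡 d') ∞ Y]

/-- The components in the chart at `x₁` of a vector field `Z` along a curve. -/
def hat (x₁ : X) (γ : ℝ → X) (Z : ℝ → Vec d) (t : ℝ) : Vec d := tcc (γ t) x₁ (γ t) (Z t)

/-- The covariant derivative of a vector field along a curve. -/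
def dcov (g : TwoTensor d X) (γ : ℝ → X) (Z : ℝ → Vec d) (s : ℝ) : Vec d :=
  covd (localTwo g (γ s)) (crd (γ s) ∘ γ) (hat (γ s) γ Z) s

lemma covd_congr {G : Vec d → Bilin d} {y y' V V' : ℝ → Vec d} {s : ℝ} (hy : y =ᶠ[𝓝 s] y')
    (hV : V =ᶠ[𝓝 s] V') : covd G y V s = covd G y' V' s := by
  simp only [covd, hy.deriv_eq, hV.deriv_eq, hy.self_of_nhds, hV.self_of_nhds]

lemma christoffel_eq (g : TwoTensor d X) (x : X) (u v : Vec d) :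
    christoffel g x u v = chris (localTwo g x) (crd x x) u v := by
  rw [chris, localTwo_self]
  rfl

lemma hat_self (γ : ℝ → X) (Z : ℝ → Vec d) (s : ℝ) : hat (γ s) γ Z s = Z s := tcc_self _ _

lemma deriv_crd_self {γ : ℝ → X} {s : ℝ} (hγ : MDifferentiableAt 𝓘(ℝ, ℝ) (𝓡 d) γ s) :
    deriv (crd (d := d) (γ s) ∘ γ) s = vel γ s := by
  rw [(hasDerivAt_curve hγ (mem_crd_source _)).deriv, tcc_self]

lemma acceleration_eq_dcov (g : TwoTensor d X) {γ : ℝ → X} {s : ℝ}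
    (hγ : MDifferentiableAt 𝓘(ℝ, ℝ) (𝓡 d) γ s) :
    acceleration g γ s = dcov g γ (vel γ) s := by
  rw [dcov, covd, deriv_crd_self hγ, hat_self]
  show _ + christoffel g (γ s) (vel γ s) (vel γ s) = _
  rw [christoffel_eq]
  rfl

/-- The covariant derivative of a vector field along a map, with values in the model space. -/
def covAlong (g : TwoTensor d X) (f : Y → X) (V : Y → Vec d) (p : Y) (u : Vec d') : Vec d :=
  covDerivAlong g f V p u

lemma hasDerivAt_of_hasMFDerivAt {u : ℝ → Vec d} {L : ℝ →L[ℝ] Vec d} {s : ℝ}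
    (h : HasMFDerivAt 𝓘(ℝ, ℝ) 𝓘(ℝ, Vec d) u s L) : HasDerivAt u (L 1) s := by
  have h' : HasFDerivAt u L s := hasMFDerivAt_iff_hasFDerivAt.1 h
  exact h'.hasDerivAt

/-- The chain rule. It allows the derivative of a normal field in the direction `v`, hence `χ(v,·)`,
to be computed along any curve with velocity `v`. -/
lemma covAlong_vel (g : TwoTensor d X) {f : Y → X} {V : Y → Vec d} {c : ℝ → Y} {s : ℝ}
    (hV : MDifferentiableAt (𝓡 d') 𝓘(ℝ, Vec d)
      (fun p => tcc (f p) (f (c s)) (f p) (V p)) (c s))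
    (hf : MDifferentiableAt (𝓡 d') (𝓡 d) f (c s)) (hc : MDifferentiableAt 𝓘(ℝ, ℝ) (𝓡 d') c s) :
    covAlong g f V (c s) (vel (d := d') c s) = dcov g (f ∘ c) (V ∘ c) s := by
  have hfc : MDifferentiableAt 𝓘(ℝ, ℝ) (𝓡 d) (f ∘ c) s := hf.comp s hc
  have h1 := vel_comp hf hc
  have h2 := deriv_crd_self hfc
  have h3 : deriv (hat ((f ∘ c) s) (f ∘ c) (V ∘ c)) s =
      mfderiv (𝓡 d') 𝓘(ℝ, Vec d) (fun p => tcc (f p) (f (c s)) (f p) (V p)) (c s) (vel (d := d') c s) := by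
    have h4 := hV.hasMFDerivAt.comp s hc.hasMFDerivAt
    exact (hasDerivAt_of_hasMFDerivAt h4).deriv
  rw [dcov, covd, h2, h3, hat_self, h1]
  show _ + christoffel g (f (c s)) (dmap f (c s) (vel (d := d') c s)) (V (c s)) = _
  rw [christoffel_eq]
  rfl

lemma tw_eq_hat (g : TwoTensor d X) {x₁ : X} {γ : ℝ → X} {t : ℝ}
    (h : γ t ∈ (crd (d := d) x₁).source) (Z W : ℝ → Vec d) :
    tw g (γ t) (Z t) (W t) = localTwo g x₁ (crd x₁ (γ t)) (hat x₁ γ Z t) (hat x₁ γ W t) :=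
  (localTwo_apply_tcc g h _ _).symm

lemma eventually_mem_source {x₁ : X} {γ : ℝ → X} {s : ℝ} (hγ : ContinuousAt γ s)
    (h : γ s ∈ (crd (d := d) x₁).source) : ∀ᶠ t in 𝓝 s, γ t ∈ (crd (d := d) x₁).source :=
  hγ.preimage_mem_nhds (crd_source_mem_nhds h)

/-- The pairing does not depend on the chart, so the single chart at `γ s` can be used for all
nearby parameters and the coordinate formula applies. -/
lemma hasDerivAt_tw {g : TwoTensor d X} (hg : IsChartMetric g) {γ : ℝ → X} {Z W : ℝ → Vec d}
    {s : ℝ} (hγ : MDifferentiableAt 𝓘(ℝ, ℝ) (𝓡 d) γ s)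
    (hZ : DifferentiableAt ℝ (hat (γ s) γ Z) s) (hW : DifferentiableAt ℝ (hat (γ s) γ W) s) :
    HasDerivAt (fun t => tw g (γ t) (Z t) (W t))
      (tw g (γ s) (dcov g γ Z s) (W s) + tw g (γ s) (Z s) (dcov g γ W s)) s := by
  have hs := mem_crd_source (d := d) (γ s)
  have h1 := hasDerivAt_metric (G := localTwo g (γ s)) (y := crd (γ s) ∘ γ)
    ((hg.smooth _ hs).differentiableAt (by simp)) (hg.eventually_metric_local hs)
    (hasDerivAt_curve hγ hs).differentiableAt hZ hW
  simp only [Function.comp_apply, hat_self, localTwo_self] at h1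
  refine h1.congr_of_eventuallyEq ?_
  filter_upwards [eventually_mem_source hγ.continuousAt hs] with t ht
  exact tw_eq_hat g ht Z W

/-- Pull-back of the covariant derivative along curves, in arbitrary charts. -/
lemma covd_hat_pullback {g : TwoTensor d X} (hg : IsChartMetric g) {h : TwoTensor d' Y}
    (hh : IsChartMetric h) {f : Y → X} {γ : ℝ → Y} {Z : ℝ → Vec d'} {s : ℝ} {y₀ : Y} {x₁ : X}
    (hy₀ : γ s ∈ (crd (d := d') y₀).source) (hx₁ : f (γ s) ∈ (crd (d := d) x₁).source)
    (hf : ContMDiffAt (𝓡 d') (𝓡 d) ∞ f (γ s))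
    (hpb : ∀ᶠ p in 𝓝 (γ s), ∀ u v : Vec d', tw h p u v = tw g (f p) (dmap f p u) (dmap f p v))
    (hγ : MDifferentiableAt 𝓘(ℝ, ℝ) (𝓡 d') γ s) (hZ : DifferentiableAt ℝ (hat y₀ γ Z) s)
    (w : Vec d') :
    localTwo g x₁ (crd x₁ (f (γ s))) (covd (localTwo g x₁) (crd x₁ ∘ f ∘ γ)
      (hat x₁ (f ∘ γ) fun t => dmap f (γ t) (Z t)) s)
      (tcc (f (γ s)) x₁ (f (γ s)) (dmap f (γ s) w)) =
    localTwo h y₀ (crd y₀ (γ s)) (covd (localTwo h y₀) (crd y₀ ∘ γ) (hat y₀ γ Z) s)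
      (tcc (γ s) y₀ (γ s) w) := by
  set ψ := crd (d := d) x₁ ∘ f ∘ (crd (d := d') y₀).symm with hψdef
  have hx : (crd (d := d') y₀).symm (crd y₀ (γ s)) = γ s := (crd y₀).left_inv hy₀
  have hψs : ψ (crd y₀ (γ s)) = crd x₁ (f (γ s)) := by simp only [hψdef, Function.comp_apply, hx]
  have hψ : ContDiffAt ℝ ∞ ψ (crd y₀ (γ s)) := contDiffAt_in_charts hy₀ hx₁ hf
  have hev := hγ.continuousAt.eventually (eventually_fderiv_in_charts hy₀ hx₁ hf)
  have key := covd_pullback (G := localTwo g x₁) (G' := localTwo h y₀) (ψ := ψ)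
    (y := crd y₀ ∘ γ) (V := hat y₀ γ Z) (s := s) (hψ.of_le (by exact WithTop.coe_le_coe.mpr le_top))
    (by simp only [Function.comp_apply, hψs]
        exact (hg.smooth _ hx₁).differentiableAt (by simp))
    ((hh.smooth _ hy₀).differentiableAt (by simp))
    (by simp only [Function.comp_apply, hψs]
        exact hg.eventually_metric_local hx₁)
    (hh.metric_local hy₀) (eventually_localTwo_pullback g h hy₀ hx₁ hf hpb)
    (hasDerivAt_curve hγ hy₀).differentiableAt hZ (tcc (γ s) y₀ (γ s) w)
  simp only [Function.comp_apply] at key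
  have e1 : ψ ∘ crd y₀ ∘ γ =ᶠ[𝓝 s] crd x₁ ∘ f ∘ γ := by
    filter_upwards [hev] with t ht
    simp only [hψdef, Function.comp_apply, (crd y₀).left_inv ht.1]
  have e2 : (fun t => fderiv ℝ ψ (crd y₀ (γ t)) (hat y₀ γ Z t)) =ᶠ[𝓝 s]
      hat x₁ (f ∘ γ) fun t => dmap f (γ t) (Z t) := by
    filter_upwards [hev] with t ht
    rw [ht.2.2.2]
    simp only [ContinuousLinearMap.comp_apply, hat]
    rw [tcc_cancel ht.1 (mem_crd_source (γ t))]
    rfl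
  rw [covd_congr e1 e2, hψs, hev.self_of_nhds.2.2.2] at key
  simp only [ContinuousLinearMap.comp_apply] at key
  rw [tcc_cancel hy₀ (mem_crd_source (γ s))] at key
  exact key

/-- The tangential part of the Gauss formula. -/
lemma tw_dcov_dmap {g : TwoTensor d X} (hg : IsChartMetric g) {h : TwoTensor d' Y}
    (hh : IsChartMetric h) {f : Y → X} {γ : ℝ → Y} {Z : ℝ → Vec d'} {s : ℝ}
    (hf : ContMDiffAt (𝓡 d') (𝓡 d) ∞ f (γ s))
    (hpb : ∀ᶠ p in 𝓝 (γ s), ∀ u v : Vec d', tw h p u v = tw g (f p) (dmap f p u) (dmap f p v))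
    (hγ : MDifferentiableAt 𝓘(ℝ, ℝ) (𝓡 d') γ s) (hZ : DifferentiableAt ℝ (hat (γ s) γ Z) s)
    (w : Vec d') :
    tw g (f (γ s)) (dcov g (f ∘ γ) (fun t => dmap f (γ t) (Z t)) s) (dmap f (γ s) w) =
      tw h (γ s) (dcov h γ Z s) w := by
  have := covd_hat_pullback hg hh (mem_crd_source (γ s)) (mem_crd_source (f (γ s))) hf hpb hγ hZ w
  rw [localTwo_self, localTwo_self, tcc_self, tcc_self] at this
  exact this

lemma dmap_id (p : X) (u : Vec d) : dmap (d := d) (n := d) (fun x : X => x) p u = u := by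
  have : mfderiv (𝓡 d) (𝓡 d) (fun x : X => x) p = ContinuousLinearMap.id ℝ _ := mfderiv_id
  simp only [dmap, this]
  rfl

/-- The covariant derivative along a curve, computed in an arbitrary chart. -/
lemma localTwo_covd_hat {g : TwoTensor d X} (hg : IsChartMetric g) {γ : ℝ → X} {Z : ℝ → Vec d}
    {s : ℝ} {x₁ : X} (hx₁ : γ s ∈ (crd (d := d) x₁).source)
    (hγ : MDifferentiableAt 𝓘(ℝ, ℝ) (𝓡 d) γ s) (hZ : DifferentiableAt ℝ (hat x₁ γ Z) s)
    (w : Vec d) :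
    localTwo g x₁ (crd x₁ (γ s)) (covd (localTwo g x₁) (crd x₁ ∘ γ) (hat x₁ γ Z) s)
      (tcc (γ s) x₁ (γ s) w) = tw g (γ s) (dcov g γ Z s) w := by
  -- Chart independence is the pull-back formula for the identity map, read in two different charts.
  have := covd_hat_pullback (f := fun x : X => x) hg hg hx₁ (mem_crd_source (γ s))
    contMDiffAt_id (Filter.Eventually.of_forall fun p u v => by
      rw [dmap_id, dmap_id]) hγ hZ w
  simp only [dmap_id, localTwo_self, tcc_self] at this
  exact this.symm

lemma hat_vel_eventuallyEq {γ : ℝ → X} {s : ℝ} {x₁ : X} (hx₁ : γ s ∈ (crd (d := d) x₁).source)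
    (hγ : ContMDiffAt 𝓘(ℝ, ℝ) (𝓡 d) ∞ γ s) :
    hat x₁ γ (vel γ) =ᶠ[𝓝 s] deriv (crd (d := d) x₁ ∘ γ) := by
  filter_upwards [eventually_mem_source hγ.continuousAt hx₁,
    eventually_mdifferentiableAt_curve hγ] with t h1 h2
  exact (hasDerivAt_curve h2 h1).deriv.symm

lemma contDiffAt_hat_vel {γ : ℝ → X} {s : ℝ} {x₁ : X} (hx₁ : γ s ∈ (crd (d := d) x₁).source)
    (hγ : ContMDiffAt 𝓘(ℝ, ℝ) (𝓡 d) ∞ γ s) : ContDiffAt ℝ ∞ (hat (d := d) x₁ γ (vel γ)) s := by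
  refine ContDiffAt.congr_of_eventuallyEq ?_ (hat_vel_eventuallyEq hx₁ hγ)
  have h := contDiffAt_curve hγ hx₁
  have h2 : deriv (crd (d := d) x₁ ∘ γ) = fun t => fderiv ℝ (crd (d := d) x₁ ∘ γ) t 1 := by
    funext t; simp
  rw [h2]
  exact (h.fderiv_right (m := ∞) (by simp)).clm_apply contDiffAt_const

/-- A smooth vector field along a map restricts to a smooth vector field along curves. -/
lemma contDiffAt_hat_comp {f : Y → X} {V : Y → Vec d} {c : ℝ → Y} {s : ℝ} {x₁ : X}
    (hx₁ : f (c s) ∈ (crd (d := d) x₁).source)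
    (hV : ContMDiffAt (𝓡 d') (𝓡 d).tangent ∞ (fun p => (⟨f p, V p⟩ : TangentBundle (𝓡 d) X)) (c s))
    (hc : ContMDiffAt 𝓘(ℝ, ℝ) (𝓡 d') ∞ c s) : ContDiffAt ℝ ∞ (hat x₁ (f ∘ c) (V ∘ c)) s := by
  rw [← contMDiffAt_iff_contDiffAt]
  exact ((contMDiffAt_along_iff hx₁).mp hV).2.comp s hc

lemma covAlong_vel_of_smooth (g : TwoTensor d X) {f : Y → X} {V : Y → Vec d} {c : ℝ → Y} {s : ℝ}
    (hV : ContMDiffAt (𝓡 d') (𝓡 d).tangent ∞ (fun p => (⟨f p, V p⟩ : TangentBundle (𝓡 d) X)) (c s))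
    (hc : MDifferentiableAt 𝓘(ℝ, ℝ) (𝓡 d') c s) :
    covAlong g f V (c s) (vel (d := d') c s) = dcov g (f ∘ c) (V ∘ c) s := by
  have h := (contMDiffAt_along_iff (mem_crd_source (f (c s)))).mp hV
  exact covAlong_vel g (h.2.mdifferentiableAt (by simp)) (h.1.mdifferentiableAt (by simp)) hc

end CovariantDerivative

/-! ### The potential and the field strength -/

section OneForms

variable {d : ℕ} {X : Type*} [TopologicalSpace X] [ChartedSpace (Vec d) X]
  [IsManifold (𝓡 d) ∞ X]

/-- The exterior derivative of a field of covectors on `ℝᵈ`. -/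
def extd (α : Vec d → Vec d →L[ℝ] ℝ) (y u w : Vec d) : ℝ := fderiv ℝ α y u w - fderiv ℝ α y w u

/-- The connection is torsion free, so the Christoffel terms cancel on antisymmetrising. -/
lemma fieldStrength_eq_extd {g : TwoTensor d X} (hg : IsChartMetric g) (A : OneTensor d X) (x : X)
    (u w : Vec d) : fieldStrength g A x u w = extd (localOne A x) (crd x x) u w := by
  have hs := mem_crd_source (d := d) x
  have : christoffel g x u w = christoffel g x w u := by
    rw [christoffel_eq, christoffel_eq]
    exact chris_symm ((hg.smooth _ hs).differentiableAt (by simp))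
      ((hg.eventually_metric_local hs).mono fun z hz => hz.symm) u w
  rw [fieldStrength, covDerivOne, covDerivOne, this, extd]
  ring

lemma fieldStrength_antisymm (g : TwoTensor d X) (A : OneTensor d X) (x : X) (u w : Vec d) :
    fieldStrength g A x u w = -fieldStrength g A x w u := by
  simp only [fieldStrength]; ring

lemma fieldStrength_self (g : TwoTensor d X) (A : OneTensor d X) (x : X) (u : Vec d) :
    fieldStrength g A x u u = 0 := by
  simp only [fieldStrength]; ring

/-- The field strength, computed in an arbitrary chart. -/
lemma fieldStrength_eq_extd_chart {g : TwoTensor d X} (hg : IsChartMetric g) {A : OneTensor d X}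
    (hA : IsSmoothOneTensor A) {x x₁ : X} (hx : x ∈ (crd (d := d) x₁).source) (u w : Vec d) :
    fieldStrength g A x u w =
      extd (localOne A x₁) (crd x₁ x) (tcc x x₁ x u) (tcc x x₁ x w) := by
  rw [fieldStrength_eq_extd hg]
  have hs := mem_crd_source (d := d) x
  have hid : ContMDiffAt (𝓡 d) (𝓡 d) ∞ (fun p : X => p) x := contMDiffAt_id
  set ψ := crd (d := d) x₁ ∘ (fun p : X => p) ∘ (crd (d := d) x).symm with hψdef
  have hψs : ψ (crd x x) = crd x₁ x := by
    simp only [hψdef, Function.comp_apply, (crd x).left_inv hs]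
  have hψ : ContDiffAt ℝ ∞ ψ (crd x x) := contDiffAt_in_charts hs hx hid
  have hev : ∀ᶠ z in 𝓝 (crd (d := d) x x), ∀ v,
      localOne A x z v = localOne A x₁ (ψ z) (fderiv ℝ ψ z v) := by
    filter_upwards [eventually_in_chart hs (eventually_fderiv_in_charts hs hx hid)]
      with z ⟨hz, h1, h2, h3, h4⟩ v
    set p := (crd (d := d) x).symm z with hp
    have hz' : z = crd x p := ((crd x).right_inv hz).symm
    rw [hz', h4, localOne_apply A h1]
    simp only [hψdef, Function.comp_apply, (crd x).left_inv h1, ContinuousLinearMap.comp_apply,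
      dmap_id]
    rw [localOne_apply_tcc A h2]
  have hψ1 : HasFDerivAt ψ (fderiv ℝ ψ (crd x x)) (crd x x) :=
    (hψ.differentiableAt (by simp)).hasFDerivAt
  have hψ2 : HasFDerivAt (fderiv ℝ ψ) (fderiv ℝ (fderiv ℝ ψ) (crd x x)) (crd x x) :=
    ((hψ.fderiv_right (m := ∞) (by simp)).differentiableAt (by simp)).hasFDerivAt
  have hsym := ((hψ.of_le (m := 2) (by exact WithTop.coe_le_coe.mpr le_top)).isSymmSndFDerivAt
    (by simp)).eq
  have hα : HasFDerivAt (localOne A x₁) (fderiv ℝ (localOne A x₁) (ψ (crd x x))) (ψ (crd x x)) := by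
    rw [hψs]
    exact ((hA.contDiffAt_localOne hx).differentiableAt (by simp)).hasFDerivAt
  have hD : ∀ a b, fderiv ℝ (localOne A x) (crd x x) a b =
      fderiv ℝ (localOne A x₁) (ψ (crd x x)) (fderiv ℝ ψ (crd x x) a) (fderiv ℝ ψ (crd x x) b) +
      localOne A x₁ (ψ (crd x x)) (fderiv ℝ (fderiv ℝ ψ) (crd x x) a b) := by
    intro a b
    have h1 : HasFDerivAt (fun z => localOne A x z b)
        ((fderiv ℝ (localOne A x) (crd x x)).flip b) (crd x x) := by
      have := ((hA.contDiffAt_localOne hs).differentiableAt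
        (by simp)).hasFDerivAt.clm_apply (hasFDerivAt_const b (crd x x))
      convert! this using 1
      ext z; simp
    have h2 := (hα.comp (crd x x) hψ1).clm_apply (hψ2.clm_apply (hasFDerivAt_const b _))
    have h3 := h1.unique (h2.congr_of_eventuallyEq (hev.mono fun z hz => hz b))
    have h4 := congrArg (fun L => L a) h3
    simp only [ContinuousLinearMap.flip_apply, add_apply, ContinuousLinearMap.comp_apply,
      zero_apply, map_zero, zero_add, Function.comp_apply] at h4
    rw [h4]
    ring
  have hfd : ∀ a, fderiv ℝ ψ (crd x x) a = tcc x x₁ x a := by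
    intro a
    rw [(eventually_fderiv_in_charts hs hx hid).self_of_nhds.2.2.2]
    simp only [ContinuousLinearMap.comp_apply, dmap_id, tcc_self]
  -- The Hessian of the coordinate change is symmetric and drops out of the antisymmetrised
  -- derivative.
  rw [extd, extd, hD, hD, hsym w u, hψs, hfd, hfd]
  ring

lemma cov_eq_hat (A : OneTensor d X) {x₁ : X} {γ : ℝ → X} {t : ℝ}
    (h : γ t ∈ (crd (d := d) x₁).source) (Z : ℝ → Vec d) :
    cov A (γ t) (Z t) = localOne A x₁ (crd x₁ (γ t)) (hat x₁ γ Z t) :=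
  (localOne_apply_tcc A h _).symm

/-- The Christoffel terms in the derivatives of `A` and of `Z` cancel, leaving the ordinary product
rule in the chart at `γ s`. -/
lemma hasDerivAt_cov (g : TwoTensor d X) {A : OneTensor d X} (hA : IsSmoothOneTensor A)
    {γ : ℝ → X} {Z : ℝ → Vec d}
    {s : ℝ} (hγ : MDifferentiableAt 𝓘(ℝ, ℝ) (𝓡 d) γ s)
    (hZ : DifferentiableAt ℝ (hat (γ s) γ Z) s) :
    HasDerivAt (fun t => cov A (γ t) (Z t))
      (covDerivOne g A (γ s) (vel γ s) (Z s) + cov A (γ s) (dcov g γ Z s)) s := by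
  have hs := mem_crd_source (d := d) (γ s)
  have h0 := hasDerivAt_curve hγ hs
  rw [tcc_self] at h0
  have h1 : HasDerivAt (fun t => localOne A (γ s) (crd (γ s) (γ t)))
      (fderiv ℝ (localOne A (γ s)) (crd (γ s) (γ s)) (vel γ s)) s := by
    have h : HasFDerivAt (localOne A (γ s)) (fderiv ℝ (localOne A (γ s)) (crd (γ s) (γ s)))
      ((crd (γ s) ∘ γ) s) := ((hA.contDiffAt_localOne hs).differentiableAt (by simp)).hasFDerivAt
    exact h.comp_hasDerivAt s h0
  have h2 := h1.clm_apply hZ.hasDerivAt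
  rw [hat_self] at h2
  have h3 : localOne A (γ s) (crd (γ s) (γ s)) = cov A (γ s) := by
    ext u
    rw [localOne_apply A hs, tcc_self]
  have h4 := h2.congr_of_eventuallyEq
    ((eventually_mem_source hγ.continuousAt hs).mono fun t ht => cov_eq_hat A ht Z)
  refine h4.congr_deriv ?_
  rw [h3, dcov, covd, map_add, hat_self, covDerivOne, christoffel_eq, h0.deriv]
  have : A (γ s) (chris (localTwo g (γ s)) (crd (γ s) (γ s)) (vel γ s) (Z s)) =
    cov A (γ s) (chris (localTwo g (γ s)) (crd (γ s) (γ s)) (vel γ s) (Z s)) := rfl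
  rw [this]
  simp only [Function.comp_apply]
  ring

end OneForms

/-! ### Smooth solutions of ordinary differential equations -/

section ODE

/-- Smooth vector fields have smooth local integral curves. -/
lemma exists_smooth_integralCurve {E : Type*} [NormedAddCommGroup E] [NormedSpace ℝ E]
    [CompleteSpace E] {V : E → E} {Ω : Set E} (hΩ : IsOpen Ω)
    (hV : ∀ x ∈ Ω, ContDiffAt ℝ ∞ V x) {x₀ : E} (hx₀ : x₀ ∈ Ω) :
    ∃ (α : ℝ → E) (ε : ℝ), 0 < ε ∧ α 0 = x₀ ∧ ContDiffOn ℝ ∞ α (Ioo (-ε) ε) ∧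
      ∀ t ∈ Ioo (-ε) ε, α t ∈ Ω ∧ HasDerivAt α (V (α t)) t := by
  obtain ⟨α, h0, ε, hε, hα⟩ :=
    ((hV x₀ hx₀).of_le (m := 1)
      (by simp)).exists_forall_mem_closedBall_exists_eq_forall_mem_Ioo_hasDerivAt₀ 0
  simp only [zero_sub, zero_add] at hα
  have hcont : ContinuousAt α 0 := (hα 0 ⟨by linarith, hε⟩).continuousAt
  have hmem : ∀ᶠ t in 𝓝 (0 : ℝ), α t ∈ Ω := hcont (hΩ.mem_nhds (by rwa [h0]))
  obtain ⟨δ, hδ, hball⟩ := Metric.eventually_nhds_iff.mp hmem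
  set r := min ε δ with hr
  have hr0 : 0 < r := lt_min hε hδ
  have hI : ∀ t ∈ Ioo (-r) r, α t ∈ Ω ∧ HasDerivAt α (V (α t)) t := by
    intro t ht
    have h1 : |t| < r := abs_lt.mpr ht
    refine ⟨hball ?_, hα t (abs_lt.mp (h1.trans_le (min_le_left _ _)))⟩
    rw [Real.dist_eq, sub_zero]
    exact h1.trans_le (min_le_right _ _)
  refine ⟨α, r, hr0, h0, ?_, hI⟩
  rw [contDiffOn_infty]
  -- Bootstrapping: if `α` is of class `Cⁿ`, so is its derivative `V ∘ α`, and `α` gains one order.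
  intro n
  induction n with
  | zero =>
    refine contDiffOn_zero.mpr fun t ht => ?_
    exact (hI t ht).2.continuousAt.continuousWithinAt
  | succ n ih =>
    have : ContDiffOn ℝ ((n : WithTop ℕ∞) + 1) α (Ioo (-r) r) := by
      rw [contDiffOn_succ_iff_deriv_of_isOpen isOpen_Ioo]
      refine ⟨fun t ht => (hI t ht).2.differentiableAt.differentiableWithinAt, by simp, ?_⟩
      have h1 : ContDiffOn ℝ n (V ∘ α) (Ioo (-r) r) := fun t ht =>
        ((hV _ (hI t ht).1).of_le (by exact_mod_cast le_top)).comp_contDiffWithinAt t (ih t ht)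
      exact h1.congr fun t ht => (hI t ht).2.deriv
    exact_mod_cast this

/-- Local existence of smooth solutions of the Lorentz force equation in coordinates. -/
lemma exists_lorentz_solution {d : ℕ} {G K : Vec d → Bilin d} {Ω : Set (Vec d)} (hΩ : IsOpen Ω)
    (hG : ∀ z ∈ Ω, ContDiffAt ℝ ∞ G z ∧ IsMetricForm (G z)) (hK : ∀ z ∈ Ω, ContDiffAt ℝ ∞ K z)
    (q : ℝ) {y₀ : Vec d} (hy₀ : y₀ ∈ Ω) (v₀ : Vec d) :
    ∃ (y : ℝ → Vec d) (ε : ℝ), 0 < ε ∧ y 0 = y₀ ∧ deriv y 0 = v₀ ∧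
      ContDiffOn ℝ ∞ y (Ioo (-ε) ε) ∧ ∀ t ∈ Ioo (-ε) ε, y t ∈ Ω ∧
        covd G y (deriv y) t = q • sharp (G (y t)) fun w => K (y t) w (deriv y t) := by
  -- The second-order equation as a first-order system for position and velocity.
  let V : Vec d × Vec d → Vec d × Vec d := fun x =>
    (x.2, - chris G x.1 x.2 x.2 + q • sharp (G x.1) fun w => K x.1 w x.2)
  have hV : ∀ x ∈ Ω ×ˢ (univ : Set (Vec d)), ContDiffAt ℝ ∞ V x := by
    rintro x ⟨hx, -⟩
    have hf : ContDiffAt ℝ ∞ (fun x : Vec d × Vec d => x.1) x := contDiffAt_fst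
    have hs : ContDiffAt ℝ ∞ (fun x : Vec d × Vec d => x.2) x := contDiffAt_snd
    refine hs.prodMk (ContDiffAt.add (contDiffAt_chris (hG _ hx).1 (hG _ hx).2 hf hs hs).neg
      (ContDiffAt.const_smul _ ?_))
    refine contDiffAt_sharp ((hG _ hx).1.comp x hf) (hG _ hx).2 fun w => ?_
    exact (((hK _ hx).comp x hf).clm_apply contDiffAt_const).clm_apply hs
  obtain ⟨α, ε, hε, h0, hsm, hα⟩ := exists_smooth_integralCurve (hΩ.prod isOpen_univ) hV
    (x₀ := (y₀, v₀)) ⟨hy₀, mem_univ _⟩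
  have hd : ∀ t ∈ Ioo (-ε) ε, HasDerivAt (fun t => (α t).1) (α t).2 t := fun t ht => by
    have h := (hα t ht).2
    exact (hasFDerivAt_fst.comp_hasDerivAt t h)
  have hd2 : ∀ t ∈ Ioo (-ε) ε, HasDerivAt (fun t => (α t).2) (V (α t)).2 t := fun t ht => by
    have h := (hα t ht).2
    exact (hasFDerivAt_snd.comp_hasDerivAt t h)
  have h0m : (0 : ℝ) ∈ Ioo (-ε) ε := ⟨by linarith, hε⟩
  refine ⟨fun t => (α t).1, ε, hε, by simp [h0], by rw [(hd 0 h0m).deriv, h0],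
    contDiff_fst.comp_contDiffOn hsm, fun t ht => ⟨(hα t ht).1.1, ?_⟩⟩
  have hev : deriv (fun t => (α t).1) =ᶠ[𝓝 t] fun t => (α t).2 := by
    filter_upwards [isOpen_Ioo.mem_nhds ht] with r hr using (hd r hr).deriv
  rw [covd, hev.deriv_eq, (hd2 t ht).deriv, (hd t ht).deriv]
  simp only [V]
  abel

end ODE

/-! ### Solving the Lorentz force equation on a manifold -/

section Existence

variable {d : ℕ} {X : Type*} [TopologicalSpace X] [ChartedSpace (Vec d) X]
  [IsManifold (𝓡 d) ∞ X]

lemma contMDiffAt_symm_comp {x₀ : X} {y : ℝ → Vec d} {t : ℝ} (hy : ContDiffAt ℝ ∞ y t)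
    (ht : y t ∈ (crd (d := d) x₀).target) :
    ContMDiffAt 𝓘(ℝ, ℝ) (𝓡 d) ∞ ((crd (d := d) x₀).symm ∘ y) t := by
  have h1 : ContMDiffAt 𝓘(ℝ, Vec d) (𝓡 d) ∞ (crd (d := d) x₀).symm (y t) :=
    (contMDiffOn_extChartAt_symm (n := ∞) x₀).contMDiffAt (extChartAt_target_mem_nhds' ht)
  exact h1.comp t hy.contMDiffAt

/-- Local existence of smooth solutions of the Lorentz force equation on a manifold. -/
lemma exists_solvesLorentzForce {h : TwoTensor d X} (hh : IsChartMetric h)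
    {F : X → Vec d → Vec d → ℝ} (q : ℝ) (p : X) (v : Vec d) {Ω : Set (Vec d)} (hΩ : IsOpen Ω)
    (hΩt : Ω ⊆ (crd (d := d) p).target) (hp : crd p p ∈ Ω) {K : Vec d → Bilin d}
    (hK : ∀ z ∈ Ω, ContDiffAt ℝ ∞ K z)
    (hF : ∀ x ∈ (crd (d := d) p).source, crd p x ∈ Ω → ∀ u w : Vec d,
      F x u w = K (crd p x) (tcc x p x u) (tcc x p x w)) :
    ∃ (c : ℝ → X) (ε : ℝ), 0 < ε ∧ c 0 = p ∧ vel c 0 = v ∧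
      SolvesLorentzForce h F q c (Ioo (-ε) ε) := by
  have hG : ∀ z ∈ Ω, ContDiffAt ℝ ∞ (localTwo h p) z ∧ IsMetricForm (localTwo h p z) := by
    intro z hz
    have h1 := (crd p).map_target (hΩt hz)
    have h2 := (crd p).right_inv (hΩt hz)
    rw [← h2]
    exact ⟨hh.smooth p h1, hh.metric_local h1⟩
  obtain ⟨y, ε, hε, hy0, hv0, hsm, hy⟩ := exists_lorentz_solution hΩ hG hK q hp v
  set c : ℝ → X := (crd (d := d) p).symm ∘ y with hc
  have h0m : (0 : ℝ) ∈ Ioo (-ε) ε := ⟨by linarith, hε⟩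
  have hys : ∀ t ∈ Ioo (-ε) ε, ContDiffAt ℝ ∞ y t := fun t ht =>
    hsm.contDiffAt (isOpen_Ioo.mem_nhds ht)
  have hsrc : ∀ t ∈ Ioo (-ε) ε, c t ∈ (crd (d := d) p).source := fun t ht =>
    (crd p).map_target (hΩt (hy t ht).1)
  have hcy : ∀ t ∈ Ioo (-ε) ε, crd p (c t) = y t := fun t ht =>
    (crd p).right_inv (hΩt (hy t ht).1)
  have hcsm : ∀ t ∈ Ioo (-ε) ε, ContMDiffAt 𝓘(ℝ, ℝ) (𝓡 d) ∞ c t := fun t ht =>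
    contMDiffAt_symm_comp (hys t ht) (hΩt (hy t ht).1)
  have hev : ∀ t ∈ Ioo (-ε) ε, crd (d := d) p ∘ c =ᶠ[𝓝 t] y := fun t ht => by
    filter_upwards [isOpen_Ioo.mem_nhds ht] with r hr using hcy r hr
  have hvel : ∀ t ∈ Ioo (-ε) ε, tcc (c t) p (c t) (vel c t) = deriv y t := fun t ht => by
    rw [← (hev t ht).deriv_eq]
    exact (hasDerivAt_curve ((hcsm t ht).mdifferentiableAt (by simp)) (hsrc t ht)).deriv.symm
  have hc0 : c 0 = p := by
    rw [hc, Function.comp_apply, hy0]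
    exact (crd p).left_inv (mem_crd_source p)
  refine ⟨c, ε, hε, hc0, ?_, fun t ht => (hcsm t ht).contMDiffWithinAt, fun t ht => ?_⟩
  · have := hvel 0 h0m
    rwa [hc0, tcc_self, hv0] at this
  have hmd := (hcsm t ht).mdifferentiableAt (n := ∞) (by simp)
  have hlin : IsLinearMap ℝ fun w => F (c t) w (vel c t) := by
    have : (fun w => F (c t) w (vel c t)) =
        ((K (y t)).flip (deriv y t)).comp (tcc (c t) p (c t)) := by
      funext w
      rw [hF _ (hsrc t ht) (by rw [hcy t ht]; exact (hy t ht).1), hvel t ht, hcy t ht]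
      rfl
    rw [this]
    exact (((K (y t)).flip (deriv y t)).comp (tcc (c t) p (c t))).toLinearMap.isLinear
  have hKlin : IsLinearMap ℝ fun w => K (y t) w (deriv y t) :=
    ((K (y t)).flip (deriv y t)).toLinearMap.isLinear
  refine (hh.metric (c t)).ext fun w => ?_
  rw [acceleration_eq_dcov h hmd, map_smul, smul_apply]
  refine Eq.trans ?_ (congrArg (q • ·) ((hh.metric (c t)).sharp_apply hlin w).symm)
  -- The solution is known in the chart at `p`, while the acceleration is defined in the chart at `c
  -- t`; chart independence lets the two be compared after lowering the index.
  rw [← localTwo_covd_hat hh (hsrc t ht) hmd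
    ((contDiffAt_hat_vel (hsrc t ht) (hcsm t ht)).differentiableAt (by simp))]
  have hhat : hat p c (vel c) =ᶠ[𝓝 t] deriv y :=
    (hat_vel_eventuallyEq (hsrc t ht) (hcsm t ht)).trans (hev t ht).deriv
  rw [covd_congr (hev t ht) hhat, hcy t ht, (hy t ht).2, map_smul, smul_apply,
    (hG _ (hy t ht).1).2.sharp_apply hKlin, hF _ (hsrc t ht) (by rw [hcy t ht]; exact (hy t ht).1),
    hcy t ht, hvel t ht]

end Existence

/-! ### Unit normals -/

section Normal

/-- A tangent space is spanned by a nondegenerate hyperplane and a unit normal. -/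
lemma eq_of_tangential_of_normal {d n : ℕ} (hdn : d + 1 = n) {B : Bilin n} (hB : IsMetricForm B)
    {L : Vec d →L[ℝ] Vec n} (hL : ∀ w, (∀ w', B (L w) (L w') = 0) → w = 0) {N : Vec n}
    (hN : ∀ w, B N (L w) = 0) (hNN : B N N = 1) {x y : Vec n}
    (h1 : ∀ w, B x (L w) = B y (L w)) (h2 : B x N = B y N) : x = y := by
  -- Tangent vectors and multiples of the normal fill the space: the map is injective between spaces
  -- of equal dimension.
  let Λ : Vec d × ℝ →ₗ[ℝ] Vec n := L.toLinearMap.coprod (LinearMap.toSpanSingleton ℝ (Vec n) N)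
  have hΛ : ∀ w a, Λ (w, a) = L w + a • N := fun w a => rfl
  have hinj : Function.Injective Λ := by
    rw [injective_iff_map_eq_zero]
    rintro ⟨w, a⟩ h
    rw [hΛ] at h
    have ha : a = 0 := by
      have := congrArg (B N) h
      simpa [hN, hNN] using this
    have hw : w = 0 := hL w fun w' => by
      have : L w = 0 := by simpa [ha] using h
      rw [this]; simp
    simp [ha, hw]
  have hsurj : Function.Surjective Λ :=
    (LinearMap.injective_iff_surjective_of_finrank_eq_finrank (by simp [hdn])).mp hinj
  refine hB.ext fun v => ?_
  obtain ⟨⟨w, a⟩, rfl⟩ := hsurj v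
  rw [hΛ]
  simp [h1, h2]

variable {n d : ℕ}
  {M : Type*} [TopologicalSpace M] [ChartedSpace (Vec n) M] [IsManifold (𝓡 n) ∞ M]
  {S : Type*} [TopologicalSpace S] [ChartedSpace (Vec d) S] [IsManifold (𝓡 d) ∞ S]

/-- A timelike hypersurface has a smooth unit normal field near each of its points. -/
lemma exists_isUnitNormalOn {g : TwoTensor n M} (hg : IsLorentzMetric g) {φ : S → M}
    (hφ : IsTimelikeHypersurface (d := d) g φ) (hsm : ContMDiff (𝓡 d) (𝓡 n) ∞ φ)
    (hh : IsChartMetric (inducedMetric (d := d) g φ)) (p : S) :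
    ∃ (U : Set S) (N : S → Vec n), IsOpen U ∧ p ∈ U ∧ IsUnitNormalOn (d := d) g φ N U := by
  have hgc := hg.isChartMetric
  set h := inducedMetric (d := d) g φ with hhdef
  set x₁ := φ p with hx₁
  set ψ := crd (d := n) x₁ ∘ φ ∘ (crd (d := d) p).symm with hψdef
  let U₀ : Set S := (crd (d := d) p).source ∩ φ ⁻¹' (crd (d := n) x₁).source
  have hU₀ : IsOpen U₀ :=
    (isOpen_extChartAt_source p).inter ((isOpen_extChartAt_source x₁).preimage hsm.continuous)
  have hpU₀ : p ∈ U₀ := ⟨mem_crd_source p, mem_crd_source x₁⟩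
  have hψs : ∀ q ∈ U₀, ψ (crd p q) = crd x₁ (φ q) := fun q hq => by
    simp only [hψdef, Function.comp_apply, (crd p).left_inv hq.1]
  have hψ : ∀ q ∈ U₀, ContDiffAt ℝ ∞ ψ (crd p q) := fun q hq =>
    contDiffAt_in_charts hq.1 hq.2 hsm.contMDiffAt
  have hdψ : ∀ q ∈ U₀, fderiv ℝ ψ (crd p q) =
      (tcc (φ q) x₁ (φ q)).comp ((dmap φ q).comp (tcc p q q)) := fun q hq =>
    (hasFDerivAt_in_charts hq.1 hq.2 (hsm.mdifferentiableAt (by simp))).fderiv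
  -- a vector that is transverse at `p`
  obtain ⟨ν, hν⟩ : ∃ ν : Vec n, ν ∉ LinearMap.range (dmap (d := d) (n := n) φ p).toLinearMap := by
    by_contra hcon
    push Not at hcon
    have h1 : LinearMap.range (dmap (d := d) (n := n) φ p).toLinearMap = ⊤ :=
      Submodule.eq_top_iff'.mpr hcon
    have h2 := LinearMap.finrank_range_le (dmap (d := d) (n := n) φ p).toLinearMap
    rw [h1, finrank_top] at h2
    simp at h2
    have := hφ.codim
    omega
  let a : Vec d → Vec d → ℝ := fun z w => localTwo g x₁ (ψ z) ν (fderiv ℝ ψ z w)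
  have halin : ∀ z, IsLinearMap ℝ (a z) := fun z =>
    ((localTwo g x₁ (ψ z) ν).comp (fderiv ℝ ψ z)).toLinearMap.isLinear
  -- The constant vector `ν` minus its tangential projection, in coordinates; normalising it by the
  -- root of its square `n2` gives the unit normal.
  let P : Vec d → Vec n := fun z => ν - fderiv ℝ ψ z (sharp (localTwo h p z) (a z))
  let n2 : Vec d → ℝ := fun z => localTwo g x₁ (ψ z) (P z) (P z)
  have hGsm : ∀ q ∈ U₀, ContDiffAt ℝ ∞ (fun z => localTwo g x₁ (ψ z)) (crd p q) := fun q hq => by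
    refine ContDiffAt.comp (crd p q) (g := localTwo g x₁) ?_ (hψ q hq)
    rw [hψs q hq]
    exact hgc.smooth x₁ hq.2
  have hPsm : ∀ q ∈ U₀, ContDiffAt ℝ ∞ P (crd p q) := fun q hq => by
    have hd := (hψ q hq).fderiv_right (m := ∞) (by simp)
    refine contDiffAt_const.sub (hd.clm_apply ?_)
    refine contDiffAt_sharp (hh.smooth p hq.1) (hh.metric_local hq.1) fun w => ?_
    exact ((hGsm q hq).clm_apply contDiffAt_const).clm_apply (hd.clm_apply contDiffAt_const)
  have hn2sm : ∀ q ∈ U₀, ContDiffAt ℝ ∞ n2 (crd p q) := fun q hq =>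
    ((hGsm q hq).clm_apply (hPsm q hq)).clm_apply (hPsm q hq)
  have hcrd : ∀ q ∈ U₀, ContMDiffAt (𝓡 d) 𝓘(ℝ, Vec d) ∞ (crd (d := d) p) q := fun q hq =>
    contMDiffAt_extChartAt' (by simpa only [extChartAt_source] using hq.1)
  have horth : ∀ q ∈ U₀, ∀ w : Vec d, localTwo g x₁ (crd x₁ (φ q)) (P (crd p q))
      (tcc (φ q) x₁ (φ q) (dmap φ q w)) = 0 := by
    intro q hq w
    have hpb : ∀ u v, localTwo h p (crd p q) u v = localTwo g x₁ (crd x₁ (φ q))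
        (fderiv ℝ ψ (crd p q) u) (fderiv ℝ ψ (crd p q) v) := by
      intro u v
      rw [hdψ q hq, localTwo_apply h hq.1]
      simp only [ContinuousLinearMap.comp_apply]
      rw [localTwo_apply_tcc g hq.2]
      rfl
    have h1 : tcc (φ q) x₁ (φ q) (dmap φ q w) = fderiv ℝ ψ (crd p q) (tcc q p q w) := by
      rw [hdψ q hq]
      simp only [ContinuousLinearMap.comp_apply]
      rw [tcc_cancel hq.1 (mem_crd_source q)]
    rw [h1]
    simp only [P, map_sub, sub_apply]
    rw [← hpb, (hh.metric_local hq.1).sharp_apply (halin _)]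
    simp only [a, hψs q hq, sub_self]
  -- At `p` this vector is orthogonal to a timelike tangent vector and nonzero because `ν` is
  -- transverse, so it is spacelike; continuity keeps it spacelike nearby.
  have hpos : 0 < n2 (crd p p) := by
    have hψp := hψs p hpU₀
    have h1 : localTwo g x₁ (ψ (crd p p)) = tw g x₁ := by rw [hψp]; exact localTwo_self g x₁
    obtain ⟨t, ht, -⟩ := (hφ.timelike p).signature
    have hL : IsLorentzForm (tw g x₁) := hg.lorentz x₁
    have h2 := horth p hpU₀ t
    rw [← hx₁, tcc_self, ← hψp, h1, hL.symm] at h2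
    simp only [n2, h1]
    refine hL.pos_of_orthogonal (u := dmap φ p t) ht h2 fun h0 => hν ?_
    have h3 : ν = fderiv ℝ ψ (crd p p) (sharp (localTwo h p (crd p p)) (a (crd p p))) :=
      sub_eq_zero.mp h0
    rw [h3, hdψ p hpU₀]
    simp only [ContinuousLinearMap.comp_apply, ← hx₁]
    rw [tcc_self]
    exact ⟨_, rfl⟩
  have hcont : ContinuousOn (fun q => n2 (crd (d := d) p q)) U₀ := fun q hq =>
    (ContinuousAt.comp (f := crd (d := d) p) (hn2sm q hq).continuousAt
      (hcrd q hq).continuousAt).continuousWithinAt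
  let U : Set S := U₀ ∩ (fun q => n2 (crd (d := d) p q)) ⁻¹' Ioi 0
  have hUo : IsOpen U := hcont.isOpen_inter_preimage hU₀ isOpen_Ioi
  let Nh : Vec d → Vec n := fun z => (Real.sqrt (n2 z))⁻¹ • P z
  let N : S → Vec n := fun q => tcc x₁ (φ q) (φ q) (Nh (crd (d := d) p q))
  have hNhat : ∀ q ∈ U₀, tcc (φ q) x₁ (φ q) (N q) = Nh (crd (d := d) p q) := fun q hq =>
    tcc_cancel (mem_crd_source (φ q)) hq.2 _
  refine ⟨U, N, hUo, ⟨hpU₀, hpos⟩, ?_, ?_, ?_⟩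
  · rintro q ⟨hq, hq0⟩
    refine ContMDiffAt.contMDiffWithinAt ?_
    refine (contMDiffAt_along_iff (V := N) hq.2).mpr ⟨hsm.contMDiffAt, ?_⟩
    have hq0' : n2 (crd p q) ≠ 0 := (mem_Ioi.mp hq0).ne'
    have hNh : ContDiffAt ℝ ∞ Nh (crd p q) :=
      (((hn2sm q hq).sqrt hq0').inv (Real.sqrt_ne_zero'.mpr hq0)).smul (hPsm q hq)
    refine (hNh.contMDiffAt.comp q (hcrd q hq)).congr_of_eventuallyEq ?_
    filter_upwards [hU₀.mem_nhds hq] with r hr using hNhat r hr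
  · rintro q ⟨hq, -⟩ w
    show tw g (φ q) (N q) (dmap φ q w) = 0
    rw [← localTwo_apply_tcc g hq.2, hNhat q hq]
    simp only [Nh, map_smul, smul_apply, horth q hq, smul_zero]
  · rintro q ⟨hq, hq0⟩
    show tw g (φ q) (N q) (N q) = 1
    rw [← localTwo_apply_tcc g hq.2, hNhat q hq]
    have h1 : localTwo g x₁ (crd x₁ (φ q)) (P (crd p q)) (P (crd p q)) = n2 (crd p q) := by
      simp only [n2, hψs q hq]
    simp only [Nh, map_smul, smul_apply, h1, smul_eq_mul]
    have h2 : 0 < n2 (crd p q) := hq0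
    have h3 := Real.sq_sqrt h2.le
    have h4 := Real.sqrt_pos.mpr h2
    field_simp
    exact h3.symm

end Normal

/-! ### Propagation of zeros along an interval -/

section LinearODE

/-- A solution of a linear scalar equation `f' = b f` that vanishes at a point vanishes near it. -/
lemma eventually_eq_zero_of_hasDerivAt_mul {f b : ℝ → ℝ} {s : ℝ} (hb : ContinuousAt b s)
    (hf : ∀ᶠ t in 𝓝 s, HasDerivAt f (b t * f t) t) (h0 : f s = 0) : ∀ᶠ t in 𝓝 s, f t = 0 := by
  have hbd : ∀ᶠ t in 𝓝 s, ‖b t‖ < ‖b s‖ + 1 :=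
    hb.norm.eventually (gt_mem_nhds (lt_add_one _))
  obtain ⟨δ, hδ, hball⟩ := Metric.eventually_nhds_iff_ball.mp (hbd.and hf)
  rw [Real.ball_eq_Ioo] at hball
  have hs : s ∈ Ioo (s - δ) (s + δ) := ⟨by linarith, by linarith⟩
  have key := ODE_solution_unique_of_mem_Ioo (v := fun t x => b t * x) (s := fun _ => univ)
    (K := ⟨‖b s‖ + 1, by positivity⟩) (f := f) (g := fun _ => 0) (t₀ := s) (a := s - δ) (b := s + δ)
    (fun t ht => by
      refine LipschitzWith.lipschitzOnWith (LipschitzWith.of_dist_le_mul fun x y => ?_)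
      rw [Real.dist_eq, Real.dist_eq, ← mul_sub, abs_mul]
      exact mul_le_mul_of_nonneg_right (hball t ht).1.le (abs_nonneg _))
    hs (fun t ht => ⟨(hball t ht).2, mem_univ _⟩)
    (fun t _ => ⟨by simpa using hasDerivAt_const t (0 : ℝ), mem_univ _⟩) h0
  filter_upwards [isOpen_Ioo.mem_nhds hs] with t ht using key ht

/-- The zero set is closed in `J` by continuity and open by `hloc`; connectedness finishes. -/
lemma eq_zero_of_locally_zero {f : ℝ → ℝ} {J : Set ℝ} (hJ : IsOpen J) (hc : IsPreconnected J)
    (hf : ContinuousOn f J) (hloc : ∀ s ∈ J, f s = 0 → ∀ᶠ t in 𝓝 s, f t = 0) {s₀ : ℝ}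
    (hs₀ : s₀ ∈ J) (h0 : f s₀ = 0) : ∀ s ∈ J, f s = 0 := by
  have hu : IsOpen {t | ∀ᶠ r in 𝓝 t, f r = 0} := isOpen_setOfPred_eventually_nhds
  have hv : IsOpen (J ∩ f ⁻¹' {0}ᶜ) := hf.isOpen_inter_preimage hJ isOpen_compl_singleton
  have := hc.subset_left_of_subset_union hu hv
    (by
      rw [Set.disjoint_left]
      rintro t ht ⟨-, h⟩
      have ht' : ∀ᶠ r in 𝓝 t, f r = 0 := ht
      exact h ht'.self_of_nhds)
    (fun t ht => by
      by_cases h : f t = 0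
      · exact Or.inl (hloc t ht h)
      · exact Or.inr ⟨ht, h⟩)
    ⟨s₀, hs₀, hloc s₀ hs₀ h0⟩
  intro s hs
  have hs' : ∀ᶠ r in 𝓝 s, f r = 0 := this hs
  exact hs'.self_of_nhds

lemma eqOn_const_of_hasDerivAt_zero {f : ℝ → ℝ} {J : Set ℝ} (hJ : IsOpen J) (hc : IsPreconnected J)
    (hf : ∀ s ∈ J, HasDerivAt f 0 s) {s₀ : ℝ} (hs₀ : s₀ ∈ J) : ∀ s ∈ J, f s = f s₀ := fun _ hs =>
  hJ.is_const_of_deriv_eq_zero hc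
    (fun t ht => (hf t ht).differentiableAt.differentiableWithinAt)
    (fun t ht => (hf t ht).deriv) hs hs₀

end LinearODE

/-! ### Continuity of geometric quantities along curves -/

section Continuity

variable {d : ℕ} {X : Type*} [TopologicalSpace X] [ChartedSpace (Vec d) X]
  [IsManifold (𝓡 d) ∞ X]

lemma isLinearMap_fieldStrength {g : TwoTensor d X} (hg : IsChartMetric g) (A : OneTensor d X)
    (x : X) (v : Vec d) : IsLinearMap ℝ fun w => fieldStrength g A x w v := by
  simp only [fieldStrength_eq_extd hg, extd]
  exact ⟨fun a b => by simp; ring, fun c a => by simp; ring⟩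

lemma continuousAt_fieldStrength {g : TwoTensor d X} (hg : IsChartMetric g) {A : OneTensor d X}
    (hA : IsSmoothOneTensor A) {γ : ℝ → X} {Z W : ℝ → Vec d} {s : ℝ}
    (hγ : ContMDiffAt 𝓘(ℝ, ℝ) (𝓡 d) ∞ γ s) (hZ : ContinuousAt (hat (γ s) γ Z) s)
    (hW : ContinuousAt (hat (γ s) γ W) s) :
    ContinuousAt (fun t => fieldStrength g A (γ t) (Z t) (W t)) s := by
  have hs := mem_crd_source (d := d) (γ s)
  have hev : (fun t => extd (localOne A (γ s)) (crd (γ s) (γ t)) (hat (γ s) γ Z t)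
      (hat (γ s) γ W t)) =ᶠ[𝓝 s] fun t => fieldStrength g A (γ t) (Z t) (W t) := by
    filter_upwards [eventually_mem_source hγ.continuousAt hs] with t ht
    exact (fieldStrength_eq_extd_chart hg hA ht _ _).symm
  refine ContinuousAt.congr ?_ hev
  have h1 : ContinuousAt (crd (d := d) (γ s) ∘ γ) s := (contDiffAt_curve hγ hs).continuousAt
  have h2 : ContinuousAt (fderiv ℝ (localOne A (γ s))) ((crd (γ s) ∘ γ) s) :=
    ((hA.contDiffAt_localOne hs).fderiv_right (m := ∞) (by simp)).continuousAt
  have h3 : ContinuousAt (fun t => fderiv ℝ (localOne A (γ s)) (crd (γ s) (γ t))) s :=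
    ContinuousAt.comp (f := crd (d := d) (γ s) ∘ γ) h2 h1
  exact ((h3.clm_apply hZ).clm_apply hW).sub ((h3.clm_apply hW).clm_apply hZ)

/-- The vector `dcov g γ Z t` is expressed in the chart at `γ t`, which need not vary continuously
with `t`; the pairing is continuous because it can be computed in the fixed chart at `γ s`. -/
lemma continuousAt_tw_dcov {g : TwoTensor d X} (hg : IsChartMetric g) {γ : ℝ → X}
    {Z W : ℝ → Vec d} {s : ℝ}
    (hγ : ContMDiffAt 𝓘(ℝ, ℝ) (𝓡 d) ∞ γ s) (hZ : ContDiffAt ℝ ∞ (hat (γ s) γ Z) s)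
    (hW : ContinuousAt (hat (γ s) γ W) s) :
    ContinuousAt (fun t => tw g (γ t) (dcov g γ Z t) (W t)) s := by
  have hs := mem_crd_source (d := d) (γ s)
  have hev : (fun t => localTwo g (γ s) (crd (γ s) (γ t))
      (covd (localTwo g (γ s)) (crd (γ s) ∘ γ) (hat (γ s) γ Z) t) (hat (γ s) γ W t)) =ᶠ[𝓝 s]
      fun t => tw g (γ t) (dcov g γ Z t) (W t) := by
    have h1 : ∀ᶠ t in 𝓝 s, DifferentiableAt ℝ (hat (γ s) γ Z) t := by
      filter_upwards [(hZ.of_le (m := 1) (by simp)).eventually (by simp)] with t ht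
      exact ht.differentiableAt (by simp)
    filter_upwards [eventually_mem_source hγ.continuousAt hs,
      eventually_mdifferentiableAt_curve hγ, h1] with t h1 h2 h3
    exact localTwo_covd_hat hg h1 h2 h3 _
  refine ContinuousAt.congr ?_ hev
  have h0 := contDiffAt_curve hγ hs
  have hd : ∀ {u : ℝ → Vec d}, ContDiffAt ℝ ∞ u s → ContDiffAt ℝ ∞ (deriv u) s := by
    intro u hu
    have h2 : deriv u = fun t => fderiv ℝ u t 1 := by
      funext t; simp
    rw [h2]
    exact (hu.fderiv_right (m := ∞) (by simp)).clm_apply contDiffAt_const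
  have h2 : ContinuousAt (fun t => localTwo g (γ s) (crd (γ s) (γ t))) s :=
    ContinuousAt.comp (f := crd (d := d) (γ s) ∘ γ) (g := localTwo g (γ s))
      (hg.smooth _ hs).continuousAt h0.continuousAt
  refine (h2.clm_apply ?_).clm_apply hW
  exact ((hd hZ).add (contDiffAt_chris (c := crd (γ s) ∘ γ) (hg.smooth _ hs) (hg.metric_local hs)
    h0 (hd h0) hZ)).continuousAt

end Continuity

/-! ### Rate of change of the total energy -/

section Energy

variable {d : ℕ} {X : Type*} [TopologicalSpace X] [ChartedSpace (Vec d) X]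
  [IsManifold (𝓡 d) ∞ X]

lemma IsSmoothVField.contDiffAt_hat {k : VField d X} (hk : IsSmoothVField k) {γ : ℝ → X} {s : ℝ}
    (hγ : ContMDiffAt 𝓘(ℝ, ℝ) (𝓡 d) ∞ γ s) :
    ContDiffAt ℝ ∞ (hat (d := d) (γ s) γ fun t => k (γ t)) s :=
  contDiffAt_hat_comp (f := fun x : X => x) (V := fun x => k x) (mem_crd_source (γ s))
    hk.contMDiffAt hγ

/-- The rate of change of `k_α (ċ^α + q A^α)` along a curve, for a Killing field `k` that
preserves `A`. -/
lemma hasDerivAt_energy {g : TwoTensor d X} (hg : IsChartMetric g) {k : VField d X}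
    (hk : IsSmoothVField k) (hkg : IsKilling g k) {A : OneTensor d X} (hA : IsSmoothOneTensor A)
    (hkA : IsInvariantPotential g k A) (q : ℝ) {γ : ℝ → X} {s : ℝ}
    (hγ : ContMDiffAt 𝓘(ℝ, ℝ) (𝓡 d) ∞ γ s) :
    HasDerivAt (fun t => tw g (γ t) (k (γ t)) (vel γ t) + q * cov A (γ t) (k (γ t)))
      (tw g (γ s) (k (γ s)) (acceleration g γ s) +
        q * fieldStrength g A (γ s) (vel γ s) (k (γ s))) s := by
  have hmd := hγ.mdifferentiableAt (n := ∞) (by simp)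
  have hkh := (hk.contDiffAt_hat hγ).differentiableAt (by simp)
  have hvh := (contDiffAt_hat_vel (mem_crd_source (γ s)) hγ).differentiableAt (n := ∞) (by simp)
  have hD : covAlong g (fun x : X => x) (fun x => k x) (γ s) (vel (d := d) γ s) =
      dcov g γ (fun t => k (γ t)) s :=
    covAlong_vel_of_smooth (f := fun x : X => x) (V := fun x => k x) g hk.contMDiffAt hmd
  have h1 := hasDerivAt_tw hg hmd hkh hvh
  have h2 := (hasDerivAt_cov g hA hmd hkh).const_mul q
  refine (h1.add h2).congr_deriv ?_
  rw [← hD, ← acceleration_eq_dcov g hmd]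
  -- The Killing equation with the velocity in both slots removes `g(∇_v k, v)`. Invariance of `A`
  -- then trades `A(∇_v k)` for `-(∇_k A)(v)`, which combines with `(∇_v A)(k)` to `F(v,k)`.
  have e1 : tw g (γ s) (covAlong g (fun x : X => x) (fun x => k x) (γ s) (vel (d := d) γ s))
      (vel γ s) = 0 := by
    have := hkg (γ s) (vel γ s) (vel γ s)
    change tw g (γ s) (covAlong g (fun x : X => x) (fun x => k x) (γ s) (vel (d := d) γ s))
      (vel γ s) + tw g (γ s) (covAlong g (fun x : X => x) (fun x => k x) (γ s)
        (vel (d := d) γ s)) (vel γ s) = 0 at this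
    linarith
  have e2 : covDerivOne g A (γ s) (k (γ s)) (vel γ s) +
      cov A (γ s) (covAlong g (fun x : X => x) (fun x => k x) (γ s) (vel (d := d) γ s)) = 0 :=
    hkA (γ s) (vel γ s)
  have e3 : fieldStrength g A (γ s) (vel γ s) (k (γ s)) =
      covDerivOne g A (γ s) (vel γ s) (k (γ s)) - covDerivOne g A (γ s) (k (γ s)) (vel γ s) := rfl
  linear_combination e1 + q * e2 - q * e3

end Energy

/-! ### The Gauss formula and the second fundamental form -/

section Gauss

variable {n d : ℕ}
  {M : Type*} [TopologicalSpace M] [ChartedSpace (Vec n) M] [IsManifold (𝓡 n) ∞ M]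
  {S : Type*} [TopologicalSpace S] [ChartedSpace (Vec d) S] [IsManifold (𝓡 d) ∞ S]
  {g : TwoTensor n M} {φ : S → M}

lemma IsTimelikeHypersurface.contMDiff (hφ : IsTimelikeHypersurface (d := d) g φ) :
    ContMDiff (𝓡 d) (𝓡 n) ∞ φ := hφ.immersion.contMDiff

lemma IsTimelikeHypersurface.isChartMetric (hg : IsLorentzMetric g)
    (hφ : IsTimelikeHypersurface (d := d) g φ) : IsChartMetric (inducedMetric (d := d) g φ) :=
  hg.isChartMetric.pullback hφ.contMDiff (fun _ _ _ => rfl)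
    fun p => (hφ.timelike p).isMetricForm

/-- The tangential part of the acceleration of a curve in a hypersurface is its intrinsic
acceleration. -/
lemma tw_acceleration_dmap (hg : IsLorentzMetric g) (hφ : IsTimelikeHypersurface (d := d) g φ)
    {c : ℝ → S} {s : ℝ} (hc : ContMDiffAt 𝓘(ℝ, ℝ) (𝓡 d) ∞ c s) (w : Vec d) :
    tw g (φ (c s)) (acceleration g (φ ∘ c) s) (dmap φ (c s) w) =
      tw (inducedMetric g φ) (c s) (acceleration (inducedMetric (d := d) g φ) c s) w := by
  have hsm := hφ.contMDiff
  have hh := hφ.isChartMetric hg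
  have hmd := hc.mdifferentiableAt (n := ∞) (by simp)
  have hφmd : ∀ p, MDifferentiableAt (𝓡 d) (𝓡 n) φ p := hsm.mdifferentiable (by simp)
  rw [acceleration_eq_dcov g ((hφmd _).comp s hmd), acceleration_eq_dcov _ hmd,
    ← tw_dcov_dmap hg.isChartMetric hh hsm.contMDiffAt
      (Filter.Eventually.of_forall fun p u v => rfl) hmd
      ((contDiffAt_hat_vel (mem_crd_source (c s)) hc).differentiableAt (by simp))]
  congr 2
  refine covd_congr Filter.EventuallyEq.rfl ?_
  filter_upwards [eventually_mdifferentiableAt_curve hc] with t ht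
  simp only [hat, vel_comp (hφmd _) ht]

variable {N : S → Vec n} {U : Set S}

lemma IsUnitNormalOn.contMDiffAt (hN : IsUnitNormalOn (d := d) g φ N U) (hU : IsOpen U) {p : S}
    (hp : p ∈ U) : ContMDiffAt (𝓡 d) (𝓡 n).tangent ∞
      (fun p => (⟨φ p, N p⟩ : TangentBundle (𝓡 n) M)) p :=
  hN.smooth.contMDiffAt (hU.mem_nhds hp)

lemma secondForm_vel (hN : IsUnitNormalOn (d := d) g φ N U) (hU : IsOpen U) {c : ℝ → S} {s : ℝ}
    (hc : ContMDiffAt 𝓘(ℝ, ℝ) (𝓡 d) ∞ c s) (hs : c s ∈ U) (w : Vec d) :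
    secondForm (d := d) g φ N (c s) (vel c s) w =
      tw g (φ (c s)) (dcov g (φ ∘ c) (N ∘ c) s) (dmap φ (c s) w) := by
  have h := covAlong_vel_of_smooth (d' := d) g (hN.contMDiffAt hU hs)
    (hc.mdifferentiableAt (n := ∞) (by simp))
  rw [← h]
  rfl

/-- The normal part of the Gauss formula: `g(∇_ċ W, n) = -χ(ċ, w)` for a tangential field `W = dφ w`
along a curve of the hypersurface. -/
lemma tw_dcov_normal (hg : IsLorentzMetric g) (hφ : IsTimelikeHypersurface (d := d) g φ)
    (hN : IsUnitNormalOn (d := d) g φ N U) (hU : IsOpen U) {c : ℝ → S} {s : ℝ}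
    (hc : ContMDiffAt 𝓘(ℝ, ℝ) (𝓡 d) ∞ c s) (hs : c s ∈ U) {W : ℝ → Vec d}
    (hW : DifferentiableAt ℝ (hat (d := n) (φ (c s)) (φ ∘ c) fun t => dmap φ (c t) (W t)) s) :
    tw g (φ (c s)) (N (c s)) (dcov g (φ ∘ c) (fun t => dmap φ (c t) (W t)) s) =
      -secondForm (d := d) g φ N (c s) (vel c s) (W s) := by
  have hmd := hc.mdifferentiableAt (n := ∞) (by simp)
  have hγ : MDifferentiableAt 𝓘(ℝ, ℝ) (𝓡 n) (φ ∘ c) s :=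
    (hφ.contMDiff.mdifferentiableAt (by simp)).comp s hmd
  have hNh : DifferentiableAt ℝ (hat (d := n) (φ (c s)) (φ ∘ c) (N ∘ c)) s :=
    (contDiffAt_hat_comp (mem_crd_source (φ (c s))) (hN.contMDiffAt hU hs) hc).differentiableAt
      (by simp)
  have h1 := hasDerivAt_tw hg.isChartMetric hγ hNh hW
  -- The identity comes from differentiating `g(n, dφ W) = 0` along the curve.
  have h2 : (fun t => tw g ((φ ∘ c) t) ((N ∘ c) t) (dmap φ (c t) (W t))) =ᶠ[𝓝 s] fun _ => 0 := by
    filter_upwards [hc.continuousAt.preimage_mem_nhds (hU.mem_nhds hs)] with t ht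
    exact hN.normal _ ht _
  have h3 := (h1.congr_of_eventuallyEq h2.symm).unique (hasDerivAt_const s (0 : ℝ))
  rw [secondForm_vel hN hU hc hs]
  simp only [Function.comp_apply] at h3 ⊢
  linarith

/-- The case in which the tangential field is the velocity itself; through it `χ` enters the
equations of motion. -/
lemma tw_acceleration_normal (hg : IsLorentzMetric g) (hφ : IsTimelikeHypersurface (d := d) g φ)
    (hN : IsUnitNormalOn (d := d) g φ N U) (hU : IsOpen U) {c : ℝ → S} {s : ℝ}
    (hc : ContMDiffAt 𝓘(ℝ, ℝ) (𝓡 d) ∞ c s) (hs : c s ∈ U) :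
    tw g (φ (c s)) (acceleration g (φ ∘ c) s) (N (c s)) =
      -secondForm (d := d) g φ N (c s) (vel c s) (vel c s) := by
  have hmd := hc.mdifferentiableAt (n := ∞) (by simp)
  have hφmd : ∀ p, MDifferentiableAt (𝓡 d) (𝓡 n) φ p := hφ.contMDiff.mdifferentiable (by simp)
  have hγ : ContMDiffAt 𝓘(ℝ, ℝ) (𝓡 n) ∞ (φ ∘ c) s := hφ.contMDiff.contMDiffAt.comp s hc
  have hev : hat (d := n) (φ (c s)) (φ ∘ c) (vel (φ ∘ c)) =ᶠ[𝓝 s]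
      hat (φ (c s)) (φ ∘ c) fun t => dmap φ (c t) (vel (d := d) c t) := by
    filter_upwards [eventually_mdifferentiableAt_curve hc] with t ht
    simp only [hat, vel_comp (hφmd _) ht]
  have h1 := (contDiffAt_hat_vel (mem_crd_source (φ (c s))) hγ).differentiableAt (by simp)
  rw [← tw_dcov_normal hg hφ hN hU hc hs (hev.differentiableAt_iff.mp h1),
    acceleration_eq_dcov g ((hφmd _).comp s hmd), (hg.isChartMetric.metric _).symm]
  congr 1
  exact covd_congr Filter.EventuallyEq.rfl hev

/-- A coordinate line through `p`; it turns a statement about a tangent vector into one about a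
curve. -/
lemma exists_curve_of_vel (p : S) (v : Vec d) : ∃ c : ℝ → S, c 0 = p ∧ vel c 0 = v ∧
    ContMDiffAt 𝓘(ℝ, ℝ) (𝓡 d) ∞ c 0 ∧ ∀ᶠ t in 𝓝 (0 : ℝ), crd p (c t) = crd p p + t • v := by
  set y : ℝ → Vec d := fun t => crd p p + t • v with hy
  have hy0 : y 0 = crd p p := by simp [hy]
  have hyd : ContDiff ℝ ∞ y := by fun_prop
  have hev : ∀ᶠ t in 𝓝 (0 : ℝ), y t ∈ (crd (d := d) p).target := by
    refine hyd.continuous.continuousAt.preimage_mem_nhds ?_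
    rw [hy0]
    exact extChartAt_target_mem_nhds p
  have hev2 : ∀ᶠ t in 𝓝 (0 : ℝ), crd (d := d) p (((crd (d := d) p).symm ∘ y) t) = y t :=
    hev.mono fun t ht => (crd p).right_inv ht
  have h0 : ((crd (d := d) p).symm ∘ y) 0 = p := by
    simp only [Function.comp_apply, hy0]
    exact (crd p).left_inv (mem_crd_source p)
  have hsm := contMDiffAt_symm_comp hyd.contDiffAt hev.self_of_nhds
  refine ⟨(crd (d := d) p).symm ∘ y, h0, ?_, hsm, hev2⟩
  have h1 := hasDerivAt_curve (x₁ := p) (hsm.mdifferentiableAt (by simp))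
    (by rw [h0]; exact mem_crd_source p)
  have h2 : HasDerivAt y v 0 := by
    have := ((hasDerivAt_id (0 : ℝ)).smul_const v).const_add (crd (d := d) p p)
    simpa [hy] using this
  have h3 := (h1.congr_of_eventuallyEq (hev2.mono fun t ht => ht.symm)).unique h2
  rw [h0] at h3
  rwa [tcc_self] at h3

/-- The second fundamental form in terms of second derivatives of the immersion. -/
lemma secondForm_eq (hg : IsLorentzMetric g) (hφ : IsTimelikeHypersurface (d := d) g φ)
    (hN : IsUnitNormalOn (d := d) g φ N U) (hU : IsOpen U) {p : S} (hp : p ∈ U) (v w : Vec d) :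
    secondForm (d := d) g φ N p v w = -(tw g (φ p)
      (fderiv ℝ (fderiv ℝ (crd (d := n) (φ p) ∘ φ ∘ (crd (d := d) p).symm)) (crd p p) v w) (N p) +
      koszul (fderiv ℝ (localTwo g (φ p)) (crd (φ p) (φ p))) (dmap φ p v) (dmap φ p w) (N p)) := by
  obtain ⟨c, rfl, rfl, hc, hev⟩ := exists_curve_of_vel p v
  have hgc := hg.isChartMetric
  set p := c 0 with hpdef
  set v := vel (d := d) c 0 with hvdef
  have hmd := hc.mdifferentiableAt (n := ∞) (by simp)
  have hφmd : ∀ p, MDifferentiableAt (𝓡 d) (𝓡 n) φ p := hφ.contMDiff.mdifferentiable (by simp)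
  have hpp := mem_crd_source (d := d) p
  have hφp := mem_crd_source (d := n) (φ p)
  set ψ := crd (d := n) (φ p) ∘ φ ∘ (crd (d := d) p).symm with hψdef
  have hψ : ContDiffAt ℝ ∞ ψ (crd p p) := contDiffAt_in_charts hpp hφp hφ.contMDiff.contMDiffAt
  -- Extending `w` with constant components makes the coordinates of its push-forward `Dψ(·) w`,
  -- whose derivative along the line is the Hessian.
  let W : ℝ → Vec d := fun t => tcc p (c t) (c t) w
  have hW0 : W 0 = w := tcc_self p w
  have hhat : hat (d := n) (φ p) (φ ∘ c) (fun t => dmap φ (c t) (W t)) =ᶠ[𝓝 0]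
      fun t => fderiv ℝ ψ (crd p p + t • v) w := by
    filter_upwards [hev, hc.continuousAt.eventually (eventually_fderiv_in_charts hpp hφp
      hφ.contMDiff.contMDiffAt)] with t h1 h2
    rw [← h1, h2.2.2.2]
    rfl
  have hψ2 : HasFDerivAt (fderiv ℝ ψ) (fderiv ℝ (fderiv ℝ ψ) (crd p p)) (crd p p + (0 : ℝ) • v) := by
    rw [zero_smul, add_zero]
    exact ((hψ.fderiv_right (m := ∞) (by simp)).differentiableAt (by simp)).hasFDerivAt
  have hline : HasDerivAt (fun t : ℝ => crd p p + t • v) v 0 := by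
    have := ((hasDerivAt_id (0 : ℝ)).smul_const v).const_add (crd (d := d) p p)
    simpa using this
  have hder : HasDerivAt (fun t : ℝ => fderiv ℝ ψ (crd p p + t • v) w)
      (fderiv ℝ (fderiv ℝ ψ) (crd p p) v w) 0 := by
    have := (hψ2.comp_hasDerivAt (0 : ℝ) hline).clm_apply (hasDerivAt_const (0 : ℝ) w)
    simpa using this
  have key := tw_dcov_normal hg hφ hN hU hc hp (W := W)
    (hhat.differentiableAt_iff.mpr hder.differentiableAt)
  rw [hW0] at key
  rw [← neg_eq_iff_eq_neg.mpr key, dcov, covd, (hgc.metric _).symm, map_add, add_apply]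
  have e1 : deriv (hat (d := n) ((φ ∘ c) 0) (φ ∘ c) fun t => dmap φ (c t) (W t)) 0 =
      fderiv ℝ (fderiv ℝ ψ) (crd p p) v w := hhat.deriv_eq.trans hder.deriv
  have e2 : deriv (crd (d := n) ((φ ∘ c) 0) ∘ φ ∘ c) 0 = dmap φ p v := by
    rw [deriv_crd_self ((hφmd _).comp 0 hmd), vel_comp (hφmd _) hmd]
  rw [e1, e2, hat_self, hW0]
  congr 2
  have := chris_apply (hgc.metric_local hφp) (dmap φ p v) (dmap φ p w) (N p)
  rw [localTwo_self] at this
  exact this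

/-- Both terms of `secondForm_eq` are symmetric: the Hessian of the immersion and the Christoffel
expression of the ambient metric. -/
lemma secondForm_symm (hg : IsLorentzMetric g) (hφ : IsTimelikeHypersurface (d := d) g φ)
    (hN : IsUnitNormalOn (d := d) g φ N U) (hU : IsOpen U) {p : S} (hp : p ∈ U) (v w : Vec d) :
    secondForm (d := d) g φ N p v w = secondForm (d := d) g φ N p w v := by
  have hgc := hg.isChartMetric
  have hφp := mem_crd_source (d := n) (φ p)
  have hψ : ContDiffAt ℝ ∞ (crd (d := n) (φ p) ∘ φ ∘ (crd (d := d) p).symm) (crd p p) :=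
    contDiffAt_in_charts (mem_crd_source p) hφp hφ.contMDiff.contMDiffAt
  have hsym := ((hψ.of_le (m := 2) (WithTop.coe_le_coe.mpr le_top)).isSymmSndFDerivAt (by simp)).eq
  have hD := fderiv_symm_of_eventually_symm ((hgc.smooth _ hφp).differentiableAt (by simp))
    ((hgc.eventually_metric_local hφp).mono fun z hz => hz.symm)
  rw [secondForm_eq hg hφ hN hU hp, secondForm_eq hg hφ hN hU hp, hsym v w]
  simp only [koszul]
  rw [hD (N p) (dmap φ p v)]
  ring

/-- The second fundamental form as a bilinear form. -/
lemma exists_bilinear_secondForm (hg : IsLorentzMetric g)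
    (hφ : IsTimelikeHypersurface (d := d) g φ) (hN : IsUnitNormalOn (d := d) g φ N U)
    (hU : IsOpen U) {p : S} (hp : p ∈ U) :
    ∃ χ : Vec d →ₗ[ℝ] Vec d →ₗ[ℝ] ℝ, ∀ v w, χ v w = secondForm (d := d) g φ N p v w := by
  refine ⟨LinearMap.mk₂ ℝ (fun v w => secondForm (d := d) g φ N p v w) ?_ ?_ ?_ ?_,
    fun v w => rfl⟩ <;> intros <;> simp only [secondForm_eq hg hφ hN hU hp, koszul, map_add,
      map_smul, add_apply, smul_apply, smul_eq_mul] <;> ring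

end Gauss

/-! ### The partially umbilic condition at a point -/

section Pointwise

variable {n d : ℕ}
  {M : Type*} [TopologicalSpace M] [ChartedSpace (Vec n) M] [IsManifold (𝓡 n) ∞ M]
  {S : Type*} [TopologicalSpace S] [ChartedSpace (Vec d) S] [IsManifold (𝓡 d) ∞ S]
  {g : TwoTensor n M} {φ : S → M} {k : VField n M} {A : OneTensor n M} {m q En : ℝ}

lemma kappa_apply (hφ : IsTimelikeHypersurface (d := d) g φ) (p : S) (w : Vec d) :
    tw (inducedMetric (d := d) g φ) p (kappa g k φ p) w = tw g (φ p) (k (φ p)) (dmap φ p w) :=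
  (hφ.timelike p).isMetricForm.sharp_apply
    ((tw g (φ p) (k (φ p))).comp (dmap φ p)).toLinearMap.isLinear w

lemma kappa_ne_zero (hφ : IsTimelikeHypersurface (d := d) g φ)
    (hort : NowhereOrthogonal (d := d) g k φ) (p : S) : (kappa g k φ p : Vec d) ≠ 0 := by
  intro h
  obtain ⟨w, hw⟩ := hort p
  apply hw
  have := kappa_apply (k := k) hφ p w
  rw [h, map_zero, zero_apply] at this
  exact this.symm

/-- The bound on `κ²` in the form that makes `H` Lorentzian; for `m = 0` the tensor `H` is `h`
itself. -/
lemma one_add_kappa_sq_pos {p : S}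
    (hE : kineticEnergy k A q En (φ p) ≠ 0)
    (hκ : m ≠ 0 → inducedMetric (d := d) g φ p (kappa g k φ p) (kappa g k φ p) >
      -(kineticEnergy k A q En (φ p) ^ 2 / m ^ 2)) :
    0 < 1 + m ^ 2 / kineticEnergy k A q En (φ p) ^ 2 *
      tw (inducedMetric (d := d) g φ) p (kappa g k φ p) (kappa g k φ p) := by
  set E := kineticEnergy k A q En (φ p)
  rcases eq_or_ne m 0 with h | h
  · simp [h]
  · have h1 : tw (inducedMetric (d := d) g φ) p (kappa g k φ p) (kappa g k φ p) >
      -(E ^ 2 / m ^ 2) := hκ h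
    have hE2 : 0 < E ^ 2 := by positivity
    have hm2 : 0 < m ^ 2 := by positivity
    have h2 := mul_lt_mul_of_pos_left h1 (div_pos hm2 hE2)
    have h3 : m ^ 2 / E ^ 2 * -(E ^ 2 / m ^ 2) = -1 := by field_simp
    linarith

/-- A tangent vector pairs with `k` only through `κ`, so the energy condition can be read in the
ambient manifold. -/
lemma isAdmissible_iff (hφ : IsTimelikeHypersurface (d := d) g φ) (p : S) (v : Vec d) :
    IsAdmissible (d := d) g k A m q En φ p v ↔
      tw (inducedMetric (d := d) g φ) p v v = -m ^ 2 ∧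
      tw g (φ p) (k (φ p)) (dmap φ p v) = -kineticEnergy k A q En (φ p) := by
  have hmet : IsMetricForm (tw (inducedMetric (d := d) g φ) p) := (hφ.timelike p).isMetricForm
  rw [← kappa_apply hφ, hmet.symm (kappa g k φ p)]
  rfl

variable {N : S → Vec n} {U : Set S}

lemma tensorH_apply (p : S) (v w : Vec d) : tensorH (d := d) g k A m q En φ p v w =
    tw (inducedMetric (d := d) g φ) p v w + m ^ 2 / kineticEnergy k A q En (φ p) ^ 2 *
      (tw (inducedMetric (d := d) g φ) p (kappa g k φ p) v *
        tw (inducedMetric (d := d) g φ) p (kappa g k φ p) w) := rfl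

lemma tensorF_apply (p : S) (v w : Vec d) : tensorF (d := d) g k A φ N p v w =
    1 / 2 * (fieldStrength g A (φ p) (N p) (dmap φ p v) *
        tw (inducedMetric (d := d) g φ) p (kappa g k φ p) w +
      fieldStrength g A (φ p) (N p) (dmap φ p w) *
        tw (inducedMetric (d := d) g φ) p (kappa g k φ p) v) := rfl

/-- The partially umbilic condition implies `χ(v,v) = -q n·F·v` for admissible `v`. -/
lemma secondForm_of_partially_umbilic (hφ : IsTimelikeHypersurface (d := d) g φ) {p : S}
    (hE : kineticEnergy k A q En (φ p) ≠ 0)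
    {v : Vec d} (hv : IsAdmissible (d := d) g k A m q En φ p v) {c : ℝ}
    (h : secondForm (d := d) g φ N p v v = c * tensorH (d := d) g k A m q En φ p v v +
      q / kineticEnergy k A q En (φ p) * tensorF (d := d) g k A φ N p v v) :
    secondForm (d := d) g φ N p v v = -q * fieldStrength g A (φ p) (N p) (dmap φ p v) := by
  have h1 : tw (inducedMetric (d := d) g φ) p v v = -m ^ 2 := hv.1
  have h2 : tw (inducedMetric (d := d) g φ) p (kappa g k φ p) v =
      -kineticEnergy k A q En (φ p) := by
    rw [kappa_apply hφ]
    exact ((isAdmissible_iff hφ p v).mp hv).2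
  rw [h, tensorH_apply, tensorF_apply, h1, h2]
  field_simp
  ring

/-- If `χ(v,v) = -q n·F·v` for admissible `v`, then the partially umbilic condition holds. -/
lemma partially_umbilic_of_admissible (hg : IsLorentzMetric g) (hd : 3 ≤ d)
    (hφ : IsTimelikeHypersurface (d := d) g φ) (hort : NowhereOrthogonal (d := d) g k φ)
    (hN : IsUnitNormalOn (d := d) g φ N U) (hU : IsOpen U) {p : S} (hp : p ∈ U)
    (hE : kineticEnergy k A q En (φ p) ≠ 0)
    (hκ : m ≠ 0 → inducedMetric (d := d) g φ p (kappa g k φ p) (kappa g k φ p) >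
      -(kineticEnergy k A q En (φ p) ^ 2 / m ^ 2))
    (hadm : ∀ v : Vec d, IsAdmissible (d := d) g k A m q En φ p v →
      secondForm (d := d) g φ N p v v = -q * fieldStrength g A (φ p) (N p) (dmap φ p v))
    (v w : Vec d) :
    secondForm (d := d) g φ N p v w =
      chiTau (d := d) g k A m q En φ N p / ((n : ℝ) - 2) * tensorH (d := d) g k A m q En φ p v w +
      q / kineticEnergy k A q En (φ p) * tensorF (d := d) g k A φ N p v w := by
  have hpos := one_add_kappa_sq_pos hE hκ
  have hmet : IsMetricForm (tw (inducedMetric (d := d) g φ) p) := (hφ.timelike p).isMetricForm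
  obtain ⟨χ, hχ⟩ := exists_bilinear_secondForm hg hφ hN hU hp
  have hlin : IsLinearMap ℝ fun w : Vec d => fieldStrength g A (φ p) (N p) (dmap φ p w) := by
    have h1 := isLinearMap_fieldStrength hg.isChartMetric A (φ p) (N p)
    have h2 : (fun w : Vec d => fieldStrength g A (φ p) (N p) (dmap φ p w)) =
        -((h1.mk' _).comp (dmap φ p).toLinearMap) := by
      funext w
      exact fieldStrength_antisymm g A (φ p) _ _
    rw [h2]
    exact LinearMap.isLinear _
  obtain ⟨c, hc⟩ := exists_partially_umbilic (κ := kappa g k φ p) (m := m) (q := q) hd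
    (hφ.timelike p) (kappa_ne_zero hφ hort p) hE hpos χ
    (fun v w => by rw [hχ, hχ, secondForm_symm hg hφ hN hU hp]) (hlin.mk' _)
    (fun v h1 h2 => by rw [hχ]; exact hadm v ⟨h1, h2⟩)
  have hform : ∀ v w, secondForm (d := d) g φ N p v w =
      c * tensorH (d := d) g k A m q En φ p v w +
      q / kineticEnergy k A q En (φ p) * tensorF (d := d) g k A φ N p v w := by
    intro v w
    rw [← hχ, hc]
    rfl
  have htrace : traceWith (inducedMetric (d := d) g φ p) (secondForm (d := d) g φ N p) =
      c * traceWith (inducedMetric (d := d) g φ p) (tensorH (d := d) g k A m q En φ p) +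
      q / kineticEnergy k A q En (φ p) *
        traceWith (inducedMetric (d := d) g φ p) (tensorF (d := d) g k A φ N p) := by
    refine Eq.trans ?_ (traceWith_linear (tw (inducedMetric (d := d) g φ) p) _ _ _ _)
    exact congrArg (traceWith (tw (inducedMetric (d := d) g φ) p))
      (funext fun v => funext fun w => hform v w)
  have hH : traceWith (inducedMetric (d := d) g φ p) (tensorH (d := d) g k A m q En φ p) =
      d + m ^ 2 / kineticEnergy k A q En (φ p) ^ 2 *
        tw (inducedMetric (d := d) g φ) p (kappa g k φ p) (kappa g k φ p) := by
    have h1 := traceWith_linear (tw (inducedMetric (d := d) g φ) p)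
      (fun v w => tw (inducedMetric (d := d) g φ) p v w)
      (fun v w => tw (inducedMetric (d := d) g φ) p (kappa g k φ p) v *
        tw (inducedMetric (d := d) g φ) p (kappa g k φ p) w) 1
      (m ^ 2 / kineticEnergy k A q En (φ p) ^ 2)
    rw [hmet.traceWith_self, hmet.traceWith_mul_self] at h1
    rw [one_mul] at h1
    rw [← h1]
    refine congrArg (traceWith (tw (inducedMetric (d := d) g φ) p))
      (funext fun v => funext fun w => ?_)
    rw [one_mul]
    rfl
  have hd3 : (3 : ℝ) ≤ d := by exact_mod_cast hd
  -- The trace of `H` is `d - 1` plus the positive quantity in `hpos`, so the trace equation can be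
  -- solved for the factor `c`.
  have hH0 : traceWith (inducedMetric (d := d) g φ p) (tensorH (d := d) g k A m q En φ p) ≠ 0 := by
    rw [hH]
    exact (by linarith : (0 : ℝ) < _).ne'
  have hn2 : (n : ℝ) - 2 ≠ 0 := by
    have : (n : ℝ) = d + 1 := by exact_mod_cast hφ.codim.symm
    rw [this]
    exact (by linarith : (0 : ℝ) < _).ne'
  have hcτ : chiTau (d := d) g k A m q En φ N p / ((n : ℝ) - 2) = c := by
    have h1 : chiTau (d := d) g k A m q En φ N p = ((n : ℝ) - 2) /
        traceWith (inducedMetric (d := d) g φ p) (tensorH (d := d) g k A m q En φ p) *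
        (traceWith (inducedMetric (d := d) g φ p) (secondForm (d := d) g φ N p) -
          q * traceWith (inducedMetric (d := d) g φ p) (tensorF (d := d) g k A φ N p) /
            kineticEnergy k A q En (φ p)) := rfl
    rw [h1, htrace]
    field_simp
    ring
  rw [hcτ]
  exact hform v w

/-- The decomposition of `k` into its tangential and normal parts. -/
lemma eq_dmap_kappa_add (hg : IsLorentzMetric g)
    (hφ : IsTimelikeHypersurface (d := d) g φ)
    (hN : IsUnitNormalOn (d := d) g φ N U) {p : S} (hp : p ∈ U) :
    (k (φ p) : Vec n) =
      dmap (d := d) (n := n) φ p (kappa g k φ p) + tw g (φ p) (k (φ p)) (N p) • N p := by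
  have hnorm : ∀ w, tw g (φ p) (N p) (dmap φ p w) = 0 := hN.normal p hp
  have hunit : tw g (φ p) (N p) (N p) = 1 := hN.unit p hp
  have hsym := (hg.isChartMetric.metric (φ p)).symm
  refine eq_of_tangential_of_normal hφ.codim (hg.isChartMetric.metric (φ p))
    (L := dmap φ p) (hφ.timelike p).isMetricForm.nondeg hnorm hunit (fun w => ?_) ?_
  · rw [map_add, add_apply, map_smul, smul_apply, hnorm, smul_zero, add_zero]
    exact (kappa_apply hφ p w).symm
  · rw [map_add, add_apply, map_smul, smul_apply, hunit, hsym (dmap φ p _), hnorm]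
    simp

end Pointwise

/-! ### Admissibility along worldlines -/

section Worldlines

variable {n d : ℕ}
  {M : Type*} [TopologicalSpace M] [ChartedSpace (Vec n) M] [IsManifold (𝓡 n) ∞ M]
  {S : Type*} [TopologicalSpace S] [ChartedSpace (Vec d) S] [IsManifold (𝓡 d) ∞ S]
  {g : TwoTensor n M} {φ : S → M} {k : VField n M} {A : OneTensor n M} {m q En : ℝ}

/-- A massive particle surface satisfies `χ(v,v) = -q n·F·v` for admissible `v`. -/
lemma IsMassiveParticleSurface.secondForm_eq (hg : IsLorentzMetric g)
    (hS : IsMassiveParticleSurface (d := d) g k A m q En φ) {N : S → Vec n} {U : Set S}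
    (hU : IsOpen U) (hN : IsUnitNormalOn (d := d) g φ N U) {p : S} (hp : p ∈ U) {v : Vec d}
    (hv : IsAdmissible (d := d) g k A m q En φ p v) :
    secondForm (d := d) g φ N p v v = -q * fieldStrength g A (φ p) (N p) (dmap φ p v) := by
  have hφ := hS.hypersurface
  obtain ⟨c, ε, hε, hsm, h0, hw, -⟩ := hS.captures p v hv
  have hc0 : c 0 = p := congrArg (fun x : TangentBundle (𝓡 d) S => x.proj) h0
  have h0m : (0 : ℝ) ∈ Ioo (-ε) ε := ⟨by linarith, hε⟩
  have hc : ContMDiffAt 𝓘(ℝ, ℝ) (𝓡 d) ∞ c 0 := hsm.contMDiffAt (isOpen_Ioo.mem_nhds h0m)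
  -- Equality in the tangent bundle compares vectors over base points that are not syntactically
  -- equal; the trivialisation at `p` turns it into an equality in the model space.
  have hvel : vel c 0 = v := by
    have h1 := congrArg (fun x : TangentBundle (𝓡 d) S =>
      (trivializationAt (Vec d) (TangentSpace (𝓡 d)) p x).2) h0
    have h2 : tcc (c 0) p (c 0) (vel (d := d) c 0) = tcc p p p v := h1
    rw [hc0] at h2
    rwa [tcc_self, tcc_self] at h2
  subst hc0
  subst hvel
  have hlin := isLinearMap_fieldStrength hg.isChartMetric A (φ (c 0)) (vel (φ ∘ c) 0)
  have hforce : acceleration g (φ ∘ c) 0 = q • sharp (tw g (φ (c 0)))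
      fun w => fieldStrength g A (φ (c 0)) w (vel (φ ∘ c) 0) := hw.force 0 h0m
  have h1 := tw_acceleration_normal hg hφ hN hU hc hp
  rw [hforce, map_smul, smul_apply, (hg.isChartMetric.metric _).sharp_apply hlin,
    vel_comp (hφ.contMDiff.mdifferentiableAt (by simp)) (hc.mdifferentiableAt (by simp))] at h1
  rw [smul_eq_mul] at h1
  linarith

/-- The Lorentz force equation in the hypersurface, with lowered index. -/
lemma tw_acceleration_of_solvesLorentzForce (hg : IsLorentzMetric g)
    (hφ : IsTimelikeHypersurface (d := d) g φ) {c : ℝ → S} {J : Set ℝ}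
    (hc : SolvesLorentzForce (inducedMetric (d := d) g φ)
      (inducedField (d := d) (fieldStrength g A) φ) q c J) {s : ℝ} (hs : s ∈ J) (w : Vec d) :
    tw (inducedMetric (d := d) g φ) (c s) (acceleration (inducedMetric (d := d) g φ) c s) w =
      q * fieldStrength g A (φ (c s)) (dmap φ (c s) w) (dmap φ (c s) (vel (d := d) c s)) := by
  have hlin : IsLinearMap ℝ fun w : Vec d =>
      fieldStrength g A (φ (c s)) (dmap φ (c s) w) (dmap φ (c s) (vel (d := d) c s)) := by
    have h1 := isLinearMap_fieldStrength hg.isChartMetric A (φ (c s))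
      (dmap φ (c s) (vel (d := d) c s))
    exact ((h1.mk' _).comp (dmap (d := d) (n := n) φ (c s)).toLinearMap).isLinear
  have h1 : acceleration (inducedMetric (d := d) g φ) c s =
      q • sharp (tw (inducedMetric (d := d) g φ) (c s)) fun w => fieldStrength g A (φ (c s))
        (dmap φ (c s) w) (dmap φ (c s) (vel (d := d) c s)) := hc.force s hs
  rw [h1, map_smul, smul_apply, ((hφ.isChartMetric hg).metric _).sharp_apply hlin]
  rfl

set_option maxHeartbeats 800000 in
/-- Under the partially umbilic condition, a worldline of the hypersurface whose velocity is
admissible at one parameter has admissible velocity throughout. -/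
lemma isAdmissible_of_partially_umbilic (hg : IsLorentzMetric g) (hk : IsSmoothVField k)
    (hkg : IsKilling g k) (hA : IsSmoothOneTensor A) (hkA : IsInvariantPotential g k A)
    (hφ : IsTimelikeHypersurface (d := d) g φ)
    (hEk : ∀ p : S, kineticEnergy k A q En (φ p) ≠ 0)
    (hκ : ∀ p : S, m ≠ 0 →
      inducedMetric (d := d) g φ p (kappa g k φ p) (kappa g k φ p) >
        -(kineticEnergy k A q En (φ p) ^ 2 / m ^ 2))
    (humb : ∀ (U : Set S) (N : S → Vec n), IsOpen U →
        IsUnitNormalOn (d := d) g φ N U → ∀ p ∈ U, ∃ lam : ℝ, ∀ v w : Vec d,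
          secondForm (d := d) g φ N p v w =
            lam * tensorH (d := d) g k A m q En φ p v w +
            q / kineticEnergy k A q En (φ p) * tensorF (d := d) g k A φ N p v w)
    {c : ℝ → S} {J : Set ℝ} (hJ : IsOpen J) (hJc : IsPreconnected J)
    (hc : SolvesLorentzForce (inducedMetric (d := d) g φ)
      (inducedField (d := d) (fieldStrength g A) φ) q c J) {s₀ : ℝ} (hs₀ : s₀ ∈ J)
    (hadm : IsAdmissible (d := d) g k A m q En φ (c s₀) (vel c s₀)) :
    ∀ s ∈ J, IsAdmissible (d := d) g k A m q En φ (c s) (vel c s) := by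
  have hgc := hg.isChartMetric
  have hh := hφ.isChartMetric hg
  have hsm : ∀ s ∈ J, ContMDiffAt 𝓘(ℝ, ℝ) (𝓡 d) ∞ c s := fun s hs =>
    hc.smooth.contMDiffAt (hJ.mem_nhds hs)
  have hφmd : ∀ p, MDifferentiableAt (𝓡 d) (𝓡 n) φ p := hφ.contMDiff.mdifferentiable (by simp)
  have hγ : ∀ s ∈ J, ContMDiffAt 𝓘(ℝ, ℝ) (𝓡 n) ∞ (φ ∘ c) s := fun s hs =>
    hφ.contMDiff.contMDiffAt.comp s (hsm s hs)
  have hmd : ∀ s ∈ J, MDifferentiableAt 𝓘(ℝ, ℝ) (𝓡 d) c s := fun s hs =>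
    (hsm s hs).mdifferentiableAt (by simp)
  have hvel : ∀ s ∈ J, vel (d := n) (φ ∘ c) s = dmap φ (c s) (vel (d := d) c s) := fun s hs =>
    vel_comp (hφmd _) (hmd s hs)
  have hforce : ∀ s ∈ J, ∀ w : Vec d, tw (inducedMetric (d := d) g φ) (c s)
      (acceleration (inducedMetric (d := d) g φ) c s) w =
      q * fieldStrength g A (φ (c s)) (dmap φ (c s) w) (dmap φ (c s) (vel (d := d) c s)) :=
    fun s hs w => tw_acceleration_of_solvesLorentzForce hg hφ hc hs w
  -- the mass is conserved
  have hmass : ∀ s ∈ J, tw (inducedMetric (d := d) g φ) (c s) (vel c s) (vel c s) = -m ^ 2 := by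
    have hder : ∀ s ∈ J, HasDerivAt
        (fun t => tw (inducedMetric (d := d) g φ) (c t) (vel c t) (vel c t)) 0 s := by
      intro s hs
      have hv := (contDiffAt_hat_vel (mem_crd_source (c s)) (hsm s hs)).differentiableAt
        (n := ∞) (by simp)
      refine (hasDerivAt_tw hh (hmd s hs) hv hv).congr_deriv ?_
      rw [← acceleration_eq_dcov _ (hmd s hs), (hh.metric _).symm (vel c s), hforce s hs,
        fieldStrength_self]
      simp
    intro s hs
    rw [eqOn_const_of_hasDerivAt_zero hJ hJc hder hs₀ s hs]
    exact hadm.1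
  -- so is the energy
  set f : ℝ → ℝ := fun t => tw g (φ (c t)) (k (φ (c t))) (vel (φ ∘ c) t) +
    q * cov A (φ (c t)) (k (φ (c t))) + En with hf
  have hfE : ∀ s, f s = tw g (φ (c s)) (k (φ (c s))) (vel (φ ∘ c) s) +
      kineticEnergy k A q En (φ (c s)) := by
    intro s
    have : kineticEnergy k A q En (φ (c s)) = En - -(q * cov A (φ (c s)) (k (φ (c s)))) := rfl
    rw [this, hf]
    ring
  have hfder : ∀ s ∈ J, HasDerivAt f (tw g (φ (c s)) (k (φ (c s))) (acceleration g (φ ∘ c) s) +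
      q * fieldStrength g A (φ (c s)) (vel (φ ∘ c) s) (k (φ (c s)))) s := fun s hs =>
    (hasDerivAt_energy hgc hk hkg hA hkA q (hγ s hs)).add_const En
  have hloc : ∀ s ∈ J, f s = 0 → ∀ᶠ t in 𝓝 s, f t = 0 := by
    intro s hs hfs
    -- Unit normals are available only locally, so the vanishing of `f` is first propagated near
    -- `s`.
    obtain ⟨U, N, hU, hsU, hN⟩ := exists_isUnitNormalOn hg hφ hφ.contMDiff hh (c s)
    let γ : ℝ → M := φ ∘ c
    let kc : ℝ → Vec n := fun t => k (γ t)
    let Nc : ℝ → Vec n := N ∘ c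
    let a : ℝ → ℝ := fun t => tw g (γ t) (kc t) (vel γ t)
    let E : ℝ → ℝ := fun t => kineticEnergy k A q En (γ t)
    let ν : ℝ → ℝ := fun t => tw g (γ t) (kc t) (Nc t)
    let Kk : ℝ → ℝ := fun t => tw g (γ t) (kc t) (kc t) - ν t ^ 2
    let Fv : ℝ → ℝ := fun t => fieldStrength g A (γ t) (Nc t) (vel γ t)
    let Fk : ℝ → ℝ := fun t => fieldStrength g A (γ t) (Nc t) (kc t)
    -- This is `χ(v,κ)` with `κ = k - ν n`, written in terms of fields along the curve so that its
    -- continuity is visible.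
    let χk : ℝ → ℝ := fun t => tw g (γ t) (dcov g γ Nc t) (kc t) -
      ν t * tw g (γ t) (dcov g γ Nc t) (Nc t)
    let D : ℝ → ℝ := fun t => a t * (1 + m ^ 2 / E t ^ 2 * Kk t)
    -- The umbilicity factor solved from the condition on the pair `(v,κ)`. The hypothesis gives a
    -- factor at each point separately; this formula gives continuity at `s`, because the
    -- denominator there is `-E` times a positive number.
    let lam : ℝ → ℝ := fun t => (χk t - q / E t * (1 / 2 * (Fv t * Kk t + Fk t * a t))) / D t
    -- The cofactor of `a + E` in `-ν (χ(v,v) + q F(n,v))`, using `a² - E² = (a - E)(a + E)`.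
    let b : ℝ → ℝ := fun t =>
      -ν t * (lam t * (m ^ 2 * (a t - E t) / E t ^ 2) + q * Fv t / E t)
    have hEs : E s ≠ 0 := hEk (c s)
    have has : a s = -E s := by
      have := hfE s
      rw [hfs] at this
      exact eq_neg_of_add_eq_zero_left this.symm
    -- pointwise identities
    have hker : ∀ t, c t ∈ U →
        kc t = dmap (d := d) (n := n) φ (c t) (kappa g k φ (c t)) + ν t • Nc t := fun t ht =>
      eq_dmap_kappa_add hg hφ hN ht
    have hKk : ∀ t, c t ∈ U → tw (inducedMetric (d := d) g φ) (c t) (kappa g k φ (c t))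
        (kappa g k φ (c t)) = Kk t := by
      intro t ht
      rw [kappa_apply hφ]
      have h1 : dmap (d := d) (n := n) φ (c t) (kappa g k φ (c t)) = kc t - ν t • Nc t := by
        rw [hker t ht]; abel
      rw [h1, map_sub, map_smul, smul_eq_mul]
      simp only [Kk, sq]
      rfl
    have hDpos : ∀ t, c t ∈ U → 0 < 1 + m ^ 2 / E t ^ 2 * Kk t := by
      intro t ht
      have h1 := one_add_kappa_sq_pos (k := k) (A := A) (q := q) (En := En) (p := c t) (hEk (c t))
        (hκ (c t))
      rw [hKk t ht] at h1
      exact h1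
    have hkv : ∀ t ∈ J, tw (inducedMetric (d := d) g φ) (c t) (kappa g k φ (c t)) (vel c t) =
        a t := by
      intro t ht
      rw [kappa_apply hφ, ← hvel t ht]
      rfl
    have hFκ : ∀ t, c t ∈ U →
        fieldStrength g A (γ t) (Nc t)
          (dmap (d := d) (n := n) φ (c t) (kappa g k φ (c t))) = Fk t := by
      intro t ht
      have hl := isLinearMap_fieldStrength hgc A (γ t) (Nc t)
      have h1 : fieldStrength g A (γ t) (kc t) (Nc t) =
          fieldStrength g A (γ t) (dmap (d := d) (n := n) φ (c t) (kappa g k φ (c t))) (Nc t) := by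
        rw [hker t ht, hl.map_add, hl.map_smul, fieldStrength_self, smul_zero, add_zero]
      rw [fieldStrength_antisymm, ← h1, ← fieldStrength_antisymm]
    have hode : ∀ t ∈ J, c t ∈ U → a t ≠ 0 → HasDerivAt f (b t * f t) t := by
      intro t ht htU hat
      have hEt : E t ≠ 0 := hEk (c t)
      have hDt := (hDpos t htU).ne'
      refine (hfder t ht).congr_deriv ?_
      obtain ⟨l, hl⟩ := humb U N hU hN (c t) htU
      -- the umbilicity factor
      have hχκ : secondForm (d := d) g φ N (c t) (vel c t) (kappa g k φ (c t)) = χk t := by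
        rw [secondForm_vel hN hU (hsm t ht) htU]
        have h1 : dmap (d := d) (n := n) φ (c t) (kappa g k φ (c t)) = kc t - ν t • Nc t := by
          rw [hker t htU]; abel
        rw [h1, map_sub, map_smul, smul_eq_mul]
        rfl
      have hlv := hl (vel c t) (kappa g k φ (c t))
      have hll := hl (vel c t) (vel c t)
      rw [hχκ, tensorH_apply, tensorF_apply, (hh.metric (c t)).symm (vel c t), hKk t htU,
        hkv t ht] at hlv
      rw [tensorH_apply, tensorF_apply, hmass t ht, hkv t ht] at hll
      have e1 : fieldStrength g A (φ (c t)) (N (c t)) (dmap φ (c t) (vel (d := d) c t)) = Fv t := by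
        rw [← hvel t ht]; rfl
      have e2 : fieldStrength g A (φ (c t)) (N (c t))
          (dmap (d := d) (n := n) φ (c t) (kappa g k φ (c t))) = Fk t :=
        hFκ t htU
      have e3 : kineticEnergy k A q En (φ (c t)) = E t := rfl
      rw [e1, e2, e3] at hlv
      rw [e1, e3] at hll
      have hlam : lam t = l := by
        simp only [lam, D]
        rw [div_eq_iff (mul_ne_zero hat hDt), hlv]
        ring
      -- the derivative of the energy
      have hacc : tw g (φ (c t)) (kc t) (acceleration g (φ ∘ c) t) =
          q * fieldStrength g A (φ (c t))
            (dmap (d := d) (n := n) φ (c t) (kappa g k φ (c t))) (vel (φ ∘ c) t) -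
          ν t * secondForm (d := d) g φ N (c t) (vel c t) (vel c t) := by
        have h1 := tw_acceleration_dmap hg hφ (hsm t ht) (kappa g k φ (c t))
        rw [hforce t ht, ← hvel t ht] at h1
        have h2 := tw_acceleration_normal hg hφ hN hU (hsm t ht) htU
        rw [(hgc.metric _).symm (kc t), hker t htU, map_add, map_smul, h1]
        rw [show Nc t = N (c t) from rfl, h2, smul_eq_mul]
        ring
      -- The tangential force term here is opposite to the one in `hacc`, so only normal
      -- contributions to `f'` survive.
      have hFvk : fieldStrength g A (φ (c t)) (vel (φ ∘ c) t) (kc t) =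
          -fieldStrength g A (φ (c t))
            (dmap (d := d) (n := n) φ (c t) (kappa g k φ (c t))) (vel (φ ∘ c) t) -
          ν t * Fv t := by
        have hl2 := isLinearMap_fieldStrength hgc A (φ (c t)) (vel (φ ∘ c) t)
        rw [fieldStrength_antisymm, hker t htU, hl2.map_add, hl2.map_smul, smul_eq_mul]
        simp only [Fv, γ, Function.comp_apply]
        ring
      have hft : f t = a t + E t := hfE t
      refine Eq.trans (b := tw g (φ (c t)) (kc t) (acceleration g (φ ∘ c) t) +
        q * fieldStrength g A (φ (c t)) (vel (φ ∘ c) t) (kc t)) rfl ?_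
      rw [hacc, hFvk, hll, hft]
      simp only [b, hlam]
      field_simp
      ring
    -- continuity of the coefficient
    have hγs := hγ s hs
    have hγmd : MDifferentiableAt 𝓘(ℝ, ℝ) (𝓡 n) γ s := hγs.mdifferentiableAt (by simp)
    have hkh : ContDiffAt ℝ ∞ (hat (γ s) γ kc) s := hk.contDiffAt_hat hγs
    have hvh : ContDiffAt ℝ ∞ (hat (γ s) γ (vel γ)) s := contDiffAt_hat_vel (mem_crd_source _) hγs
    have hNh : ContDiffAt ℝ ∞ (hat (γ s) γ Nc) s :=
      contDiffAt_hat_comp (mem_crd_source (φ (c s))) (hN.contMDiffAt hU hsU) (hsm s hs)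
    have hdk := hkh.differentiableAt (by simp)
    have hdv := hvh.differentiableAt (by simp)
    have hdN := hNh.differentiableAt (by simp)
    have ca : ContinuousAt a s := (hasDerivAt_tw hgc hγmd hdk hdv).continuousAt
    have cE : ContinuousAt E s := by
      have h1 := (hasDerivAt_cov g hA hγmd hdk).continuousAt
      exact continuousAt_const.sub (continuousAt_const.mul h1).neg
    have cν : ContinuousAt ν s := (hasDerivAt_tw hgc hγmd hdk hdN).continuousAt
    have cK : ContinuousAt Kk s := (hasDerivAt_tw hgc hγmd hdk hdk).continuousAt.sub (cν.pow 2)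
    have cFv : ContinuousAt Fv s :=
      continuousAt_fieldStrength hgc hA hγs hNh.continuousAt hvh.continuousAt
    have cFk : ContinuousAt Fk s :=
      continuousAt_fieldStrength hgc hA hγs hNh.continuousAt hkh.continuousAt
    have cχ : ContinuousAt χk s := (continuousAt_tw_dcov hgc hγs hNh hkh.continuousAt).sub
      (cν.mul (continuousAt_tw_dcov hgc hγs hNh hNh.continuousAt))
    have cD : ContinuousAt D s := ca.mul (continuousAt_const.add
      ((continuousAt_const.div (cE.pow 2) (pow_ne_zero 2 hEs)).mul cK))
    have hDs : D s ≠ 0 := mul_ne_zero (by rw [has]; exact neg_ne_zero.mpr hEs) (hDpos s hsU).ne'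
    have cl : ContinuousAt lam s := (cχ.sub ((continuousAt_const.div cE hEs).mul
      (continuousAt_const.mul ((cFv.mul cK).add (cFk.mul ca))))).div cD hDs
    have cb : ContinuousAt b s := cν.neg.mul ((cl.mul ((continuousAt_const.mul (ca.sub cE)).div
      (cE.pow 2) (pow_ne_zero 2 hEs))).add ((continuousAt_const.mul cFv).div cE hEs))
    refine eventually_eq_zero_of_hasDerivAt_mul cb ?_ hfs
    filter_upwards [hJ.mem_nhds hs, (hsm s hs).continuousAt.preimage_mem_nhds (hU.mem_nhds hsU),
      ca.eventually_ne (by rw [has]; exact neg_ne_zero.mpr hEs)] with t h1 h2 h3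
    exact hode t h1 h2 h3
  have hf0 : f s₀ = 0 := by
    rw [hfE, hvel s₀ hs₀, ((isAdmissible_iff hφ _ _).mp hadm).2]
    ring
  have hfJ := eq_zero_of_locally_zero hJ hJc
    (fun s hs => (hfder s hs).continuousAt.continuousWithinAt) hloc hs₀ hf0
  intro s hs
  refine (isAdmissible_iff hφ _ _).mpr ⟨hmass s hs, ?_⟩
  have := hfE s
  rw [hfJ s hs, hvel s hs] at this
  exact eq_neg_of_add_eq_zero_left this.symm

end Worldlines

/-! ### From the hypersurface to the ambient manifold -/

section Surfaces

variable {n d : ℕ}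
  {M : Type*} [TopologicalSpace M] [ChartedSpace (Vec n) M] [IsManifold (𝓡 n) ∞ M]
  {S : Type*} [TopologicalSpace S] [ChartedSpace (Vec d) S] [IsManifold (𝓡 d) ∞ S]
  {g : TwoTensor n M} {φ : S → M} {k : VField n M} {A : OneTensor n M} {m q En : ℝ}

/-- A worldline of the hypersurface whose velocity stays admissible is a worldline of the ambient
manifold, if `χ(v,v) = -q n·F·v` for admissible `v`. -/
lemma isWorldline_of_isAdmissible (hg : IsLorentzMetric g)
    (hφ : IsTimelikeHypersurface (d := d) g φ)
    (hχ : ∀ (U : Set S) (N : S → Vec n), IsOpen U → IsUnitNormalOn (d := d) g φ N U →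
      ∀ p ∈ U, ∀ v : Vec d, IsAdmissible (d := d) g k A m q En φ p v →
        secondForm (d := d) g φ N p v v = -q * fieldStrength g A (φ p) (N p) (dmap φ p v))
    {c : ℝ → S} {J : Set ℝ} (hJ : IsOpen J)
    (hc : SolvesLorentzForce (inducedMetric (d := d) g φ)
      (inducedField (d := d) (fieldStrength g A) φ) q c J)
    (hadm : ∀ s ∈ J, IsAdmissible (d := d) g k A m q En φ (c s) (vel c s)) :
    IsWorldline g (fieldStrength g A) m q (φ ∘ c) J := by
  have hgc := hg.isChartMetric
  have hsm : ∀ s ∈ J, ContMDiffAt 𝓘(ℝ, ℝ) (𝓡 d) ∞ c s := fun s hs =>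
    hc.smooth.contMDiffAt (hJ.mem_nhds hs)
  have hvel : ∀ s ∈ J, vel (d := n) (φ ∘ c) s = dmap φ (c s) (vel (d := d) c s) := fun s hs =>
    vel_comp (hφ.contMDiff.mdifferentiableAt (by simp)) ((hsm s hs).mdifferentiableAt (by simp))
  refine ⟨⟨fun s hs => (hφ.contMDiff.contMDiffAt.comp s (hsm s hs)).contMDiffWithinAt,
    fun s hs => ?_⟩, fun s hs => ?_⟩
  · obtain ⟨U, N, hU, hsU, hN⟩ := exists_isUnitNormalOn hg hφ hφ.contMDiff (hφ.isChartMetric hg)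
      (c s)
    have hlin := isLinearMap_fieldStrength hgc A (φ (c s)) (vel (φ ∘ c) s)
    -- The tangential components agree by the equation of motion in `S`, the normal ones by the
    -- condition on `χ`.
    refine eq_of_tangential_of_normal hφ.codim (hgc.metric (φ (c s))) (L := dmap φ (c s))
      (hφ.timelike (c s)).isMetricForm.nondeg (hN.normal _ hsU) (hN.unit _ hsU) (fun w => ?_) ?_
    · rw [tw_acceleration_dmap hg hφ (hsm s hs),
        tw_acceleration_of_solvesLorentzForce hg hφ hc hs, ← hvel s hs, map_smul, smul_apply]
      exact congrArg (q * ·) ((hgc.metric (φ (c s))).sharp_apply hlin _).symm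
    · rw [tw_acceleration_normal hg hφ hN hU (hsm s hs) hsU, hχ U N hU hN _ hsU _ (hadm s hs),
        ← hvel s hs, map_smul, smul_apply, neg_mul, neg_neg]
      exact congrArg (q * ·) ((hgc.metric (φ (c s))).sharp_apply hlin _).symm
  · have h1 : tw (inducedMetric (d := d) g φ) (c s) (vel c s) (vel c s) = -m ^ 2 := (hadm s hs).1
    have h2 : tw g (φ (c s)) (vel (φ ∘ c) s) (vel (φ ∘ c) s) = -m ^ 2 := by
      rw [hvel s hs]
      exact h1
    exact h2

/-- The total energy of a worldline is constant. -/
lemma IsWorldline.totalEnergy_eq (hg : IsLorentzMetric g) (hk : IsSmoothVField k)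
    (hkg : IsKilling g k) (hA : IsSmoothOneTensor A) (hkA : IsInvariantPotential g k A)
    {γ : ℝ → M} {J : Set ℝ} (hJ : IsOpen J) (hJc : IsPreconnected J)
    (hγ : IsWorldline g (fieldStrength g A) m q γ J) {s₀ : ℝ} (hs₀ : s₀ ∈ J) :
    ∀ s ∈ J, totalEnergy g k A q (γ s) (velocity γ s) =
      totalEnergy g k A q (γ s₀) (velocity γ s₀) := by
  have hgc := hg.isChartMetric
  have hder : ∀ s ∈ J, HasDerivAt (fun t => tw g (γ t) (k (γ t)) (vel γ t) +
      q * cov A (γ t) (k (γ t))) 0 s := by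
    intro s hs
    have hlin := isLinearMap_fieldStrength hgc A (γ s) (vel γ s)
    have hforce : acceleration g γ s = q • sharp (tw g (γ s))
      fun w => fieldStrength g A (γ s) w (vel γ s) := hγ.force s hs
    refine (hasDerivAt_energy hgc hk hkg hA hkA q
      (hγ.smooth.contMDiffAt (hJ.mem_nhds hs))).congr_deriv ?_
    have h1 : ∀ w : Vec n, tw g (γ s) w (acceleration g γ s) =
        q * fieldStrength g A (γ s) w (vel γ s) := fun w => by
      rw [(hgc.metric (γ s)).symm w, hforce, map_smul, smul_apply,
        (hgc.metric (γ s)).sharp_apply hlin, smul_eq_mul]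
    -- For an ambient worldline the acceleration term cancels the field term by antisymmetry of `F`,
    -- whatever vector takes the place of `k`.
    have h2 : ∀ w : Vec n, tw g (γ s) w (acceleration g γ s) +
        q * fieldStrength g A (γ s) (vel γ s) w = 0 := fun w => by
      rw [h1, fieldStrength_antisymm g A (γ s) (vel γ s)]
      ring
    exact h2 (k (γ s))
  intro s hs
  exact congrArg Neg.neg (eqOn_const_of_hasDerivAt_zero hJ hJc hder hs₀ s hs)

/-- Existence of worldlines of the hypersurface. -/
lemma exists_worldline_hypersurface (hg : IsLorentzMetric g) (hA : IsSmoothOneTensor A)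
    (hφ : IsTimelikeHypersurface (d := d) g φ) (q : ℝ) (p : S) (v : Vec d) :
    ∃ (c : ℝ → S) (ε : ℝ), 0 < ε ∧ c 0 = p ∧ vel c 0 = v ∧
      SolvesLorentzForce (inducedMetric (d := d) g φ)
        (inducedField (d := d) (fieldStrength g A) φ) q c (Ioo (-ε) ε) := by
  set Ω : Set (Vec d) :=
    (crd (d := d) p).target ∩ (crd (d := d) p).symm ⁻¹' (φ ⁻¹' (crd (d := n) (φ p)).source)
  set ψ : Vec d → Vec n := crd (d := n) (φ p) ∘ φ ∘ (crd (d := d) p).symm with hψ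
  set α := localOne A (φ p)
  -- The exterior derivative of the potential, pulled back by the chart representative `ψ`: a smooth
  -- coordinate expression of the induced field on `Ω`.
  let K : Vec d → Bilin d := fun z =>
    (fderiv ℝ α (ψ z) - (fderiv ℝ α (ψ z)).flip).bilinearComp (fderiv ℝ ψ z) (fderiv ℝ ψ z)
  have hps : p ∈ (crd (d := d) p).source := mem_crd_source p
  have hΩs : ∀ z ∈ Ω, (crd (d := d) p).symm z ∈ (crd (d := d) p).source ∧
      crd p ((crd (d := d) p).symm z) = z := fun z hz =>
    ⟨(crd p).map_target hz.1, (crd p).right_inv hz.1⟩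
  refine exists_solvesLorentzForce (hφ.isChartMetric hg) q p v (Ω := Ω) (K := K) ?_
    inter_subset_left ?_ (fun z hz => ?_) (fun x hx hxΩ u w => ?_)
  · exact (continuousOn_extChartAt_symm (I := 𝓡 d) p).isOpen_inter_preimage
      (isOpen_extChartAt_target p)
      ((isOpen_extChartAt_source (I := 𝓡 n) (φ p)).preimage hφ.contMDiff.continuous)
  · refine ⟨(crd p).map_source hps, ?_⟩
    rw [mem_preimage, mem_preimage, (crd (d := d) p).left_inv hps]
    exact mem_crd_source (φ p)
  · obtain ⟨h1, h2⟩ := hΩs z hz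
    have hψz : ContDiffAt ℝ ∞ ψ z := by
      have := contDiffAt_in_charts (f := φ) h1 hz.2 hφ.contMDiff.contMDiffAt
      rwa [h2] at this
    have hα : ContDiffAt ℝ ∞ α (ψ z) := hA.contDiffAt_localOne hz.2
    have hDψ : ContDiffAt ℝ ∞ (fderiv ℝ ψ) z := hψz.fderiv_right (by simp)
    have hDα : ContDiffAt ℝ ∞ (fun z => fderiv ℝ α (ψ z)) z :=
      (hα.fderiv_right (m := ∞) (by simp)).comp z hψz
    refine contDiffAt_bilin_of_apply fun a b => ?_
    have e1 := hDψ.clm_apply (contDiffAt_const (c := a))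
    have e2 := hDψ.clm_apply (contDiffAt_const (c := b))
    exact ((hDα.clm_apply e1).clm_apply e2).sub ((hDα.clm_apply e2).clm_apply e1)
  · have hx' : (crd (d := d) p).symm (crd p x) = x := (crd p).left_inv hx
    have hφx : φ x ∈ (crd (d := n) (φ p)).source := by
      have := hxΩ.2
      rwa [mem_preimage, mem_preimage, hx'] at this
    have hψx : ψ (crd p x) = crd (φ p) (φ x) := by
      simp only [hψ, Function.comp_apply, hx']
    have hD : ∀ u, fderiv ℝ ψ (crd p x) (tcc x p x u) = tcc (φ x) (φ p) (φ x) (dmap φ x u) := by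
      intro u
      rw [(hasFDerivAt_in_charts hx hφx
        (hφ.contMDiff.mdifferentiableAt (by simp))).fderiv]
      simp only [ContinuousLinearMap.comp_apply]
      rw [tcc_cancel hx (mem_crd_source x)]
    refine (fieldStrength_eq_extd_chart hg.isChartMetric hA hφx _ _).trans ?_
    rw [← hD, ← hD, ← hψx]
    rfl

end Surfaces

end ChargedSurface

end

/-! ### The equivalence -/

open ChargedSurface

theorem theorem1 {n : ℕ} (hn : 4 ≤ n)
    {M : Type*} [TopologicalSpace M] [ChartedSpace (Vec n) M]
    [IsManifold (𝓡 n) ∞ M]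
    {S : Type*} [TopologicalSpace S] [ChartedSpace (Vec (n - 1)) S]
    [IsManifold (𝓡 (n - 1)) ∞ S]
    (g : TwoTensor n M) (hg : IsLorentzMetric g)
    (k : VField n M) (hk : IsSmoothVField k) (hkg : IsKilling g k)
    (A : OneTensor n M) (hA : IsSmoothOneTensor A)
    (hkA : IsInvariantPotential g k A)
    (m q En : ℝ) (hm : 0 ≤ m)
    (φ : S → M) (hφ : IsTimelikeHypersurface (d := n - 1) g φ)
    (hort : NowhereOrthogonal (d := n - 1) g k φ)
    (hEk : ∀ p : S, kineticEnergy k A q En (φ p) ≠ 0)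
    -- for `m = 0` the bound `-E_k²/m²` is `-∞`, so there is no restriction
    (hκ : ∀ p : S, m ≠ 0 →
      inducedMetric (d := n - 1) g φ p (kappa g k φ p) (kappa g k φ p) >
        -(kineticEnergy k A q En (φ p) ^ 2 / m ^ 2)) :
    List.TFAE [
      -- (i) a massive particle surface
      IsMassiveParticleSurface (d := n - 1) g k A m q En φ,
      -- (ii) `χ(v,v) = -q n·F·v` for all admissible `v`
      ∀ (U : Set S) (N : ∀ p : S, TangentSpace (𝓡 n) (φ p)), IsOpen U →
        IsUnitNormalOn (d := n - 1) g φ N U → ∀ p ∈ U, ∀ v : Vec (n - 1),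
          IsAdmissible (d := n - 1) g k A m q En φ p v →
            secondForm (d := n - 1) g φ N p v v =
              -q * fieldStrength g A (φ p) (N p) (dmap φ p v),
      -- (iii) the partially umbilic condition
      ∀ (U : Set S) (N : ∀ p : S, TangentSpace (𝓡 n) (φ p)), IsOpen U →
        IsUnitNormalOn (d := n - 1) g φ N U → ∀ p ∈ U, ∀ v w : Vec (n - 1),
          secondForm (d := n - 1) g φ N p v w =
            chiTau (d := n - 1) g k A m q En φ N p / ((n : ℝ) - 2) *
              tensorH (d := n - 1) g k A m q En φ p v w +
            q / kineticEnergy k A q En (φ p) *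
              tensorF (d := n - 1) g k A φ N p v w,
      -- (iv) worldlines of `S` with admissible velocity at some point are worldlines of `M`
      ∀ (c : ℝ → S) (J : Set ℝ), IsOpen J → IsPreconnected J →
        SolvesLorentzForce (inducedMetric (d := n - 1) g φ)
          (inducedField (d := n - 1) (fieldStrength g A) φ) q c J →
        (∃ s ∈ J, IsAdmissible (d := n - 1) g k A m q En φ (c s) (velocity (d := n - 1) c s)) →
        IsWorldline g (fieldStrength g A) m q (φ ∘ c) J] := by
  have hd : 3 ≤ n - 1 := by omega
  tfae_have 1 → 2 := fun h U N hU hN p hp v hv => h.secondForm_eq hg hU hN hp hv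
  tfae_have 2 → 3 := fun h U N hU hN p hp v w =>
    partially_umbilic_of_admissible hg hd hφ hort hN hU hp (hEk p) (hκ p) (h U N hU hN p hp) v w
  tfae_have 3 → 4 := by
    rintro h c J hJ hJc hc ⟨s₀, hs₀, hadm⟩
    refine isWorldline_of_isAdmissible hg hφ (fun U N hU hN p hp v hv =>
      secondForm_of_partially_umbilic hφ (hEk p) hv (h U N hU hN p hp v v)) hJ hc ?_
    exact isAdmissible_of_partially_umbilic hg hk hkg hA hkA hφ hEk hκ
      (fun U N hU hN p hp => ⟨_, h U N hU hN p hp⟩) hJ hJc hc hs₀ hadm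
  tfae_have 4 → 1 := by
    refine fun h => ⟨hφ, hort, fun p v hv => ?_⟩
    obtain ⟨c, ε, hε, hc0, hv0, hc⟩ := exists_worldline_hypersurface hg hA hφ q p v
    have h0 : (0 : ℝ) ∈ Ioo (-ε) ε := ⟨by linarith, hε⟩
    subst hc0
    subst hv0
    have hw := h c _ isOpen_Ioo isPreconnected_Ioo hc ⟨0, h0, hv⟩
    refine ⟨c, ε, hε, hc.smooth, rfl, hw, fun s hs => ?_⟩
    -- By conservation only the energy at parameter `0` matters; there admissibility gives the
    -- kinetic energy minus `q A(k)`, which is `En`.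
    refine (hw.totalEnergy_eq hg hk hkg hA hkA isOpen_Ioo isPreconnected_Ioo h0 s hs).trans ?_
    have hvel : vel (φ ∘ c) 0 = dmap φ (c 0) (vel (d := n - 1) c 0) :=
      vel_comp (hφ.contMDiff.mdifferentiableAt (by simp))
        ((hc.smooth.contMDiffAt (isOpen_Ioo.mem_nhds h0)).mdifferentiableAt (by simp))
    have h1 := ((isAdmissible_iff hφ (c 0) (vel c 0)).mp hv).2
    rw [← hvel] at h1
    have h2 : totalEnergy g k A q ((φ ∘ c) 0) (velocity (φ ∘ c) 0) =
      -(tw g (φ (c 0)) (k (φ (c 0))) (vel (φ ∘ c) 0) + q * A (φ (c 0)) (k (φ (c 0)))) := rfl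
    rw [h2, h1, kineticEnergy]
    ring
  tfae_finish
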